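/- **Setting.** Consider $N$ independent two-state (bad $=0$, good $=1$) Markov channels. Channel $i$ moves from bad to good with probability $p^{(i)}_{01}\in[0,1]$, stays good with probability $p^{(i)}_{11}\in[0,1]$, has rate $B_i\in(0,1]$, and its initial state is good with probability $\omega_i(1)\in[0,1]$. Let $1\le K<N$ and $0\le\beta<1$. Channel $i$ is called negatively correlated if $p^{(i)}_{11}<p^{(i)}_{01}$ and positively correlated otherwise; the pair $p_{01}^{(i)}=0$, $p_{11}^{(i)}=1$ is excluded, so that $\omega_o^{(i)}=p_{01}^{(i)}/(p_{01}^{(i)}+1-p_{11}^{(i)})$ is defined. Put $\mathcal T(\omega)=\omega p_{11}+(1-\omega)p_{01}$. In the single-armed bandit with subsidy $m\in\mathbb R$, an arm in belief state $\omega$ is in each slot either made passive (reward $m$, next belief $\mathcal T(\omega)$) or activated (expected reward $\omega B$; next belief $p_{11}$ with probability $\omega$, $p_{01}$ with probability $1-\omega$). $V^{(i)}_{\beta,m}(\omega)$ is the supremum over all policies of the expected total $\beta$-discounted reward from belief $\omega$, and $D^{(i)}_{\beta,m}(\omega)$ is the expected total discounted passive time under the optimal policy that is passive in case of a tie. Put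 $$G_m=\sum_{i=1}^N V^{(i)}_{\beta,m}(\omega_i(1))-m\frac{N-K}{1-\beta},\qquad \bar V_\beta(\Omega(1))=\inf_{m\in\mathbb R}G_m .$$ *Closed forms.* With $L(\omega,\theta)=\min\{k\ge0:\mathcal T^k(\omega)>\theta\}$, the index $W(\omega)$ of a channel is as follows. If $p_{11}\ge p_{01}$: $W(\omega)=\omega B$ for $\omega\le p_{01}$ or $\omega\ge p_{11}$; $W(\omega)=\frac{\omega}{1-\beta p_{11}+\beta\omega}B$ for $\omega_o\le\omega<p_{11}$; and for $p_{01}<\omega<\omega_o$ $$W(\omega)=\frac{\omega-\beta\mathcal T(\omega)+C_2(1-\beta)E}{1-\beta p_{11}-C_1E}\,B,\qquad E=\beta(1-\beta p_{11})-\beta(\omega-\beta\mathcal T(\omega)),$$ with $L=L(p_{01},\omega)$, $Q=(1-\beta p_{11})(1-\beta^{L+1})+(1-\beta)\beta^{L+1}\mathcal T^L(p_{01})$, $C_1=(1-\beta p_{11})(1-\beta^L)/Q$, $C_2=\beta^L\mathcal T^L(p_{01})/Q$. If $p_{11}<p_{01}$: $W(\omega)=\omega B$ for $\omega\le p_{11}$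 or $\omega\ge p_{01}$; $W(\omega)=\frac{\beta p_{01}+\omega(1-\beta)}{1+\beta(p_{01}-\omega)}B$ for $\mathcal T(p_{11})\le\omega<p_{01}$; $W(\omega)=\frac{(1-\beta+\beta C_4)(\beta p_{01}+\omega(1-\beta))}{1-\beta(1-p_{01})-C_3(\beta^2p_{01}+\beta\omega-\beta^2\omega)}B$ for $\omega_o\le\omega<\mathcal T(p_{11})$; and for $p_{11}<\omega<\omega_o$, with $Y=\beta\mathcal T(\omega)-\beta p_{01}-\omega$, $W(\omega)=\frac{-(1-\beta)Y-C_4\beta Y}{1-\beta(1-p_{01})+C_3\beta Y}B$, where $C_3=\frac{1-\beta(1-p_{01})}{R}$, $C_4=\frac{\beta\mathcal T(p_{11})(1-\beta)+\beta^2p_{01}}{R}$, $R=1+(1+\beta)\beta p_{01}-\beta^2\mathcal T(p_{11})$. For a given $m$ let $L_m(z)=\min\{k:W(\mathcal T^k(z))>m\}\in\mathbb N\cup\{\infty\}$; with $L=L_m(z)$ and $s=\mathcal T^L(z)$ (the terms with $\beta^L$ being absent if $L=\infty$) $$V(z)=\tfrac{1-\beta^L}{1-\beta}m+\beta^L\bigl(sB+\beta(sV(p_{11})+(1-s)V(p_{01}))\bigr),\qquad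 D(z)=\tfrac{1-\beta^L}{1-\beta}+\beta^{L+1}\bigl(sD(p_{11})+(1-s)D(p_{01})\bigr),$$ where $V(p_{01}),V(p_{11})$ (and likewise for $D$) are obtained from the two linear equations for $z=p_{01},p_{11}$. *The algorithm.* Input: $\varepsilon>0$ and the data above. Set $\delta=\varepsilon(1-\beta)/K$. 1. For each negatively correlated channel calculate $W(p_{11})$, $W(\mathcal T(p_{11}))$, $W(p_{01})$, $W(\omega_i(1))$ and, if $\omega_i(1)<\omega_o$, also $W(\mathcal T(\omega_i(1)))$. 2. For each positively correlated channel calculate $W(p_{01})$, $W(p_{11})$, $W(\omega_o)$. Find, by repeatedly halving the distance to $\omega_o$ starting from $\delta/N$, an $\bar\omega\in[\omega_o-\frac\delta N,\omega_o)$ with $W(\omega_o)-W(\bar\omega)\le\frac\delta N$. Let $l$ be the least integer with $\mathcal T^{l}(p_{01})>\bar\omega$ and calculate $W(\mathcal T^k(p_{01}))$, $0\le k\le l$. If $\omega_i(1)<\omega_o$, let $d$ be the least integer with $\mathcal T^{d}(\omega_i(1))>\bar\omega$ and calculate $W(\mathcal T^k(\omega_i(1)))$, $0\le k\le d$; otherwise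 calculate only $W(\omega_i(1))$. The gray area of the channel is $[\min\{W(\mathcal T^{l}(p_{01})),W(\mathcal T^{d}(\omega_i(1)))\},W(\omega_o))$ (without the second entry of the minimum if $\omega_i(1)\ge\omega_o$); let $V$ be the union of all gray areas. 3. Sort all calculated indices by merge sort: $a_1\le\dots\le a_h$; set $a_0=0$, $a_{h+1}=1$. 4. For $j=0,1,\dots,h$: skip $[a_j,a_{j+1})$ if it is empty or contained in $V$; otherwise calculate $D=\sum_iD^{(i)}_{\beta,a_j}(\omega_i(1))-\frac{N-K}{1-\beta}$, and stop with $m'=a_j$ if $D\ge0$. If the loop ends without stopping, put $m'=a_{h+1}=1$. 5. Calculate $G$, the closed form of $G_{m'}$; output $m'$ and $G$. Running time is counted in steps of a machine with exact real arithmetic in which a field operation, a power with natural exponent, a logarithm, rounding down, a comparison and a recursive call each cost one step. **Theorem.** Let $\varepsilon>0$, $0\le\beta<1$ and $\rho<1$. There is a constant $C=C(\varepsilon,\beta,\rho)$ such that for all $N$, $K$ with $1\le K<N$, all channels as above with $p_{11}^{(i)}-p_{01}^{(i)}\le\rho$ for every $i$, and all $\omega_i(1)\in[0,1]$, the algorithm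 halts after at most $C\,N^2\log N$ steps, and its output $(m',G)$ satisfies $G=G_{m'}$ and $|G-\bar V_\beta(\Omega(1))|\le\varepsilon$. If every channel is negatively correlated, the output is exact: $G=\bar V_\beta(\Omega(1))$, and $m'$ is the smallest subsidy at which the infimum is attained. -/

import Mathlib

noncomputable section

namespace ChannelAccess

/-! ## Channels and the Lagrangian-relaxation bound -/

/-- A Gilbert-Elliot channel: `p01` is the probability of moving from the bad state `0` to the
good state `1`, `p11` the probability of staying in the good state, and `B` is the rate. -/
structure Channel where
  p01 : ℝ
  p11 : ℝ
  B : ℝ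

/-- Admissible parameters: transition probabilities, and a positive rate, with the maximal rate
normalized to at most one. -/
structure Channel.Admissible (c : Channel) : Prop where
  p01_mem : c.p01 ∈ Set.Icc (0 : ℝ) 1
  p11_mem : c.p11 ∈ Set.Icc (0 : ℝ) 1
  B_mem : c.B ∈ Set.Ioc (0 : ℝ) 1

/-- The one-step update of the belief (the conditional probability of the good state) of an
unobserved channel. -/
def Channel.update (c : Channel) (ω : ℝ) : ℝ := ω * c.p11 + (1 - ω) * c.p01

/-- A deterministic policy for a single arm: in slot `t` (counted from `0`) with belief `ω` the
arm is activated iff `π t ω = true`. -/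
abbrev Policy := ℕ → ℝ → Bool

/-- The policy that is followed from the second slot on. -/
def Policy.shift (π : Policy) : Policy := fun t ω => π (t + 1) ω

/-- The expected reward collected in slot `t` by the single-armed bandit with subsidy `m` when the
initial belief is `ω` and the policy `π` is used. An active arm pays its rate if the channel is
good, so `ω * B` in expectation; a passive arm pays `m`. An active arm reveals its state, so that
the next belief is `p11` with probability `ω` and `p01` with probability `1 - ω`; the belief of a
passive arm is updated by `Channel.update`. -/
def Channel.slotReward (c : Channel) (m : ℝ) : ℕ → Policy → ℝ → ℝ
  | 0, π, ω => if π 0 ω then ω * c.B else m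
  | t + 1, π, ω =>
    if π 0 ω then
      ω * c.slotReward m t π.shift c.p11 + (1 - ω) * c.slotReward m t π.shift c.p01
    else
      c.slotReward m t π.shift (c.update ω)

/-- The expected total discounted reward of a policy. -/
def Channel.totalReward (c : Channel) (β m : ℝ) (π : Policy) (ω : ℝ) : ℝ :=
  ∑' t : ℕ, β ^ t * c.slotReward m t π ω

/-- The value function of the single-armed bandit with subsidy `m`. -/
def Channel.value (c : Channel) (β m ω : ℝ) : ℝ := ⨆ π : Policy, c.totalReward β m π ω

/-- The Lagrangian `∑ᵢ V⁽ⁱ⁾(ωᵢ) - m (N - K) / (1 - β)`. -/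
def lagrangian {N : ℕ} (β : ℝ) (K : ℕ) (c : Fin N → Channel) (ω : Fin N → ℝ) (m : ℝ) : ℝ :=
  ∑ i, (c i).value β m (ω i) - m * ((N : ℝ) - K) / (1 - β)

/-- The Lagrangian-relaxation upper bound. -/
def relaxedBound {N : ℕ} (β : ℝ) (K : ℕ) (c : Fin N → Channel) (ω : Fin N → ℝ) : ℝ :=
  ⨅ m : ℝ, lagrangian β K c ω m

/-! ## Step counting

Programs run on a unit-cost machine with exact real numbers. One step is charged for each field
operation, power with a natural exponent, logarithm, rounding down and comparison, and for each
call of a recursive procedure (which covers the constantly many list and record operations in its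
body). -/

/-- The outcome of a program together with the number of executed steps; the number is `⊤` if the
program does not halt. -/
structure Timed (α : Type) where
  val : α
  steps : ℕ∞

namespace Timed

instance : Monad Timed where
  pure a := ⟨a, 0⟩
  bind x f := ⟨(f x.val).val, x.steps + (f x.val).steps⟩

/-- Charge one step. -/
def tick : Timed Unit := ⟨(), 1⟩

/-- A number that is already available costs nothing. -/
def const (a : ℝ) : Timed ℝ := ⟨a, 0⟩

instance : Coe ℝ (Timed ℝ) := ⟨fun a => const a⟩

instance (n : ℕ) [OfNat ℝ n] : OfNat (Timed ℝ) n := ⟨const (OfNat.ofNat n)⟩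

instance : Add (Timed ℝ) := ⟨fun x y => ⟨x.val + y.val, x.steps + y.steps + 1⟩⟩

instance : Sub (Timed ℝ) := ⟨fun x y => ⟨x.val - y.val, x.steps + y.steps + 1⟩⟩

instance : Mul (Timed ℝ) := ⟨fun x y => ⟨x.val * y.val, x.steps + y.steps + 1⟩⟩

instance : Div (Timed ℝ) := ⟨fun x y => ⟨x.val / y.val, x.steps + y.steps + 1⟩⟩

instance : Pow (Timed ℝ) ℕ := ⟨fun x n => ⟨x.val ^ n, x.steps + 1⟩⟩

/-- Logarithm. -/
def log (a : ℝ) : Timed ℝ := ⟨Real.log a, 1⟩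

/-- Rounding down. -/
def floor (a : ℝ) : Timed ℕ := ⟨⌊a⌋₊, 1⟩

open Classical in
/-- Comparison. -/
def lt (a b : ℝ) : Timed Bool := ⟨decide (a < b), 1⟩

open Classical in
/-- Comparison. -/
def le (a b : ℝ) : Timed Bool := ⟨decide (a ≤ b), 1⟩

open Classical in
/-- Run the tests `test 0`, `test 1`, ... until the first one that succeeds, and return its
number; this does not halt if no test succeeds. -/
def search (test : ℕ → Timed Bool) : Timed ℕ where
  val := sInf {n | (test n).val = true}
  steps :=
    if ∃ n, (test n).val = true then
      ∑ k ∈ Finset.range (sInf {n | (test n).val = true} + 1), ((test k).steps + 1)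
    else ⊤

end Timed

open Timed

/-! ## Evaluation of the closed forms -/

/-- The belief update `𝒯(ω)`. -/
def step (c : Channel) (ω : ℝ) : Timed ℝ := ω * c.p11 + (1 - ω) * c.p01

/-- The stationary probability of the good state, `p01 / (p01 + p10)`. -/
def stationary (c : Channel) : Timed ℝ := c.p01 / (c.p01 + (1 - c.p11))

/-- The `k`-step belief update `𝒯ᵏ(ω)`. -/
def stepIter (c : Channel) (k : ℕ) (ω : ℝ) : Timed ℝ := do
  let x ← (c.p11 - c.p01 : Timed ℝ)
  (c.p01 - x ^ k * (c.p01 - (1 - x) * ω)) / (1 - x)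

/-- For a positively correlated channel and `θ` below the stationary probability: the crossing
time `L(ω, θ) = min {k : 𝒯ᵏ(ω) > θ}`. -/
def crossing (c : Channel) (ω θ : ℝ) : Timed ℕ := do
  if ← lt θ ω then
    return 0
  else
    let x ← (c.p11 - c.p01 : Timed ℝ)
    if ← le x 0 then
      return 1
    else
      let r ← ((c.p01 - θ * (1 - x)) / (c.p01 - ω * (1 - x)) : Timed ℝ)
      let n ← floor (← (log r / log x : Timed ℝ))
      tick
      return n + 1

/-- Whittle's index of the belief `ω`, by its closed form. -/
def index (β : ℝ) (c : Channel) (ω : ℝ) : Timed ℝ := do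
  let ωo ← stationary c
  let y ← step c ω
  if ← le c.p01 c.p11 then
    if ← le ω c.p01 then
      ω * c.B
    else if ← le c.p11 ω then
      ω * c.B
    else if ← le ωo ω then
      ω / (1 - β * c.p11 + β * ω) * c.B
    else
      let n ← crossing c c.p01 ω
      let s ← stepIter c n c.p01
      let q ← ((1 - β * c.p11) * (1 - β ^ (n + 1)) + (1 - β) * β ^ (n + 1) * s : Timed ℝ)
      let C₁ ← ((1 - β * c.p11) * (1 - β ^ n) / q : Timed ℝ)
      let C₂ ← (β ^ n * s / q : Timed ℝ)
      let e ← (β * (1 - β * c.p11) - β * (ω - β * y) : Timed ℝ)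
      (ω - β * y + C₂ * (1 - β) * e) / (1 - β * c.p11 - C₁ * e) * c.B
  else
    if ← le ω c.p11 then
      ω * c.B
    else if ← le c.p01 ω then
      ω * c.B
    else
      let s ← step c c.p11
      if ← le s ω then
        (β * c.p01 + ω * (1 - β)) / (1 + β * (c.p01 - ω)) * c.B
      else
        let q ← (1 + (1 + β) * β * c.p01 - β ^ 2 * s : Timed ℝ)
        let C₃ ← ((1 - β * (1 - c.p01)) / q : Timed ℝ)
        let C₄ ← ((β * s * (1 - β) + β ^ 2 * c.p01) / q : Timed ℝ)
        if ← le ωo ω then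
          (1 - β + β * C₄) * (β * c.p01 + ω * (1 - β)) /
            (1 - β * (1 - c.p01) - C₃ * (β ^ 2 * c.p01 + β * ω - β ^ 2 * ω)) * c.B
        else
          ((1 - β) * (β * c.p01 + ω - β * y) - C₄ * β * (β * y - β * c.p01 - ω)) /
            (1 - β * (1 - c.p01) + C₃ * β * (β * y - β * c.p01 - ω)) * c.B

/-! ## Steps 1 and 2: the indices and the gray area -/

/-- The list of the indices of `z, 𝒯(z), ..., 𝒯ⁿ(z)`. -/
def indices (β : ℝ) (c : Channel) : ℕ → ℝ → Timed (List ℝ)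
  | 0, z => do
    tick
    return [← index β c z]
  | n + 1, z => do
    tick
    let w ← index β c z
    let l ← indices β c n (← step c z)
    return w :: l

/-- A belief `z` with the indices of `z, 𝒯(z), ...` that were calculated. The first `passed` of
them do not exceed the current subsidy and have been removed from the list; `rest` are the
others. -/
structure Track where
  z : ℝ
  passed : ℕ
  rest : List ℝ

/-- The data of one arm: its channel, the tracks of `p01`, `p11` and of the initial belief, and,
for a positively correlated channel, the end points of its gray area. -/
structure Arm where
  c : Channel
  t01 : Track
  t11 : Track
  t1 : Track
  gray : Option (ℝ × ℝ)

/-- A point `ωbar` in `[ωo - η, ωo)` with `W(ωo) - W(ωbar) ≤ η`, found by halving the distance to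
`ωo`, starting from `η`. -/
def searchBar (β : ℝ) (c : Channel) (η ωo : ℝ) : Timed ℝ := do
  let wo ← index β c ωo
  let n ← search fun n => do
    let w ← index β c (← (ωo - η / 2 ^ n : Timed ℝ))
    le (← (wo - w : Timed ℝ)) η
  (ωo - η / 2 ^ n : Timed ℝ)

/-- The data of one arm with initial belief `ω`; `η` bounds the length of the gray area. -/
def prepareArm (β η : ℝ) (c : Channel) (ω : ℝ) : Timed Arm := do
  let ωo ← stationary c
  if ← lt c.p11 c.p01 then
    let l01 ← indices β c 0 c.p01
    let l11 ← indices β c 1 c.p11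
    let l1 ← if ← lt ω ωo then indices β c 1 ω else indices β c 0 ω
    return ⟨c, ⟨c.p01, 0, l01⟩, ⟨c.p11, 0, l11⟩, ⟨ω, 0, l1⟩, none⟩
  else
    let wo ← index β c ωo
    let ωbar ← searchBar β c η ωo
    let l ← crossing c c.p01 ωbar
    let l01 ← indices β c l c.p01
    let l11 ← indices β c 0 c.p11
    let a ← index β c (← stepIter c l c.p01)
    if ← lt ω ωo then
      let d ← crossing c ω ωbar
      let l1 ← indices β c d ω
      let b ← index β c (← stepIter c d ω)
      let lo := if ← le a b then a else b
      return ⟨c, ⟨c.p01, 0, l01⟩, ⟨c.p11, 0, l11⟩, ⟨ω, 0, l1⟩, some (lo, wo)⟩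
    else
      let l1 ← indices β c 0 ω
      return ⟨c, ⟨c.p01, 0, l01⟩, ⟨c.p11, 0, l11⟩, ⟨ω, 0, l1⟩, some (a, wo)⟩

/-- Preparation of all arms. -/
def prepare (β η : ℝ) : List (Channel × ℝ) → Timed (List Arm)
  | [] => do
    tick
    return []
  | (c, ω) :: l => do
    tick
    let a ← prepareArm β η c ω
    let as ← prepare β η l
    return a :: as

/-! ## Step 3: ordering the indices -/

/-- Prepend the list `l` to the list `acc`. -/
def prepend : List ℝ → List ℝ → Timed (List ℝ)
  | [], acc => do
    tick
    return acc
  | a :: l, acc => do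
    tick
    let r ← prepend l acc
    return a :: r

/-- All calculated indices. -/
def collect : List Arm → Timed (List ℝ)
  | [] => do
    tick
    return []
  | a :: as => do
    tick
    let r ← collect as
    let r ← prepend a.t01.rest r
    let r ← prepend a.t11.rest r
    let r ← prepend a.t1.rest r
    match a.gray with
    | none => return r
    | some (_, hi) => return hi :: r

/-- The length of a list. -/
def count : List ℝ → Timed ℕ
  | [] => do
    tick
    return 0
  | _ :: l => do
    tick
    let n ← count l
    return n + 1

/-- Distribute the entries of a list evenly over two lists. -/
def split : List ℝ → Timed (List ℝ × List ℝ)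
  | [] => do
    tick
    return ([], [])
  | a :: l => do
    tick
    let (u, v) ← split l
    return (a :: v, u)

/-- Merge two ascending lists. -/
def merge : List ℝ → List ℝ → Timed (List ℝ)
  | [], v => do
    tick
    return v
  | u, [] => do
    tick
    return u
  | a :: u, b :: v => do
    tick
    if ← le a b then
      let r ← merge u (b :: v)
      return a :: r
    else
      let r ← merge (a :: u) v
      return b :: r
termination_by u v => u.length + v.length

/-- Merge sort; the first argument bounds the depth of the recursion (the length of the list is
always enough). -/
def mergeSort : ℕ → List ℝ → Timed (List ℝ)
  | 0, l => do
    tick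
    return l
  | n + 1, l => do
    tick
    match l with
    | [] => return []
    | [a] => return [a]
    | a :: b :: l =>
      let (u, v) ← split (a :: b :: l)
      let u ← mergeSort n u
      let v ← mergeSort n v
      merge u v

/-! ## Steps 4 and 5: passive time, value, and the search over the regions -/

/-- Remove the indices that do not exceed `m`, counting them. -/
def advanceList (m : ℝ) : ℕ → List ℝ → Timed (ℕ × List ℝ)
  | k, [] => do
    tick
    return (k, [])
  | k, w :: l => do
    tick
    if ← le w m then
      advanceList m (k + 1) l
    else
      return (k, w :: l)

/-- Bring a track to the subsidy `m`. -/
def advanceTrack (m : ℝ) (t : Track) : Timed Track := do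
  let (k, l) ← advanceList m t.passed t.rest
  return ⟨t.z, k, l⟩

/-- Bring all arms to the subsidy `m`. -/
def advance (m : ℝ) : List Arm → Timed (List Arm)
  | [] => do
    tick
    return []
  | a :: as => do
    tick
    let t01 ← advanceTrack m a.t01
    let t11 ← advanceTrack m a.t11
    let t1 ← advanceTrack m a.t1
    let r ← advance m as
    return ⟨a.c, t01, t11, t1, a.gray⟩ :: r

/-- For a track at subsidy `m` with crossing time `L` (`L = passed`, or `L = ∞` if no index is
left): the discounted length `(1 - β ^ L) / (1 - β)` of the passive period, the discount factor
`β ^ L` at its end, and the belief `𝒯ᴸ(z)` at its end (irrelevant if `L = ∞`). -/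
def crossingData (β : ℝ) (c : Channel) (t : Track) : Timed (ℝ × ℝ × ℝ) :=
  match t.rest with
  | [] => do
    let A ← (1 / (1 - β) : Timed ℝ)
    return (A, 0, 0)
  | _ :: _ => do
    let b ← (β ^ t.passed : Timed ℝ)
    let A ← ((1 - b) / (1 - β) : Timed ℝ)
    let s ← stepIter c t.passed t.z
    return (A, b, s)

/-- The expected total discounted income from the initial belief, if each passive slot pays `m`
and an active slot with belief `ω` pays `ω * B`. From each of the beliefs `p01`, `p11` and the
initial one, with `(A, b, s)` from `crossingData`, the income `J` satisfies
`J(z) = A * m + b * (B * s + β * (s * J(p11) + (1 - s) * J(p01)))`; the two equations for `J(p01)`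
and `J(p11)` are solved first. -/
def income (β m B : ℝ) (a : Arm) : Timed ℝ := do
  let (A₀, b₀, s₀) ← crossingData β a.c a.t01
  let (A₁, b₁, s₁) ← crossingData β a.c a.t11
  let (A, b, s) ← crossingData β a.c a.t1
  let r₀ ← (A₀ * m + b₀ * (B * s₀) : Timed ℝ)
  let r₁ ← (A₁ * m + b₁ * (B * s₁) : Timed ℝ)
  let r ← (A * m + b * (B * s) : Timed ℝ)
  let d ← ((1 - β * b₀ * (1 - s₀)) * (1 - β * b₁ * s₁) -
    β * b₀ * s₀ * (β * b₁ * (1 - s₁)) : Timed ℝ)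
  let J₀ ← ((r₀ * (1 - β * b₁ * s₁) + β * b₀ * s₀ * r₁) / d : Timed ℝ)
  let J₁ ← ((r₁ * (1 - β * b₀ * (1 - s₀)) + β * b₁ * (1 - s₁) * r₀) / d : Timed ℝ)
  r + β * b * (s * J₁ + (1 - s) * J₀)

/-- The sum of the discounted passive times of all arms. -/
def totalPassive (β : ℝ) : List Arm → Timed ℝ
  | [] => do
    tick
    return 0
  | a :: as => do
    tick
    let x ← income β 1 0 a
    let y ← totalPassive β as
    (x + y : Timed ℝ)

/-- The sum of the values of all arms at subsidy `m`. -/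
def totalValue (β m : ℝ) : List Arm → Timed ℝ
  | [] => do
    tick
    return 0
  | a :: as => do
    tick
    let x ← income β m a.c.B a
    let y ← totalValue β m as
    (x + y : Timed ℝ)

/-- Whether one of the gray areas `[lo, hi)` contains the nonempty region `[u, v)`. As the
end points of the gray areas are among the ordered indices, this decides for two consecutive
indices `u < v` whether `[u, v)` lies in the union of the gray areas. -/
def covered (u v : ℝ) : List Arm → Timed Bool
  | [] => do
    tick
    return false
  | a :: as => do
    tick
    match a.gray with
    | none => covered u v as
    | some (lo, hi) =>
      if ← le lo u then
        if ← le v hi then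
          return true
        else
          covered u v as
      else
        covered u v as

/-- Go through the regions between consecutive entries of the ordered list, skip those that are
empty or lie in the gray area, and stop at the first one in which the derivative of the Lagrangian,
`(passive time) - κ`, is nonnegative, or else at the last entry of the list. The left end point and
the arms at this subsidy are returned. -/
def sweep (β κ : ℝ) : List ℝ → List Arm → Timed (ℝ × List Arm)
  | [], as => do
    tick
    return (0, as)
  | [u], as => do
    tick
    let as ← advance u as
    return (u, as)
  | u :: v :: l, as => do
    tick
    let skip ← if ← lt u v then covered u v as else pure true
    if skip then
      sweep β κ (v :: l) as
    else
      let as ← advance u as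
      let D ← (totalPassive β as - κ : Timed ℝ)
      if ← le 0 D then
        return (u, as)
      else
        sweep β κ (v :: l) as

/-- The algorithm. Its input is the accuracy `ε`, the discount factor `β`, the numbers `N` and `K`,
and the list of the `N` channels with their initial beliefs. It returns the subsidy `m'` and the
value `G`. -/
def upperBoundAlgorithm (ε β : ℝ) (N K : ℕ) (input : List (Channel × ℝ)) : Timed (ℝ × ℝ) := do
  let δ ← (ε * (1 - β) / (K : ℝ) : Timed ℝ)
  let η ← (δ / (N : ℝ) : Timed ℝ)
  let κ ← (((N : ℝ) - (K : ℝ)) / (1 - β) : Timed ℝ)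
  let arms ← prepare β η input
  let ws ← collect arms
  let h ← count ws
  let ws ← mergeSort h ws
  let grid ← prepend ws [1]
  let (m, arms) ← sweep β κ (0 :: grid) arms
  let G ← (totalValue β m arms - m * κ : Timed ℝ)
  return (m, G)

end ChannelAccess

end

noncomputable section

namespace ChannelAccess

open Set Filter Topology

variable {c : Channel} {β m ω : ℝ}

/-! The core is a single arm with subsidy m. Its value is the fixed point of a contraction that
preserves convexity in the belief (`value_facts`). Hence the advantage `gap` of passivity is convex
in the belief; it equals m at belief 0 and m - B at belief 1, so for m < B its sign changes at most
once and a threshold policy is optimal. If the gap vanishes at ω, the optimality equation collapses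
to a linear system for the values at p01 and p11, and solving it gives m = W(ω) with the closed form
W (`whittle_eq_of_gap_eq_zero`). Since the gap is continuous in m, the intermediate value theorem
turns this into indexability (`gap_nonneg_iff_and_mem`), and the monotonicity of W follows without
touching the formulas.

With the policy frozen, the reward is affine in m, and its slope is the discounted passive time. The
policy that is optimal at m, used at another subsidy, therefore yields a subgradient
(`value_subgradient`), and the Lagrangian is affine between consecutive indices of the beliefs in
the orbits of p01, p11 and the initial belief. In a negatively correlated channel, or above the
limit belief, the largest belief of an orbit is the first or the second one, so finitely many
indices decide everything. Below the limit of a positively correlated channel the orbit rises and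
infinitely many indices may accumulate at W(limit); they are hidden in a gray area of length at most
η = ε(1-β)/(KN).

The sweep finds a point u such that the Lagrangian is nowhere smaller to the right of u, is strictly
larger to the left of some m₀ ≤ u than at m₀, and [m₀, u) is covered by gray areas (`exists_found`).
The cover has length at most Nη and the Lagrangian grows at rate at most K/(1-β), so at most ε is
lost (`Found.lagrangian_le`); without gray areas m₀ = u and the result is exact (`Found.exact`).

For the running time, W satisfies a one-sided Lipschitz bound at the limit with a constant depending
on β only (`whittle_limit_sub_le`), so the number of halvings is bounded independently of N. Orbits
of positively correlated channels approach the limit geometrically at a rate bounded away from 1, so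
each arm needs O(log N) indices. The O(N log N) regions cost O(N) each, the removal of passed
indices being amortized (`sweep_steps`); sorting is of lower order. -/

lemma convex_comb_mem {s t ω : ℝ} {a b : ℝ} (hω : ω ∈ Icc (0 : ℝ) 1) (hs : s ∈ Icc a b)
    (ht : t ∈ Icc a b) : ω * s + (1 - ω) * t ∈ Icc a b := by
  obtain ⟨h0, h1⟩ := hω
  obtain ⟨hs0, hs1⟩ := hs
  obtain ⟨ht0, ht1⟩ := ht
  constructor
  · nlinarith
  · nlinarith

lemma abs_convex_comb_sub_le {s t s' t' ω d : ℝ} (hω : ω ∈ Icc (0 : ℝ) 1) (hs : |s - s'| ≤ d)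
    (ht : |t - t'| ≤ d) : |ω * s + (1 - ω) * t - (ω * s' + (1 - ω) * t')| ≤ d := by
  have := convex_comb_mem hω (abs_le.1 hs) (abs_le.1 ht)
  rw [show ω * s + (1 - ω) * t - (ω * s' + (1 - ω) * t') =
    ω * (s - s') + (1 - ω) * (t - t') by ring]
  exact abs_le.2 this

lemma Channel.Admissible.update_mem (hc : c.Admissible) (hω : ω ∈ Icc (0 : ℝ) 1) :
    c.update ω ∈ Icc (0 : ℝ) 1 :=
  convex_comb_mem hω hc.p11_mem hc.p01_mem

lemma Channel.Admissible.iterate_mem (hc : c.Admissible) (hω : ω ∈ Icc (0 : ℝ) 1) (k : ℕ) :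
    c.update^[k] ω ∈ Icc (0 : ℝ) 1 := by
  induction k with
  | zero => simpa using hω
  | succ k ih => rw [Function.iterate_succ_apply']; exact hc.update_mem ih

/-! ### Rewards of policies -/

lemma slotReward_abs_le (hc : c.Admissible) (m : ℝ) (t : ℕ) :
    ∀ (π : Policy) {ω : ℝ}, ω ∈ Icc (0 : ℝ) 1 → |c.slotReward m t π ω| ≤ max 1 |m| := by
  induction t with
  | zero =>
    intro π ω hω
    simp only [Channel.slotReward]
    have hB := hc.B_mem
    split_ifs
    · refine le_max_of_le_left ?_
      rw [abs_of_nonneg (mul_nonneg hω.1 hB.1.le)]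
      exact mul_le_one₀ hω.2 hB.1.le hB.2
    · exact le_max_right _ _
  | succ t ih =>
    intro π ω hω
    simp only [Channel.slotReward]
    split_ifs
    · rw [abs_le]
      exact convex_comb_mem hω (abs_le.1 (ih _ hc.p11_mem)) (abs_le.1 (ih _ hc.p01_mem))
    · exact ih _ (hc.update_mem hω)

lemma summable_slotReward (hc : c.Admissible) (hβ₀ : 0 ≤ β) (hβ₁ : β < 1) (m : ℝ) (π : Policy)
    (hω : ω ∈ Icc (0 : ℝ) 1) : Summable fun t => β ^ t * c.slotReward m t π ω := by
  refine Summable.of_norm_bounded (g := fun t => β ^ t * max 1 |m|)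
    ((summable_geometric_of_lt_one hβ₀ hβ₁).mul_right _) fun t => ?_
  rw [Real.norm_eq_abs, abs_mul, abs_of_nonneg (pow_nonneg hβ₀ t)]
  exact mul_le_mul_of_nonneg_left (slotReward_abs_le hc m t π hω) (pow_nonneg hβ₀ t)

lemma totalReward_abs_le (hc : c.Admissible) (hβ₀ : 0 ≤ β) (hβ₁ : β < 1) (m : ℝ) (π : Policy)
    (hω : ω ∈ Icc (0 : ℝ) 1) : |c.totalReward β m π ω| ≤ (1 - β)⁻¹ * max 1 |m| := by
  rw [← Real.norm_eq_abs]
  refine tsum_of_norm_bounded (g := fun t => β ^ t * max 1 |m|)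
    ((hasSum_geometric_of_lt_one hβ₀ hβ₁).mul_right _) fun t => ?_
  rw [Real.norm_eq_abs, abs_mul, abs_of_nonneg (pow_nonneg hβ₀ t)]
  exact mul_le_mul_of_nonneg_left (slotReward_abs_le hc m t π hω) (pow_nonneg hβ₀ t)

lemma totalReward_eq (hc : c.Admissible) (hβ₀ : 0 ≤ β) (hβ₁ : β < 1) (m : ℝ) (π : Policy)
    (hω : ω ∈ Icc (0 : ℝ) 1) :
    c.totalReward β m π ω =
      if π 0 ω then ω * c.B + β * (ω * c.totalReward β m π.shift c.p11 +
        (1 - ω) * c.totalReward β m π.shift c.p01)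
      else m + β * c.totalReward β m π.shift (c.update ω) := by
  unfold Channel.totalReward
  rw [(summable_slotReward hc hβ₀ hβ₁ m π hω).tsum_eq_zero_add]
  have h1 := summable_slotReward hc hβ₀ hβ₁ m π.shift hc.p11_mem
  have h0 := summable_slotReward hc hβ₀ hβ₁ m π.shift hc.p01_mem
  have hu := summable_slotReward hc hβ₀ hβ₁ m π.shift (hc.update_mem hω)
  split_ifs with h
  · simp only [pow_zero, one_mul, Channel.slotReward, h, if_true]
    rw [← tsum_mul_left, ← tsum_mul_left, ← (h1.mul_left ω).tsum_add (h0.mul_left (1 - ω)),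
      ← tsum_mul_left]
    congr 1
    refine tsum_congr fun t => ?_
    ring
  · simp only [pow_zero, one_mul, Channel.slotReward, h]
    rw [← tsum_mul_left]
    congr 1
    refine tsum_congr fun t => ?_
    simp only [Bool.false_eq_true, if_false]
    ring

/-- The policy does not depend on the subsidy, so the subsidy enters only through the probability
that the slot is passive, a number between 0 and 1. -/
lemma slotReward_mono (hc : c.Admissible) {m₁ m₂ : ℝ} (h : m₁ ≤ m₂) (t : ℕ) :
    ∀ (π : Policy) {ω : ℝ}, ω ∈ Icc (0 : ℝ) 1 → c.slotReward m₁ t π ω ≤ c.slotReward m₂ t π ω ∧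
      c.slotReward m₂ t π ω ≤ c.slotReward m₁ t π ω + (m₂ - m₁) := by
  induction t with
  | zero =>
    intro π ω hω
    simp only [Channel.slotReward]
    split_ifs <;> constructor <;> linarith
  | succ t ih =>
    intro π ω hω
    simp only [Channel.slotReward]
    split_ifs
    · obtain ⟨a, b⟩ := ih π.shift hc.p11_mem
      obtain ⟨a', b'⟩ := ih π.shift hc.p01_mem
      obtain ⟨h0, h1⟩ := hω
      constructor <;> nlinarith
    · exact ih _ (hc.update_mem hω)

lemma totalReward_mono (hc : c.Admissible) (hβ₀ : 0 ≤ β) (hβ₁ : β < 1) {m₁ m₂ : ℝ} (h : m₁ ≤ m₂)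
    (π : Policy) (hω : ω ∈ Icc (0 : ℝ) 1) :
    c.totalReward β m₁ π ω ≤ c.totalReward β m₂ π ω ∧
      c.totalReward β m₂ π ω ≤ c.totalReward β m₁ π ω + (m₂ - m₁) / (1 - β) := by
  have s1 := summable_slotReward hc hβ₀ hβ₁ m₁ π hω
  have s2 := summable_slotReward hc hβ₀ hβ₁ m₂ π hω
  have sg := (hasSum_geometric_of_lt_one hβ₀ hβ₁).mul_right (m₂ - m₁)
  constructor
  · exact s1.tsum_le_tsum (fun t => mul_le_mul_of_nonneg_left
      (slotReward_mono hc h t π hω).1 (pow_nonneg hβ₀ t)) s2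
  · have : (m₂ - m₁) / (1 - β) = ∑' t, β ^ t * (m₂ - m₁) := by
      rw [sg.tsum_eq, div_eq_inv_mul]
    unfold Channel.totalReward
    rw [this, ← s1.tsum_add sg.summable]
    refine s2.tsum_le_tsum (fun t => ?_) (s1.add sg.summable)
    rw [← mul_add]
    exact mul_le_mul_of_nonneg_left (slotReward_mono hc h t π hω).2 (pow_nonneg hβ₀ t)

lemma bddAbove_totalReward (hc : c.Admissible) (hβ₀ : 0 ≤ β) (hβ₁ : β < 1) (m : ℝ)
    (hω : ω ∈ Icc (0 : ℝ) 1) : BddAbove (range fun π : Policy => c.totalReward β m π ω) :=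
  ⟨_, by rintro _ ⟨π, rfl⟩; exact (abs_le.1 (totalReward_abs_le hc hβ₀ hβ₁ m π hω)).2⟩

lemma totalReward_le_value (hc : c.Admissible) (hβ₀ : 0 ≤ β) (hβ₁ : β < 1) (m : ℝ) (π : Policy)
    (hω : ω ∈ Icc (0 : ℝ) 1) : c.totalReward β m π ω ≤ c.value β m ω :=
  le_ciSup (bddAbove_totalReward hc hβ₀ hβ₁ m hω) π

/-- The growth rate 1/(1-β) is that of an arm which is always passive. It gives continuity in m and
later the growth bound of the Lagrangian. -/
lemma value_mono (hc : c.Admissible) (hβ₀ : 0 ≤ β) (hβ₁ : β < 1) {m₁ m₂ : ℝ} (h : m₁ ≤ m₂)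
    (hω : ω ∈ Icc (0 : ℝ) 1) :
    c.value β m₁ ω ≤ c.value β m₂ ω ∧
      c.value β m₂ ω ≤ c.value β m₁ ω + (m₂ - m₁) / (1 - β) := by
  constructor
  · refine ciSup_le fun π => ?_
    exact ((totalReward_mono hc hβ₀ hβ₁ h π hω).1).trans (totalReward_le_value hc hβ₀ hβ₁ _ _ hω)
  · refine ciSup_le fun π => ?_
    have := totalReward_le_value hc hβ₀ hβ₁ m₁ π hω
    linarith [(totalReward_mono hc hβ₀ hβ₁ h π hω).2]

lemma continuous_value (hc : c.Admissible) (hβ₀ : 0 ≤ β) (hβ₁ : β < 1)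
    (hω : ω ∈ Icc (0 : ℝ) 1) : Continuous fun m => c.value β m ω := by
  have h1 : 0 < 1 - β := by linarith
  refine (LipschitzWith.of_dist_le_mul (K := ⟨(1 - β)⁻¹, by positivity⟩) fun a b => ?_).continuous
  simp only [Real.dist_eq]
  have key : ∀ a b : ℝ, a ≤ b →
      |c.value β b ω - c.value β a ω| ≤ (1 - β)⁻¹ * |b - a| := fun a b h => by
    obtain ⟨h1, h2⟩ := value_mono hc hβ₀ hβ₁ h hω
    rw [abs_of_nonneg (by linarith), abs_of_nonneg (by linarith), ← div_eq_inv_mul]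
    linarith
  rcases le_total a b with h | h
  · rw [abs_sub_comm, abs_sub_comm a]; exact key a b h
  · exact key b a h

/-! ### The optimality equation -/

/-- The optimality operator. -/
def bellman (c : Channel) (β m : ℝ) (U : ℝ → ℝ) (ω : ℝ) : ℝ :=
  max (m + β * U (c.update ω)) (ω * c.B + β * (ω * U c.p11 + (1 - ω) * U c.p01))

lemma bellman_contract (hc : c.Admissible) (hβ₀ : 0 ≤ β) {U U' : ℝ → ℝ} {d : ℝ}
    (h : ∀ ω ∈ Icc (0 : ℝ) 1, |U ω - U' ω| ≤ d) (hω : ω ∈ Icc (0 : ℝ) 1) :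
    |bellman c β m U ω - bellman c β m U' ω| ≤ β * d := by
  unfold bellman
  refine (abs_max_sub_max_le_max _ _ _ _).trans (max_le ?_ ?_)
  · rw [add_sub_add_left_eq_sub, ← mul_sub, abs_mul, abs_of_nonneg hβ₀]
    exact mul_le_mul_of_nonneg_left (h _ (hc.update_mem hω)) hβ₀
  · rw [add_sub_add_left_eq_sub, ← mul_sub, abs_mul, abs_of_nonneg hβ₀]
    exact mul_le_mul_of_nonneg_left
      (abs_convex_comb_sub_le hω (h _ hc.p11_mem) (h _ hc.p01_mem)) hβ₀

lemma iterate_bellman_dist (hc : c.Admissible) (hβ₀ : 0 ≤ β) (m : ℝ) (n : ℕ) :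
    ∀ ω ∈ Icc (0 : ℝ) 1, |(bellman c β m)^[n] 0 ω - (bellman c β m)^[n + 1] 0 ω| ≤
      max 1 |m| * β ^ n := by
  induction n with
  | zero =>
    intro ω hω
    have hB := hc.B_mem
    have hb : 0 ≤ ω * c.B := mul_nonneg hω.1 hB.1.le
    have hb' : ω * c.B ≤ 1 := mul_le_one₀ hω.2 hB.1.le hB.2
    simp only [Function.iterate_zero, id, Function.iterate_succ_apply', bellman, Pi.zero_apply,
      mul_zero, add_zero, pow_zero, mul_one, zero_sub, abs_neg]
    rw [abs_le]
    constructor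
    · have : 0 ≤ max 1 |m| := by positivity
      have := le_max_right m (ω * c.B)
      linarith
    · exact max_le (le_max_of_le_right (le_abs_self m)) (le_max_of_le_left hb')
  | succ n ih =>
    intro ω hω
    rw [Function.iterate_succ_apply', Function.iterate_succ_apply' _ (n + 1)]
    refine (bellman_contract hc hβ₀ ih hω).trans (le_of_eq ?_)
    ring

/-- Activation leads to p11 or p01 whatever the belief was, so the active branch is affine in ω; the
passive branch composes a convex function with an affine map; a maximum of convex functions is
convex. -/
lemma convexOn_bellman (hc : c.Admissible) (hβ₀ : 0 ≤ β) {U : ℝ → ℝ}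
    (h : ConvexOn ℝ (Icc 0 1) U) : ConvexOn ℝ (Icc 0 1) (bellman c β m U) := by
  have h1 : ConvexOn ℝ (Icc 0 1) fun ω => U (c.update ω) := by
    refine ⟨convex_Icc _ _, fun x hx y hy a b ha hb hab => ?_⟩
    have := h.2 (hc.update_mem hx) (hc.update_mem hy) ha hb hab
    convert this using 2
    have hb' : b = 1 - a := by linarith
    subst hb'
    simp only [Channel.update, smul_eq_mul]
    ring
  have h2 : ConvexOn ℝ (Icc 0 1) fun ω => m + β * U (c.update ω) := by
    have := (convexOn_const m (convex_Icc (0 : ℝ) 1)).add (h1.smul hβ₀)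
    exact this
  refine h2.sup ⟨convex_Icc _ _, fun x hx y hy a b ha hb hab => le_of_eq ?_⟩
  have hb' : b = 1 - a := by linarith
  subst hb'
  simp only [smul_eq_mul]
  ring

/-- The fixed point is built as the pointwise limit of the iterates from 0, because convexity and
boundedness then pass to the limit directly. -/
lemma exists_bellman_fixed (hc : c.Admissible) (hβ₀ : 0 ≤ β) (hβ₁ : β < 1) (m : ℝ) :
    ∃ U : ℝ → ℝ, (∀ ω ∈ Icc (0 : ℝ) 1, U ω = bellman c β m U ω) ∧ ConvexOn ℝ (Icc 0 1) U ∧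
      ∃ M, ∀ ω ∈ Icc (0 : ℝ) 1, |U ω| ≤ M := by
  have hd := iterate_bellman_dist hc hβ₀ m
  have hcs : ∀ ω ∈ Icc (0 : ℝ) 1, ∃ L,
      Tendsto (fun n => (bellman c β m)^[n] 0 ω) atTop (𝓝 L) := fun ω hω =>
    cauchySeq_tendsto_of_complete
      (cauchySeq_of_le_geometric β (max 1 |m|) hβ₁ fun n => by
        rw [Real.dist_eq]; exact hd n ω hω)
  choose! U hU using hcs
  refine ⟨U, fun ω hω => ?_, ⟨convex_Icc _ _, fun x hx y hy a b ha hb hab => ?_⟩,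
    max 1 |m| / (1 - β), fun ω hω => ?_⟩
  · have h1 : Tendsto (fun n => (bellman c β m)^[n + 1] 0 ω) atTop (𝓝 (U ω)) :=
      (tendsto_add_atTop_iff_nat 1).2 (hU ω hω)
    refine tendsto_nhds_unique h1 ?_
    simp only [Function.iterate_succ_apply']
    unfold bellman
    exact ((tendsto_const_nhds.add ((hU _ (hc.update_mem hω)).const_mul β))).max
      (tendsto_const_nhds.add ((((hU _ hc.p11_mem).const_mul ω).add
        ((hU _ hc.p01_mem).const_mul (1 - ω))).const_mul β))
  · have hcv : ∀ n, ConvexOn ℝ (Icc 0 1) ((bellman c β m)^[n] 0) := fun n => by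
      induction n with
      | zero => exact convexOn_const 0 (convex_Icc _ _)
      | succ n ih => rw [Function.iterate_succ_apply']; exact convexOn_bellman hc hβ₀ ih
    have hxy := (convex_Icc (0 : ℝ) 1) hx hy ha hb hab
    exact le_of_tendsto_of_tendsto' (hU _ hxy)
      (((hU _ hx).const_smul a).add ((hU _ hy).const_smul b))
      fun n => (hcv n).2 hx hy ha hb hab
  · have := dist_le_of_le_geometric_of_tendsto₀ β (max 1 |m|) hβ₁
      (f := fun n => (bellman c β m)^[n] 0 ω) (fun n => by
        rw [Real.dist_eq]; exact hd n ω hω) (hU ω hω)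
    simpa [Real.dist_eq] using this

/-- A policy that acts in the same way in all slots. -/
def stationaryPolicy (g : ℝ → Bool) : Policy := fun _ ω => g ω

lemma stationaryPolicy_shift (g : ℝ → Bool) :
    (stationaryPolicy g).shift = stationaryPolicy g := rfl

/-! ### Verification: bounded solutions of the recursions are rewards and values -/

lemma tendsto_pow_mul_zero (hβ₀ : 0 ≤ β) (hβ₁ : β < 1) (M : ℝ) :
    Tendsto (fun n : ℕ => β ^ n * M) atTop (𝓝 0) := by
  simpa using (tendsto_pow_atTop_nhds_zero_of_lt_one hβ₀ hβ₁).mul_const M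

/-- Unrolling n slots bounds any policy by U up to an error of order β^n. The policy is quantified
inside the induction since it is shifted in every slot. -/
lemma totalReward_le_of_bellman (hc : c.Admissible) (hβ₀ : 0 ≤ β) (hβ₁ : β < 1) {U : ℝ → ℝ} {M : ℝ}
    (hU : ∀ ω ∈ Icc (0 : ℝ) 1, U ω = bellman c β m U ω) (hM : ∀ ω ∈ Icc (0 : ℝ) 1, |U ω| ≤ M)
    (π : Policy) (hω : ω ∈ Icc (0 : ℝ) 1) : c.totalReward β m π ω ≤ U ω := by
  have key : ∀ n : ℕ, ∀ (π : Policy), ∀ ω ∈ Icc (0 : ℝ) 1,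
      c.totalReward β m π ω ≤ U ω + β ^ n * ((1 - β)⁻¹ * max 1 |m| + M) := by
    intro n
    induction n with
    | zero =>
      intro π ω hω
      have h1 := (abs_le.1 (totalReward_abs_le hc hβ₀ hβ₁ m π hω)).2
      have h2 := (abs_le.1 (hM ω hω)).1
      simp only [pow_zero]
      linarith
    | succ n ih =>
      intro π ω hω
      rw [totalReward_eq hc hβ₀ hβ₁ m π hω, hU ω hω, pow_succ]
      set R := (1 - β)⁻¹ * max 1 |m| + M
      have h1 := ih π.shift _ hc.p11_mem
      have h0 := ih π.shift _ hc.p01_mem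
      have hu := ih π.shift _ (hc.update_mem hω)
      split_ifs
      · have := le_max_right (m + β * U (c.update ω))
          (ω * c.B + β * (ω * U c.p11 + (1 - ω) * U c.p01))
        have h3 := mul_le_mul_of_nonneg_left h1 hω.1
        have h4 := mul_le_mul_of_nonneg_left h0 (sub_nonneg.2 hω.2)
        have h5 := mul_le_mul_of_nonneg_left (add_le_add h3 h4) hβ₀
        unfold bellman
        nlinarith
      · have := le_max_left (m + β * U (c.update ω))
          (ω * c.B + β * (ω * U c.p11 + (1 - ω) * U c.p01))
        have h5 := mul_le_mul_of_nonneg_left hu hβ₀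
        unfold bellman
        nlinarith
  have hlim : Tendsto (fun n : ℕ => U ω + β ^ n * ((1 - β)⁻¹ * max 1 |m| + M)) atTop
      (𝓝 (U ω + 0)) := tendsto_const_nhds.add (tendsto_pow_mul_zero hβ₀ hβ₁ _)
  rw [add_zero] at hlim
  exact ge_of_tendsto' hlim fun n => key n π ω hω

/-- The recursion of a stationary policy contracts by β, so it has only one bounded solution on [0,
1]. This identifies the rewards of the greedy, the index and the always active policies. -/
lemma totalReward_stationary_unique (hc : c.Admissible) (hβ₀ : 0 ≤ β) (hβ₁ : β < 1) {U : ℝ → ℝ}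
    {M : ℝ} {g : ℝ → Bool}
    (hU : ∀ ω ∈ Icc (0 : ℝ) 1, U ω = if g ω then ω * c.B + β * (ω * U c.p11 + (1 - ω) * U c.p01)
      else m + β * U (c.update ω))
    (hM : ∀ ω ∈ Icc (0 : ℝ) 1, |U ω| ≤ M) (hω : ω ∈ Icc (0 : ℝ) 1) :
    c.totalReward β m (stationaryPolicy g) ω = U ω := by
  set J := c.totalReward β m (stationaryPolicy g) with hJ
  have hJr : ∀ ω ∈ Icc (0 : ℝ) 1, J ω = if g ω then ω * c.B + β * (ω * J c.p11 + (1 - ω) * J c.p01)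
      else m + β * J (c.update ω) := fun ω hω =>
    totalReward_eq hc hβ₀ hβ₁ m (stationaryPolicy g) hω
  have key : ∀ n : ℕ, ∀ ω ∈ Icc (0 : ℝ) 1,
      |J ω - U ω| ≤ β ^ n * ((1 - β)⁻¹ * max 1 |m| + M) := by
    intro n
    induction n with
    | zero =>
      intro ω hω
      have h1 := totalReward_abs_le hc hβ₀ hβ₁ m (stationaryPolicy g) hω
      rw [pow_zero, one_mul]
      exact (abs_sub _ _).trans (add_le_add h1 (hM ω hω))
    | succ n ih =>
      intro ω hω
      rw [hJr ω hω, hU ω hω, pow_succ]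
      split_ifs
      · rw [add_sub_add_left_eq_sub, ← mul_sub, abs_mul, abs_of_nonneg hβ₀, mul_comm _ β,
          mul_assoc]
        exact mul_le_mul_of_nonneg_left
          (abs_convex_comb_sub_le hω (ih _ hc.p11_mem) (ih _ hc.p01_mem)) hβ₀
      · rw [add_sub_add_left_eq_sub, ← mul_sub, abs_mul, abs_of_nonneg hβ₀, mul_comm _ β,
          mul_assoc]
        exact mul_le_mul_of_nonneg_left (ih _ (hc.update_mem hω)) hβ₀
  have h0 : |J ω - U ω| ≤ 0 :=
    ge_of_tendsto' (tendsto_pow_mul_zero hβ₀ hβ₁ _) fun n => key n ω hω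
  linarith [abs_nonpos_iff.1 h0]

lemma value_eq_of_bellman (hc : c.Admissible) (hβ₀ : 0 ≤ β) (hβ₁ : β < 1) {U : ℝ → ℝ} {M : ℝ}
    (hU : ∀ ω ∈ Icc (0 : ℝ) 1, U ω = bellman c β m U ω) (hM : ∀ ω ∈ Icc (0 : ℝ) 1, |U ω| ≤ M)
    (hω : ω ∈ Icc (0 : ℝ) 1) : c.value β m ω = U ω := by
  refine le_antisymm (ciSup_le fun π => totalReward_le_of_bellman hc hβ₀ hβ₁ hU hM π hω) ?_
  classical
  -- The greedy policy attains U. It activates in a tie, which is harmless for the value.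
  set g : ℝ → Bool := fun ω => decide (m + β * U (c.update ω) ≤
    ω * c.B + β * (ω * U c.p11 + (1 - ω) * U c.p01)) with hg
  rw [← totalReward_stationary_unique (g := g) hc hβ₀ hβ₁ (fun ω hω => ?_) hM hω]
  · exact totalReward_le_value hc hβ₀ hβ₁ m _ hω
  · rw [hU ω hω, bellman]
    simp only [hg, decide_eq_true_eq]
    split_ifs with h
    · exact max_eq_right h
    · exact max_eq_left (le_of_not_ge h)

lemma value_facts (hc : c.Admissible) (hβ₀ : 0 ≤ β) (hβ₁ : β < 1) (m : ℝ) :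
    (∀ ω ∈ Icc (0 : ℝ) 1, c.value β m ω = bellman c β m (c.value β m) ω) ∧
      ConvexOn ℝ (Icc 0 1) (c.value β m) ∧ ∃ M, ∀ ω ∈ Icc (0 : ℝ) 1, |c.value β m ω| ≤ M := by
  obtain ⟨U, hU, hcv, M, hM⟩ := exists_bellman_fixed hc hβ₀ hβ₁ m
  have he : ∀ ω ∈ Icc (0 : ℝ) 1, c.value β m ω = U ω := fun ω hω =>
    value_eq_of_bellman hc hβ₀ hβ₁ hU hM hω
  refine ⟨fun ω hω => ?_, hcv.congr fun ω hω => (he ω hω).symm, M, fun ω hω => ?_⟩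
  · rw [he ω hω, hU ω hω, bellman, bellman, he _ (hc.update_mem hω), he _ hc.p11_mem,
      he _ hc.p01_mem]
  · rw [he ω hω]; exact hM ω hω

/-! ### Timed computations -/

namespace Timed

variable {α γ : Type}

@[simp] lemma bind_val (x : Timed α) (f : α → Timed γ) : (x >>= f).val = (f x.val).val := rfl

@[simp] lemma bind_steps (x : Timed α) (f : α → Timed γ) :
    (x >>= f).steps = x.steps + (f x.val).steps := rfl

@[simp] lemma pure_val (a : α) : (pure a : Timed α).val = a := rfl

@[simp] lemma pure_steps (a : α) : (pure a : Timed α).steps = 0 := rfl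

@[simp] lemma tick_steps : tick.steps = 1 := rfl

@[simp] lemma const_val (a : ℝ) : (const a).val = a := rfl

@[simp] lemma const_steps (a : ℝ) : (const a).steps = 0 := rfl

@[simp] lemma one_val : (1 : Timed ℝ).val = 1 := rfl

@[simp] lemma one_steps : (1 : Timed ℝ).steps = 0 := rfl

@[simp] lemma zero_val : (0 : Timed ℝ).val = 0 := rfl

@[simp] lemma zero_steps : (0 : Timed ℝ).steps = 0 := rfl

@[simp] lemma two_val : (2 : Timed ℝ).val = 2 := rfl

@[simp] lemma two_steps : (2 : Timed ℝ).steps = 0 := rfl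

@[simp] lemma add_val (x y : Timed ℝ) : (x + y).val = x.val + y.val := rfl

@[simp] lemma add_steps (x y : Timed ℝ) : (x + y).steps = x.steps + y.steps + 1 := rfl

@[simp] lemma sub_val (x y : Timed ℝ) : (x - y).val = x.val - y.val := rfl

@[simp] lemma sub_steps (x y : Timed ℝ) : (x - y).steps = x.steps + y.steps + 1 := rfl

@[simp] lemma mul_val (x y : Timed ℝ) : (x * y).val = x.val * y.val := rfl

@[simp] lemma mul_steps (x y : Timed ℝ) : (x * y).steps = x.steps + y.steps + 1 := rfl

@[simp] lemma div_val (x y : Timed ℝ) : (x / y).val = x.val / y.val := rfl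

@[simp] lemma div_steps (x y : Timed ℝ) : (x / y).steps = x.steps + y.steps + 1 := rfl

@[simp] lemma pow_val (x : Timed ℝ) (n : ℕ) : (x ^ n).val = x.val ^ n := rfl

@[simp] lemma pow_steps (x : Timed ℝ) (n : ℕ) : (x ^ n).steps = x.steps + 1 := rfl

@[simp] lemma log_val (a : ℝ) : (log a).val = Real.log a := rfl

@[simp] lemma log_steps (a : ℝ) : (log a).steps = 1 := rfl

@[simp] lemma floor_val (a : ℝ) : (floor a).val = ⌊a⌋₊ := rfl

@[simp] lemma floor_steps (a : ℝ) : (floor a).steps = 1 := rfl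

@[simp] lemma lt_val_iff (a b : ℝ) : (lt a b).val = true ↔ a < b := by simp [lt]

@[simp] lemma lt_steps (a b : ℝ) : (lt a b).steps = 1 := rfl

@[simp] lemma le_val_iff (a b : ℝ) : (le a b).val = true ↔ a ≤ b := by simp [le]

@[simp] lemma le_steps (a b : ℝ) : (le a b).steps = 1 := rfl

@[simp] lemma ite_val (p : Prop) [Decidable p] (x y : Timed α) :
    (if p then x else y).val = if p then x.val else y.val := by split_ifs <;> rfl

@[simp] lemma ite_steps (p : Prop) [Decidable p] (x y : Timed α) :
    (if p then x else y).steps = if p then x.steps else y.steps := by split_ifs <;> rfl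

end Timed

/-! ### Dynamics of the belief -/

/-- The stationary probability of the good state. -/
def Channel.limit (c : Channel) : ℝ := c.p01 / (c.p01 + (1 - c.p11))

/-- The second eigenvalue of the transition matrix. -/
def Channel.memory (c : Channel) : ℝ := c.p11 - c.p01

lemma stationary_val (c : Channel) : (stationary c).val = c.limit := rfl

lemma step_val (c : Channel) (ω : ℝ) : (step c ω).val = c.update ω := rfl

/-- For an admissible channel, `memory < 1` says precisely that the pair p01 = 0, p11 = 1 is
excluded; it makes the denominator of the stationary probability positive. -/
lemma limit_mul (hx : c.memory < 1) : c.limit * (1 - c.memory) = c.p01 := by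
  unfold Channel.memory Channel.limit at *
  have : c.p01 + (1 - c.p11) ≠ 0 := by linarith
  rw [show 1 - (c.p11 - c.p01) = c.p01 + (1 - c.p11) by ring]
  exact div_mul_cancel₀ _ this

lemma limit_mem (hc : c.Admissible) (hx : c.memory < 1) : c.limit ∈ Icc (0 : ℝ) 1 := by
  have h1 := hc.p11_mem.2
  have h0 := hc.p01_mem.1
  unfold Channel.memory at hx
  constructor
  · exact div_nonneg h0 (by linarith)
  · exact div_le_one_of_le₀ (by linarith) (by linarith)

lemma update_sub_limit (hx : c.memory < 1) (ω : ℝ) :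
    c.update ω - c.limit = c.memory * (ω - c.limit) := by
  have := limit_mul hx
  unfold Channel.update Channel.memory at *
  linarith

/-- The update is affine with fixed point `limit` and ratio `memory`. All facts about orbits are
read off from this formula. -/
lemma iterate_update (hx : c.memory < 1) (ω : ℝ) (k : ℕ) :
    c.update^[k] ω = c.limit + c.memory ^ k * (ω - c.limit) := by
  induction k with
  | zero => simp
  | succ k ih =>
    rw [Function.iterate_succ_apply']
    have := update_sub_limit hx (c.update^[k] ω)
    rw [eq_add_of_sub_eq this, ih]
    ring

lemma stepIter_val (hx : c.memory < 1) (k : ℕ) (ω : ℝ) :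
    (stepIter c k ω).val = c.update^[k] ω := by
  rw [iterate_update hx]
  have h := limit_mul hx
  simp only [stepIter, Timed.bind_val, Timed.sub_val, Timed.const_val, Timed.div_val,
    Timed.mul_val, Timed.pow_val, Timed.one_val]
  rw [show c.p11 - c.p01 = c.memory from rfl, ← h]
  have h' : 1 - c.memory ≠ 0 := by linarith
  field_simp
  ring

lemma p01_eq (c : Channel) : c.p01 = c.update 0 := by simp [Channel.update]

lemma p11_eq (c : Channel) : c.p11 = c.update 1 := by simp [Channel.update]

lemma p01_sub_limit (hx : c.memory < 1) : c.p01 - c.limit = -c.memory * c.limit := by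
  rw [p01_eq, update_sub_limit hx]; ring

lemma p11_sub_limit (hx : c.memory < 1) : c.p11 - c.limit = c.memory * (1 - c.limit) := by
  rw [p11_eq, update_sub_limit hx]

/-- In a positively correlated channel, the belief approaches its limit from below. -/
lemma iterate_le_limit (h₀ : 0 ≤ c.memory) (hx : c.memory < 1) (hω : ω ≤ c.limit) (k : ℕ) :
    c.update^[k] ω ≤ c.limit := by
  rw [iterate_update hx]
  have := mul_nonneg (pow_nonneg h₀ k) (sub_nonneg.2 hω)
  linarith

lemma le_iterate (h₀ : 0 ≤ c.memory) (hx : c.memory < 1) (hω : ω ≤ c.limit) (k : ℕ) :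
    ω ≤ c.update^[k] ω := by
  rw [iterate_update hx]
  have := mul_nonneg (sub_nonneg.2 (pow_le_one₀ (n := k) h₀ hx.le)) (sub_nonneg.2 hω)
  nlinarith

lemma abs_pow_le_one (h : |c.memory| ≤ 1) (k : ℕ) : c.memory ^ k ≤ 1 :=
  (le_abs_self _).trans (by rw [abs_pow]; exact pow_le_one₀ (abs_nonneg _) h)

lemma abs_memory_le (hc : c.Admissible) : |c.memory| ≤ 1 := by
  have h1 := hc.p11_mem
  have h0 := hc.p01_mem
  rw [abs_le]
  unfold Channel.memory
  constructor <;> linarith [h1.1, h1.2, h0.1, h0.2]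

/-- Any channel started above its limit stays below the initial belief. -/
lemma iterate_le_self (hc : c.Admissible) (hx : c.memory < 1) (hω : c.limit ≤ ω) (k : ℕ) :
    c.update^[k] ω ≤ ω := by
  rw [iterate_update hx]
  have := mul_nonneg (sub_nonneg.2 (abs_pow_le_one (abs_memory_le hc) k)) (sub_nonneg.2 hω)
  nlinarith

/-- A negatively correlated channel started below its limit never exceeds its second belief. -/
lemma iterate_le_update (hc : c.Admissible) (h₀ : c.memory ≤ 0) (hω : ω ≤ c.limit) (k : ℕ) :
    c.update^[k] ω ≤ c.update ω := by
  have hx : c.memory < 1 := by linarith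
  have h1 : c.limit ≤ c.update ω := by
    have := update_sub_limit hx ω
    nlinarith
  cases k with
  | zero => exact hω.trans h1
  | succ k =>
    rw [Function.iterate_succ_apply]
    exact iterate_le_self hc hx h1 k

/-! ### The crossing time -/

lemma crossing_val (c : Channel) (ω θ : ℝ) : (crossing c ω θ).val =
    if θ < ω then 0 else if c.memory ≤ 0 then 1 else
      ⌊Real.log ((c.p01 - θ * (1 - c.memory)) / (c.p01 - ω * (1 - c.memory))) /
        Real.log c.memory⌋₊ + 1 := by
  simp [crossing, Channel.memory]

lemma crossing_steps_le (c : Channel) (ω θ : ℝ) : (crossing c ω θ).steps ≤ 20 := by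
  simp only [crossing, Timed.bind_steps, Timed.ite_steps, Timed.lt_steps, Timed.le_steps,
    Timed.sub_steps, Timed.const_steps, Timed.pure_steps, Timed.div_steps, Timed.mul_steps,
    Timed.log_steps, Timed.floor_steps, Timed.tick_steps, Timed.one_steps]
  split_ifs <;> norm_num

/-- Crossing θ means that the remaining distance memory^k (limit - ω) is less than limit - θ; taking
logarithms and dividing by the negative number log memory gives a strict lower bound on k. -/
lemma crossing_log_iff (h₀ : 0 < c.memory) (hx : c.memory < 1) {θ : ℝ} (hω : ω < c.limit)
    (hθ : θ < c.limit) (k : ℕ) :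
    θ < c.update^[k] ω ↔
      Real.log ((c.limit - θ) / (c.limit - ω)) / Real.log c.memory < k := by
  have hl : Real.log c.memory < 0 := Real.log_neg h₀ hx
  rw [div_lt_iff_of_neg hl, ← Real.log_pow, Real.log_lt_log_iff (by positivity)
    (div_pos (by linarith) (by linarith)), lt_div_iff₀ (by linarith), iterate_update hx]
  constructor <;> intro h <;> linarith

lemma crossing_ratio (hx : c.memory < 1) {θ : ℝ} :
    (c.p01 - θ * (1 - c.memory)) / (c.p01 - ω * (1 - c.memory)) =
      (c.limit - θ) / (c.limit - ω) := by
  rw [← limit_mul hx, ← sub_mul, ← sub_mul]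
  exact mul_div_mul_right _ _ (by linarith)

lemma crossing_spec (h₀ : 0 ≤ c.memory) (hx : c.memory < 1) {θ : ℝ} (hθ : θ < c.limit) :
    θ < c.update^[(crossing c ω θ).val] ω ∧
      ∀ k < (crossing c ω θ).val, c.update^[k] ω ≤ θ := by
  rw [crossing_val]
  split_ifs with h1 h2
  · simp [h1]
  -- Without memory the first update lands on the limit, which exceeds θ.
  · have h3 : c.memory = 0 := le_antisymm h2 h₀
    constructor
    · rw [iterate_update hx, h3]; simpa using hθ
    · intro k hk
      obtain rfl : k = 0 := by omega
      simpa using h1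
  · push Not at h1 h2
    have hω : ω < c.limit := h1.trans_lt hθ
    rw [crossing_ratio hx]
    constructor
    · rw [crossing_log_iff h2 hx hω hθ]
      exact_mod_cast Nat.lt_floor_add_one _
    · intro k hk
      rw [← not_lt, crossing_log_iff h2 hx hω hθ, not_lt]
      -- The natural floor truncates negative numbers to 0, so minimality needs a nonnegative
      -- quotient; it holds because ω ≤ θ.
      have hnn : 0 ≤ Real.log ((c.limit - θ) / (c.limit - ω)) / Real.log c.memory :=
        div_nonneg_of_nonpos (Real.log_nonpos (div_nonneg (by linarith) (by linarith))
          (div_le_one_of_le₀ (by linarith) (by linarith))) (Real.log_neg h2 hx).le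
      exact (Nat.le_floor_iff hnn).1 (by omega)

/-! ### The closed form of the index -/

lemma index_steps_le (β : ℝ) (c : Channel) (ω : ℝ) : (index β c ω).steps ≤ 120 := by
  have h : (crossing c c.p01 ω).steps ≤ 20 := crossing_steps_le _ _ _
  obtain ⟨n, hn⟩ := ENat.ne_top_iff_exists.1 (ne_top_of_le_ne_top (by simp) h)
  rw [← hn] at h
  have hn' : n ≤ 20 := by exact_mod_cast h
  simp only [index, Timed.bind_steps, Timed.ite_steps, Timed.le_steps,
    Timed.sub_steps, Timed.add_steps, Timed.const_steps, Timed.div_steps,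
    Timed.mul_steps, Timed.pow_steps, stationary, step, stepIter, Timed.one_steps, ← hn]
  split_ifs <;> norm_cast <;> omega

/-- Whittle's index. -/
def whittle (β : ℝ) (c : Channel) (ω : ℝ) : ℝ := (index β c ω).val

lemma whittle_pos_outer (h : c.p01 ≤ c.p11) (hω : ω ≤ c.p01 ∨ c.p11 ≤ ω) :
    whittle β c ω = ω * c.B := by
  rcases hω with hω | hω <;> simp [whittle, index, h, hω]

lemma whittle_pos_right (h : c.p01 ≤ c.p11) (h1 : c.p01 < ω) (h2 : ω < c.p11)
    (h3 : c.limit ≤ ω) :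
    whittle β c ω = ω / (1 - β * c.p11 + β * ω) * c.B := by
  simp [whittle, index, h, h1.not_ge, h2.not_ge, stationary_val, h3]

lemma whittle_pos_left (h : c.p01 ≤ c.p11) (hx : c.memory < 1) (h1 : c.p01 < ω) (h2 : ω < c.p11)
    (h3 : ω < c.limit) {n : ℕ} (hn : (crossing c c.p01 ω).val = n) {s q e : ℝ}
    (hs : s = c.update^[n] c.p01)
    (hq : q = (1 - β * c.p11) * (1 - β ^ (n + 1)) + (1 - β) * β ^ (n + 1) * s)
    (he : e = β * (1 - β * c.p11) - β * (ω - β * c.update ω)) :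
    whittle β c ω = (ω - β * c.update ω + (β ^ n * s / q) * (1 - β) * e) /
      (1 - β * c.p11 - ((1 - β * c.p11) * (1 - β ^ n) / q) * e) * c.B := by
  simp [whittle, index, h, h1.not_ge, h2.not_ge, stationary_val, h3.not_ge, step_val, hn,
    stepIter_val hx, ← hs, ← hq, ← he]

lemma whittle_neg_outer (h : c.p11 < c.p01) (hω : ω ≤ c.p11 ∨ c.p01 ≤ ω) :
    whittle β c ω = ω * c.B := by
  rcases hω with hω | hω <;> simp [whittle, index, h.not_ge, hω]

lemma whittle_neg_right (h : c.p11 < c.p01) (h1 : c.p11 < ω) (h2 : ω < c.p01)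
    (h3 : c.update c.p11 ≤ ω) :
    whittle β c ω = (β * c.p01 + ω * (1 - β)) / (1 + β * (c.p01 - ω)) * c.B := by
  simp [whittle, index, h.not_ge, h1.not_ge, h2.not_ge, step_val, h3]

lemma whittle_neg_mid (h : c.p11 < c.p01) (h1 : c.p11 < ω) (h2 : ω < c.p01)
    (h3 : ω < c.update c.p11) (h4 : c.limit ≤ ω) {s q C₃ C₄ : ℝ} (hs : s = c.update c.p11)
    (hq : q = 1 + (1 + β) * β * c.p01 - β ^ 2 * s)
    (h₃ : C₃ = (1 - β * (1 - c.p01)) / q)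
    (h₄ : C₄ = (β * s * (1 - β) + β ^ 2 * c.p01) / q) :
    whittle β c ω = (1 - β + β * C₄) * (β * c.p01 + ω * (1 - β)) /
      (1 - β * (1 - c.p01) - C₃ * (β ^ 2 * c.p01 + β * ω - β ^ 2 * ω)) * c.B := by
  simp [whittle, index, h.not_ge, h1.not_ge, h2.not_ge, step_val, stationary_val, h4,
    ← hs, ← hq, ← h₃, ← h₄, (hs.trans_gt h3).not_ge]

lemma whittle_neg_left (h : c.p11 < c.p01) (h1 : c.p11 < ω) (h2 : ω < c.p01)
    (h3 : ω < c.update c.p11) (h4 : ω < c.limit) {s q C₃ C₄ : ℝ} (hs : s = c.update c.p11)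
    (hq : q = 1 + (1 + β) * β * c.p01 - β ^ 2 * s)
    (h₃ : C₃ = (1 - β * (1 - c.p01)) / q)
    (h₄ : C₄ = (β * s * (1 - β) + β ^ 2 * c.p01) / q) :
    whittle β c ω = ((1 - β) * (β * c.p01 + ω - β * c.update ω) -
        C₄ * β * (β * c.update ω - β * c.p01 - ω)) /
      (1 - β * (1 - c.p01) + C₃ * β * (β * c.update ω - β * c.p01 - ω)) * c.B := by
  simp [whittle, index, h.not_ge, h1.not_ge, h2.not_ge, step_val, stationary_val,
    h4.not_ge, ← hs, ← hq, ← h₃, ← h₄, (hs.trans_gt h3).not_ge]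

/-! ### The indifference equation -/

/-- The expected income from activating in belief `z`, if `v` is the income from the next slot
on. -/
def activeIncome (c : Channel) (β : ℝ) (v : ℝ → ℝ) (z : ℝ) : ℝ :=
  z * c.B + β * (z * v c.p11 + (1 - z) * v c.p01)

lemma passive_steps {v : ℝ → ℝ} (hc : c.Admissible) (hβ₁ : β < 1)
    (hP : ∀ z ∈ Icc (0 : ℝ) 1, z ≤ ω → v z = m + β * v (c.update z)) {z : ℝ}
    (hz : z ∈ Icc (0 : ℝ) 1) (n : ℕ) (h : ∀ k < n, c.update^[k] z ≤ ω) :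
    v z = (1 - β ^ n) / (1 - β) * m + β ^ n * v (c.update^[n] z) := by
  have hb : 1 - β ≠ 0 := by linarith
  induction n with
  | zero => simp
  | succ n ih =>
    rw [ih fun k hk => h k (hk.trans n.lt_succ_self), hP _ (hc.iterate_mem hz n) (h n n.lt_succ_self),
      Function.iterate_succ_apply']
    field_simp
    ring

/-- Boundedness of v removes the tail β^n v(𝒯ⁿ z) from the geometric sum. -/
lemma passive_forever {v : ℝ → ℝ} (hc : c.Admissible) (hβ₀ : 0 ≤ β) (hβ₁ : β < 1) {M : ℝ}
    (hM : ∀ z ∈ Icc (0 : ℝ) 1, |v z| ≤ M)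
    (hP : ∀ z ∈ Icc (0 : ℝ) 1, z ≤ ω → v z = m + β * v (c.update z)) {z : ℝ}
    (hz : z ∈ Icc (0 : ℝ) 1) (h : ∀ k, c.update^[k] z ≤ ω) : v z = m / (1 - β) := by
  have hb : 1 - β ≠ 0 := by linarith
  have key : ∀ n : ℕ, |v z - m / (1 - β)| ≤ β ^ n * (M + |m / (1 - β)|) := fun n => by
    rw [passive_steps hc hβ₁ hP hz n fun k _ => h k,
      show (1 - β ^ n) / (1 - β) * m + β ^ n * v (c.update^[n] z) - m / (1 - β) =
        β ^ n * (v (c.update^[n] z) - m / (1 - β)) by field_simp; ring,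
      abs_mul, abs_of_nonneg (pow_nonneg hβ₀ n)]
    exact mul_le_mul_of_nonneg_left
      ((abs_sub _ _).trans (add_le_add_left (hM _ (hc.iterate_mem hz n)) _)) (pow_nonneg hβ₀ n)
  have h0 : |v z - m / (1 - β)| ≤ 0 :=
    ge_of_tendsto' (tendsto_pow_mul_zero hβ₀ hβ₁ _) key
  linarith [abs_nonpos_iff.1 h0]

lemma mul_lt_one_of_mem (hβ₀ : 0 ≤ β) (hβ₁ : β < 1) {p : ℝ} (hp : p ∈ Icc (0 : ℝ) 1) :
    β * p < 1 := lt_of_le_of_lt (mul_le_of_le_one_right hβ₀ hp.2) hβ₁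

/-- The function t - β𝒯(t) has slope 1 - β·memory ≥ 0, so along an orbit below ω it is at most ω -
β𝒯(ω). Summing it with weights β^k telescopes to z - β^n 𝒯ⁿ(z). -/
lemma le_pow_mul_iterate_add (hc : c.Admissible) (hβ₀ : 0 ≤ β) (hβ₁ : β < 1) {z : ℝ} (n : ℕ)
    (h : ∀ k < n, c.update^[k] z ≤ ω) :
    (1 - β) * z ≤ (1 - β) * β ^ n * c.update^[n] z + (ω - β * c.update ω) * (1 - β ^ n) := by
  induction n with
  | zero => simp
  | succ n ih =>
    have ih := ih fun k hk => h k (hk.trans n.lt_succ_self)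
    have hz := h n n.lt_succ_self
    rw [Function.iterate_succ_apply']
    set t := c.update^[n] z
    have h1 := hc.p11_mem
    have h0 := hc.p01_mem
    have hbx : 0 ≤ 1 - β * (c.p11 - c.p01) := by
      have := mul_le_mul_of_nonneg_left (show c.p11 - c.p01 ≤ 1 by linarith [h1.2, h0.1]) hβ₀
      linarith
    have h2 : t - β * c.update t ≤ ω - β * c.update ω := by
      unfold Channel.update
      nlinarith [mul_nonneg hbx (sub_nonneg.2 hz)]
    have h3 := mul_le_mul_of_nonneg_left h2
      (mul_nonneg (sub_nonneg.2 hβ₁.le) (pow_nonneg hβ₀ n))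
    rw [pow_succ]
    nlinarith

/-- The difference of the two sides is β times the right-hand side of `le_pow_mul_iterate_add` at z
= p01, which is nonnegative. The lower bound is uniform in n, and so serves both for the
nonvanishing of the denominator and for the modulus of continuity. -/
lemma pos_left_denominator (hc : c.Admissible) (hβ₀ : 0 ≤ β) (hβ₁ : β < 1) {n : ℕ}
    (h : ∀ k < n, c.update^[k] c.p01 ≤ ω) {s q e : ℝ}
    (hs : s = c.update^[n] c.p01)
    (hq : q = (1 - β * c.p11) * (1 - β ^ (n + 1)) + (1 - β) * β ^ (n + 1) * s)
    (he : e = β * (1 - β * c.p11) - β * (ω - β * c.update ω)) :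
    (1 - β) * (1 - β * c.p11) ≤ q - (1 - β ^ n) * e := by
  have h1 := le_pow_mul_iterate_add hc hβ₀ hβ₁ n h
  rw [← hs] at h1
  have h2 : 0 ≤ (1 - β) * c.p01 := mul_nonneg (by linarith) hc.p01_mem.1
  have h3 := mul_le_mul_of_nonneg_left (h2.trans h1) hβ₀
  rw [hq, he, pow_succ]
  nlinarith

lemma pos_left_q_pos (hc : c.Admissible) (hβ₀ : 0 ≤ β) (hβ₁ : β < 1) (n : ℕ) {s : ℝ} (hs : 0 ≤ s) :
    0 < (1 - β * c.p11) * (1 - β ^ (n + 1)) + (1 - β) * β ^ (n + 1) * s := by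
  have h1 := mul_lt_one_of_mem hβ₀ hβ₁ hc.p11_mem
  have h2 : β ^ (n + 1) < 1 := pow_lt_one₀ hβ₀ hβ₁ n.succ_ne_zero
  have h3 : 0 ≤ (1 - β) * β ^ (n + 1) * s :=
    mul_nonneg (mul_nonneg (by linarith) (pow_nonneg hβ₀ _)) hs
  nlinarith [mul_pos (sub_pos.2 h1) (sub_pos.2 h2)]

/-- Each branch of the closed form corresponds to what p01, p11 and 𝒯(ω) do under the threshold ω:
act at once, wait a known number of slots, or wait forever. This gives linear equations for v(p01)
and v(p11); substituting them into the indifference equation `hi` determines m. -/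
lemma whittle_eq_of_indifferent_pos (hc : c.Admissible) (hβ₀ : 0 ≤ β) (hβ₁ : β < 1)
    (hx : c.memory < 1) (hp : c.p01 ≤ c.p11) {v : ℝ → ℝ} {M : ℝ}
    (hM : ∀ z ∈ Icc (0 : ℝ) 1, |v z| ≤ M)
    (hP : ∀ z ∈ Icc (0 : ℝ) 1, z ≤ ω → v z = m + β * v (c.update z))
    (hA : ∀ z ∈ Icc (0 : ℝ) 1, ω ≤ z → v z = activeIncome c β v z)
    (hω : ω ∈ Icc (0 : ℝ) 1) (hi : m + β * v (c.update ω) = activeIncome c β v ω) :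
    whittle β c ω = m := by
  have h0 : 0 ≤ c.memory := sub_nonneg.2 hp
  have hb : 1 - β ≠ 0 := by linarith
  have hPp := mul_lt_one_of_mem hβ₀ hβ₁ hc.p11_mem
  have l0 : c.p01 ≤ c.limit := by
    have := p01_sub_limit hx; have := mul_nonneg h0 (limit_mem hc hx).1; linarith
  have l1 : c.limit ≤ c.p11 := by
    have := p11_sub_limit hx
    have := mul_nonneg h0 (sub_nonneg.2 (limit_mem hc hx).2); linarith
  have hT : c.update ω ∈ Icc c.p01 c.p11 := convex_comb_mem hω ⟨hp, le_rfl⟩ ⟨le_rfl, hp⟩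
  -- Below p01 all later beliefs are active, where v is affine. So the expected continuation is the
  -- same for both actions and cancels, leaving m = ωB.
  rcases le_or_gt ω c.p01 with h01 | h01
  · rw [whittle_pos_outer hp (Or.inl h01)]
    have e0 := hA _ hc.p01_mem h01
    have e1 := hA _ hc.p11_mem (h01.trans hp)
    rw [hA _ (hc.update_mem hω) (h01.trans hT.1)] at hi
    unfold activeIncome Channel.update at *
    linear_combination -hi - β * (1 - ω) * e0 - β * ω * e1
  have pf : ∀ z ∈ Icc (0 : ℝ) 1, (∀ k, c.update^[k] z ≤ ω) → v z = m / (1 - β) := fun z hz hk =>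
    passive_forever hc hβ₀ hβ₁ hM hP hz hk
  -- Above p11 every continuation is passive forever and worth m/(1-β).
  rcases le_or_gt c.p11 ω with h11 | h11
  · rw [whittle_pos_outer hp (Or.inr h11)]
    have e0 := pf _ hc.p01_mem fun k => (iterate_le_limit h0 hx l0 k).trans (l1.trans h11)
    have e1 := pf _ hc.p11_mem fun k => (iterate_le_self hc hx l1 k).trans h11
    have e2 := pf _ (hc.update_mem hω) fun k => by
      rw [← Function.iterate_succ_apply]; exact iterate_le_self hc hx (l1.trans h11) _
    unfold activeIncome at hi
    rw [e0, e1, e2] at hi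
    linear_combination -hi
  -- Between the limit and p11, the orbits of p01 and 𝒯(ω) never exceed ω, while p11 is active.
  -- Below the limit, 𝒯(ω) is active and p01 waits n slots.
  rcases le_or_gt c.limit ω with hl | hl
  · rw [whittle_pos_right hp h01 h11 hl]
    have e0 := pf _ hc.p01_mem fun k => (iterate_le_limit h0 hx l0 k).trans hl
    have e1 := hA _ hc.p11_mem h11.le
    have e2 := pf _ (hc.update_mem hω) fun k => by
      rw [← Function.iterate_succ_apply]; exact iterate_le_self hc hx hl _
    unfold activeIncome at hi e1
    rw [e2, e0] at hi
    rw [e0] at e1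
    have hd : 1 - β * c.p11 + β * ω ≠ 0 := by
      have := mul_nonneg hβ₀ hω.1; linarith
    rw [div_mul_eq_mul_div, div_eq_iff hd]
    field_simp at hi e1
    have : (1 - β) * (ω * c.B) = (1 - β) * (m * (1 - β * c.p11 + β * ω)) := by
      linear_combination (-(1 - β * c.p11)) * hi - β * ω * e1
    exact mul_left_cancel₀ hb this
  · set n := (crossing c c.p01 ω).val with hn
    obtain ⟨hn1, hn2⟩ := crossing_spec (ω := c.p01) h0 hx hl
    rw [← hn] at hn1 hn2
    rw [whittle_pos_left hp hx h01 h11 hl hn.symm rfl rfl rfl]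
    set s := c.update^[n] c.p01 with hs
    have hden := pos_left_denominator hc hβ₀ hβ₁ hn2 hs rfl rfl
    have hsm : s ∈ Icc (0 : ℝ) 1 := hc.iterate_mem hc.p01_mem n
    have hqp := pos_left_q_pos hc hβ₀ hβ₁ n hsm.1
    have hTω : ω ≤ c.update ω := le_iterate h0 hx hl.le 1
    have e0 := passive_steps hc hβ₁ hP hc.p01_mem n hn2
    rw [← hs, hA s hsm hn1.le] at e0
    have e1 := hA _ hc.p11_mem h11.le
    rw [hA _ (hc.update_mem hω) hTω] at hi
    unfold activeIncome at *
    set q := (1 - β * c.p11) * (1 - β ^ (n + 1)) + (1 - β) * β ^ (n + 1) * s with hq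
    set y := c.update ω with hy
    set e := β * (1 - β * c.p11) - β * (ω - β * y) with he
    set a := v c.p01
    set b := v c.p11
    have hPp' : 0 < 1 - β * c.p11 := by linarith
    have hden' : 1 - β * c.p11 - (1 - β * c.p11) * (1 - β ^ n) / q * e ≠ 0 := by
      have : 1 - β * c.p11 - (1 - β * c.p11) * (1 - β ^ n) / q * e =
          (1 - β * c.p11) * (q - (1 - β ^ n) * e) / q := by field_simp
      rw [this]
      have : 0 < (1 - β) * (1 - β * c.p11) := mul_pos (by linarith) hPp'
      exact (div_pos (mul_pos hPp' (by linarith)) hqp).ne'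
    rw [div_mul_eq_mul_div, div_eq_iff hden']
    have hb' : b * (1 - β * c.p11) = c.p11 * c.B + β * (1 - c.p11) * a := by linear_combination e1
    -- Eliminating v(p11) from the two equations leaves v(p01) with coefficient q; this is the
    -- origin of q and of the constants C₁, C₂.
    have ha : (1 - β) * a * q = (1 - β * c.p11) * (1 - β ^ n) * m + β ^ n * s * (1 - β) * c.B := by
      have e0' : (1 - β) * a = (1 - β ^ n) * m + (1 - β) * β ^ n *
          (s * c.B + β * (s * b + (1 - s) * a)) := by
        rw [show (1 - β ^ n) * m = (1 - β) * ((1 - β ^ n) / (1 - β) * m) by field_simp]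
        linear_combination (1 - β) * e0
      rw [hq, pow_succ]
      linear_combination (1 - β * c.p11) * e0' + (1 - β) * β ^ n * β * s * hb'
    have hm' : m * (1 - β * c.p11) = (ω - β * y) * c.B + (1 - β) * a * e := by
      rw [he]
      linear_combination (1 - β * c.p11) * hi + β * (ω - β * y) * hb'
    have ha' : (1 - β) * a = ((1 - β * c.p11) * (1 - β ^ n) * m + β ^ n * s * (1 - β) * c.B) / q :=
      (eq_div_iff hqp.ne').2 ha
    rw [ha'] at hm'
    field_simp at hm' ⊢
    linear_combination -hm'

/-- Same scheme as in the positively correlated case, but orbits alternate around the limit with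
nonincreasing amplitude. So an orbit either exceeds ω within one slot or never, and no crossing time
appears in the formulas. -/
lemma whittle_eq_of_indifferent_neg (hc : c.Admissible) (hβ₀ : 0 ≤ β) (hβ₁ : β < 1)
    (hp : c.p11 < c.p01) {v : ℝ → ℝ} {M : ℝ}
    (hM : ∀ z ∈ Icc (0 : ℝ) 1, |v z| ≤ M)
    (hP : ∀ z ∈ Icc (0 : ℝ) 1, z ≤ ω → v z = m + β * v (c.update z))
    (hA : ∀ z ∈ Icc (0 : ℝ) 1, ω ≤ z → v z = activeIncome c β v z)
    (hω : ω ∈ Icc (0 : ℝ) 1) (hi : m + β * v (c.update ω) = activeIncome c β v ω) :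
    whittle β c ω = m := by
  have h0 : c.memory ≤ 0 := sub_nonpos.2 hp.le
  have hx : c.memory < 1 := by linarith
  have hb : 0 < 1 - β := by linarith
  have l0 : c.limit ≤ c.p01 := by
    have := p01_sub_limit hx
    nlinarith [mul_nonneg (neg_nonneg.2 h0) (limit_mem hc hx).1]
  have l1 : c.p11 ≤ c.limit := by
    have := p11_sub_limit hx
    nlinarith [mul_nonneg (neg_nonneg.2 h0) (sub_nonneg.2 (limit_mem hc hx).2)]
  have hT : c.update ω ∈ Icc c.p11 c.p01 := convex_comb_mem hω ⟨le_rfl, hp.le⟩ ⟨hp.le, le_rfl⟩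
  have pf : ∀ z ∈ Icc (0 : ℝ) 1, (∀ k, c.update^[k] z ≤ ω) → v z = m / (1 - β) := fun z hz hk =>
    passive_forever hc hβ₀ hβ₁ hM hP hz hk
  rcases le_or_gt ω c.p11 with h11 | h11
  · rw [whittle_neg_outer hp (Or.inl h11)]
    have e0 := hA _ hc.p01_mem (h11.trans hp.le)
    have e1 := hA _ hc.p11_mem h11
    rw [hA _ (hc.update_mem hω) (h11.trans hT.1)] at hi
    unfold activeIncome Channel.update at *
    linear_combination -hi - β * (1 - ω) * e0 - β * ω * e1
  rcases le_or_gt c.p01 ω with h01 | h01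
  · rw [whittle_neg_outer hp (Or.inr h01)]
    have e0 := pf _ hc.p01_mem fun k => (iterate_le_self hc hx l0 k).trans h01
    have hu : c.update c.p11 ≤ c.p01 :=
      (convex_comb_mem hc.p11_mem ⟨le_rfl, hp.le⟩ ⟨hp.le, le_rfl⟩ :
        c.update c.p11 ∈ Icc c.p11 c.p01).2
    have e1 := pf _ hc.p11_mem fun k => (iterate_le_update hc h0 l1 k).trans (hu.trans h01)
    have e2 := pf _ (hc.update_mem hω) fun k => by
      rw [← Function.iterate_succ_apply]; exact iterate_le_self hc hx (l0.trans h01) _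
    unfold activeIncome at hi
    rw [e0, e1, e2] at hi
    field_simp at hi
    have : (1 - β) * (ω * c.B) = (1 - β) * m := by linear_combination -hi
    exact mul_left_cancel₀ hb.ne' this
  set s := c.update c.p11 with hs
  have hsm : s ∈ Icc (0 : ℝ) 1 := hc.update_mem hc.p11_mem
  have e0 := hA _ hc.p01_mem h01.le
  have hR : 0 < 1 - β * (1 - c.p01) := by
    have := mul_nonneg hβ₀ hc.p01_mem.1; nlinarith
  have p0 := hc.p01_mem.1
  have hbp : 0 ≤ β * c.p01 := mul_nonneg hβ₀ p0
  have hbb : 0 ≤ β * (1 - β) := mul_nonneg hβ₀ hb.le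
  have ls : c.limit ≤ s := by
    have := update_sub_limit hx c.p11
    nlinarith [mul_nonneg (neg_nonneg.2 h0) (sub_nonneg.2 l1)]
  -- The largest belief in the orbit of p11 is s. If s ≤ ω, then p11 is passive forever; otherwise
  -- it is passive for one slot and active in s.
  rcases le_or_gt s ω with hsω | hsω
  · rw [whittle_neg_right hp h11 h01 hsω]
    have e1 := pf _ hc.p11_mem fun k => (iterate_le_update hc h0 l1 k).trans hsω
    have e2 := pf _ (hc.update_mem hω) fun k => by
      rw [← Function.iterate_succ_apply]; exact iterate_le_self hc hx (ls.trans hsω) _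
    unfold activeIncome at hi e0
    rw [e2, e1] at hi
    rw [e1] at e0
    have hd : 1 + β * (c.p01 - ω) ≠ 0 := by
      have := mul_nonneg hβ₀ (sub_nonneg.2 h01.le); linarith
    rw [div_mul_eq_mul_div, div_eq_iff hd]
    field_simp at hi e0
    have : (1 - β) * ((β * c.p01 + ω * (1 - β)) * c.B) =
        (1 - β) * (m * (1 + β * (c.p01 - ω))) := by
      linear_combination (-(1 - β * (1 - c.p01))) * hi - β * (1 - ω) * e0
    exact mul_left_cancel₀ hb.ne' this
  have e1 := hP _ hc.p11_mem h11.le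
  rw [← hs, hA s hsm hsω.le] at e1
  unfold activeIncome at e0 e1
  set a := v c.p01 with ha
  set b := v c.p11 with hb_def
  have hβ2 : β ^ 2 * s ≤ β ^ 2 := mul_le_of_le_one_right (sq_nonneg β) hsm.2
  have hqp : 0 < 1 + (1 + β) * β * c.p01 - β ^ 2 * s := by
    have : 0 ≤ (1 + β) * (β * c.p01) := mul_nonneg (by linarith) hbp
    nlinarith
  have ha' : a * (1 - β * (1 - c.p01)) = c.p01 * (c.B + β * b) := by linear_combination e0
  have hb' : (1 - β) * b * (1 + (1 + β) * β * c.p01 - β ^ 2 * s) =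
      (1 - β * (1 - c.p01)) * m + (β * s * (1 - β) + β ^ 2 * c.p01) * c.B := by
    linear_combination (1 - β * (1 - c.p01)) * e1 + β ^ 2 * (1 - s) * ha'
  -- The last two branches differ only in 𝒯(ω): from ω above the limit the orbit never exceeds ω,
  -- from below the limit the next belief is already active.
  rcases le_or_gt c.limit ω with hl | hl
  · rw [whittle_neg_mid hp h11 h01 hsω hl hs rfl rfl rfl]
    have e2 := pf _ (hc.update_mem hω) fun k => by
      rw [← Function.iterate_succ_apply]; exact iterate_le_self hc hx hl _
    unfold activeIncome at hi
    rw [e2, ← ha, ← hb_def] at hi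
    set q := 1 + (1 + β) * β * c.p01 - β ^ 2 * s with hq
    have hd0 : 0 < q - (β ^ 2 * c.p01 + β * ω - β ^ 2 * ω) := by
      have : β * (1 - β) * ω ≤ β * (1 - β) := mul_le_of_le_one_right hbb hω.2
      rw [hq]; nlinarith
    have hd : 1 - β * (1 - c.p01) - (1 - β * (1 - c.p01)) / q *
        (β ^ 2 * c.p01 + β * ω - β ^ 2 * ω) ≠ 0 := by
      rw [show 1 - β * (1 - c.p01) - (1 - β * (1 - c.p01)) / q *
        (β ^ 2 * c.p01 + β * ω - β ^ 2 * ω) = (1 - β * (1 - c.p01)) *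
          (q - (β ^ 2 * c.p01 + β * ω - β ^ 2 * ω)) / q by field_simp]
      exact (div_pos (mul_pos hR hd0) hqp).ne'
    rw [div_mul_eq_mul_div, div_eq_iff hd]
    have hm' : m * (1 - β * (1 - c.p01)) =
        (ω * (1 - β) + β * c.p01) * ((1 - β) * c.B + β * ((1 - β) * b)) := by
      field_simp at hi
      linear_combination (1 - β * (1 - c.p01)) * hi + β * (1 - β) * (1 - ω) * ha'
    rw [(eq_div_iff hqp.ne').2 hb'] at hm'
    field_simp at hm' ⊢
    linear_combination -hm'
  · rw [whittle_neg_left hp h11 h01 hsω hl hs rfl rfl rfl]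
    have hlT : ω ≤ c.update ω := by
      have := update_sub_limit hx ω
      nlinarith [mul_nonneg (neg_nonneg.2 h0) (sub_nonneg.2 hl.le)]
    rw [hA _ (hc.update_mem hω) hlT] at hi
    have hym := hc.update_mem hω
    set y := c.update ω
    unfold activeIncome at hi
    rw [← ha, ← hb_def] at hi
    set q := 1 + (1 + β) * β * c.p01 - β ^ 2 * s with hq
    have hd0 : 0 < q + β * (β * y - β * c.p01 - ω) := by
      have h1 : β * ω ≤ β * c.p01 := mul_le_mul_of_nonneg_left h01.le hβ₀
      have h2 : 0 ≤ β ^ 2 * y := mul_nonneg (sq_nonneg β) hym.1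
      rw [hq]; nlinarith
    have hd : 1 - β * (1 - c.p01) + (1 - β * (1 - c.p01)) / q * β *
        (β * y - β * c.p01 - ω) ≠ 0 := by
      rw [show 1 - β * (1 - c.p01) + (1 - β * (1 - c.p01)) / q * β *
        (β * y - β * c.p01 - ω) = (1 - β * (1 - c.p01)) *
          (q + β * (β * y - β * c.p01 - ω)) / q by field_simp]
      exact (div_pos (mul_pos hR hd0) hqp).ne'
    rw [div_mul_eq_mul_div, div_eq_iff hd]
    have hm' : m * (1 - β * (1 - c.p01)) =
        (ω + β * c.p01 - β * y) * ((1 - β) * c.B + β * ((1 - β) * b)) := by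
      linear_combination (1 - β * (1 - c.p01)) * hi + (β * (1 - ω) - β ^ 2 * (1 - y)) * ha'
    rw [(eq_div_iff hqp.ne').2 hb'] at hm'
    field_simp at hm' ⊢
    linear_combination -hm'

/-! ### Indexability -/

/-- The advantage of the passive action. -/
def gap (c : Channel) (β m ω : ℝ) : ℝ :=
  m + β * c.value β m (c.update ω) - activeIncome c β (c.value β m) ω

lemma value_eq_passive (hc : c.Admissible) (hβ₀ : 0 ≤ β) (hβ₁ : β < 1) (hω : ω ∈ Icc (0 : ℝ) 1)
    (h : 0 ≤ gap c β m ω) : c.value β m ω = m + β * c.value β m (c.update ω) := by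
  rw [(value_facts hc hβ₀ hβ₁ m).1 ω hω]
  exact max_eq_left (sub_nonneg.1 h)

lemma value_eq_active (hc : c.Admissible) (hβ₀ : 0 ≤ β) (hβ₁ : β < 1) (hω : ω ∈ Icc (0 : ℝ) 1)
    (h : gap c β m ω ≤ 0) : c.value β m ω = activeIncome c β (c.value β m) ω := by
  rw [(value_facts hc hβ₀ hβ₁ m).1 ω hω]
  exact max_eq_right (sub_nonpos.1 h)

lemma gap_zero : gap c β m 0 = m := by
  simp [gap, activeIncome, Channel.update]

lemma gap_one : gap c β m 1 = m - c.B := by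
  simp [gap, activeIncome, Channel.update]

/-- The value is convex, the update is affine, and the income from activation is affine in the
belief. -/
lemma convexOn_gap (hc : c.Admissible) (hβ₀ : 0 ≤ β) (hβ₁ : β < 1) (m : ℝ) :
    ConvexOn ℝ (Icc 0 1) (gap c β m) := by
  refine ⟨convex_Icc _ _, fun x hx y hy a b ha hb hab => ?_⟩
  have h := (value_facts hc hβ₀ hβ₁ m).2.1.2 (hc.update_mem hx) (hc.update_mem hy) ha hb hab
  have hb' : b = 1 - a := by linarith
  subst hb'
  have he : c.update (a • x + (1 - a) • y) = a • c.update x + (1 - a) • c.update y := by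
    simp only [Channel.update, smul_eq_mul]; ring
  rw [← he] at h
  have h' := mul_le_mul_of_nonneg_left h hβ₀
  simp only [gap, activeIncome, smul_eq_mul] at h' ⊢
  linarith

lemma gap_le (hc : c.Admissible) (hβ₀ : 0 ≤ β) (hβ₁ : β < 1) (hω : ω ∈ Icc (0 : ℝ) 1) :
    gap c β m ω ≤ m - ω * c.B := by
  have h := (convexOn_gap hc hβ₀ hβ₁ m).2 (left_mem_Icc.2 zero_le_one)
    (right_mem_Icc.2 zero_le_one) (sub_nonneg.2 hω.2) hω.1 (by ring)
  simp only [smul_eq_mul, mul_zero, mul_one, zero_add, gap_zero, gap_one] at h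
  linarith

/-- No activation pays more than m, so the constant m/(1-β) solves the optimality equation. -/
lemma value_of_B_le (hc : c.Admissible) (hβ₀ : 0 ≤ β) (hβ₁ : β < 1) (hm : c.B ≤ m)
    (hω : ω ∈ Icc (0 : ℝ) 1) : c.value β m ω = m / (1 - β) := by
  have hb : 0 < 1 - β := by linarith
  have hU : ∀ ω ∈ Icc (0 : ℝ) 1, (fun _ => m / (1 - β)) ω =
      bellman c β m (fun _ => m / (1 - β)) ω := fun ω hω => by
    have h1 : ω * c.B ≤ m := (mul_le_of_le_one_left hc.B_mem.1.le hω.2).trans hm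
    have h2 : m / (1 - β) = m + β * (m / (1 - β)) := by field_simp; ring
    rw [bellman, max_eq_left (by linarith)]
    exact h2
  exact value_eq_of_bellman hc hβ₀ hβ₁ hU (M := |m / (1 - β)|) (fun _ _ => le_rfl) hω

lemma gap_of_B_le (hc : c.Admissible) (hβ₀ : 0 ≤ β) (hβ₁ : β < 1) (hm : c.B ≤ m)
    (hω : ω ∈ Icc (0 : ℝ) 1) : gap c β m ω = m - ω * c.B := by
  rw [gap, activeIncome, value_of_B_le hc hβ₀ hβ₁ hm (hc.update_mem hω),
    value_of_B_le hc hβ₀ hβ₁ hm hc.p01_mem, value_of_B_le hc hβ₀ hβ₁ hm hc.p11_mem]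
  ring

lemma continuous_gap (hc : c.Admissible) (hβ₀ : 0 ≤ β) (hβ₁ : β < 1) (hω : ω ∈ Icc (0 : ℝ) 1) :
    Continuous fun m => gap c β m ω := by
  have h1 := continuous_value hc hβ₀ hβ₁ hc.p11_mem
  have h0 := continuous_value hc hβ₀ hβ₁ hc.p01_mem
  have hu := continuous_value hc hβ₀ hβ₁ (hc.update_mem hω)
  unfold gap activeIncome
  fun_prop

lemma gap_mul_le (hc : c.Admissible) (hβ₀ : 0 ≤ β) (hβ₁ : β < 1) {z : ℝ} (hz : 0 ≤ z) (hzω : z ≤ ω)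
    (hω : ω ≤ 1) : (1 - z) * gap c β m ω ≤ (1 - ω) * gap c β m z + (ω - z) * (m - c.B) := by
  rcases (hzω.trans hω).eq_or_lt with rfl | hz1
  · obtain rfl : ω = 1 := le_antisymm hω hzω
    simp
  have h1 : 0 < 1 - z := by linarith
  have hcv := (convexOn_gap (c := c) (β := β) hc hβ₀ hβ₁ m).2 ⟨hz, hz1.le⟩
    (right_mem_Icc.2 zero_le_one) (div_nonneg (sub_nonneg.2 hω) h1.le)
    (div_nonneg (sub_nonneg.2 hzω) h1.le) (by field_simp; ring)
  have he : ((1 - ω) / (1 - z)) • z + ((ω - z) / (1 - z)) • (1 : ℝ) = ω := by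
    simp only [smul_eq_mul]; field_simp; ring
  rw [he, smul_eq_mul, smul_eq_mul, gap_one] at hcv
  have := mul_le_mul_of_nonneg_left hcv h1.le
  field_simp at this
  linarith

/-- Threshold structure. For m < B the gap is negative at 1; if it were negative at z too, convexity
would make it negative at every ω in between. For m ≥ B the gap is explicit. -/
lemma gap_nonneg_of_le (hc : c.Admissible) (hβ₀ : 0 ≤ β) (hβ₁ : β < 1)
    (hω : ω ∈ Icc (0 : ℝ) 1) (h : 0 ≤ gap c β m ω) {z : ℝ} (hz : 0 ≤ z) (hzω : z ≤ ω) :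
    0 ≤ gap c β m z := by
  rcases le_or_gt c.B m with hB | hB
  · have hz1 : z ≤ 1 := hzω.trans hω.2
    rw [gap_of_B_le hc hβ₀ hβ₁ hB ⟨hz, hz1⟩]
    linarith [mul_le_of_le_one_left hc.B_mem.1.le hz1]
  · by_contra! hneg
    have hω1 : ω < 1 := hω.2.lt_of_ne fun he => by
      rw [he, gap_one] at h; linarith
    have hzω' : z < ω := hzω.lt_of_ne fun he => by rw [he] at hneg; linarith
    have hcv := gap_mul_le (m := m) hc hβ₀ hβ₁ hz hzω hω.2
    have e1 := mul_neg_of_pos_of_neg (sub_pos.2 hω1) hneg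
    have e2 := mul_neg_of_pos_of_neg (sub_pos.2 hzω') (sub_neg.2 hB)
    nlinarith

/-- A zero of the convex gap separates passive beliefs from active ones, since the gap is negative
at 1. So the value function satisfies the hypotheses of the indifference lemmas. -/
lemma whittle_eq_of_gap_eq_zero (hc : c.Admissible) (hβ₀ : 0 ≤ β) (hβ₁ : β < 1)
    (hx : c.memory < 1) (hmB : m < c.B) (hω : ω ∈ Icc (0 : ℝ) 1)
    (h : gap c β m ω = 0) : whittle β c ω = m := by
  obtain ⟨-, -, M, hM⟩ := value_facts hc hβ₀ hβ₁ m
  have hP : ∀ z ∈ Icc (0 : ℝ) 1, z ≤ ω →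
      c.value β m z = m + β * c.value β m (c.update z) := fun z hz hzω =>
    value_eq_passive hc hβ₀ hβ₁ hz (gap_nonneg_of_le hc hβ₀ hβ₁ hω h.ge hz.1 hzω)
  have hA : ∀ z ∈ Icc (0 : ℝ) 1, ω ≤ z →
      c.value β m z = activeIncome c β (c.value β m) z := fun z hz hzω => by
    refine value_eq_active hc hβ₀ hβ₁ hz ?_
    by_contra! hpos
    have hlt : ω < z := hzω.lt_of_ne fun he => by rw [← he, h] at hpos; exact lt_irrefl _ hpos
    have hz1 : z < 1 := hz.2.lt_of_ne fun he => by rw [he, gap_one] at hpos; linarith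
    have hcv := gap_mul_le (m := m) hc hβ₀ hβ₁ hω.1 hzω hz.2
    rw [h] at hcv
    have e1 := mul_pos (show 0 < 1 - ω by linarith) hpos
    have e2 := mul_neg_of_pos_of_neg (sub_pos.2 hlt) (sub_neg.2 hmB)
    linarith
  have hi := sub_eq_zero.1 h
  rcases le_or_gt c.p01 c.p11 with hp | hp
  · exact whittle_eq_of_indifferent_pos hc hβ₀ hβ₁ hx hp hM hP hA hω hi
  · exact whittle_eq_of_indifferent_neg hc hβ₀ hβ₁ hp hM hP hA hω hi

lemma whittle_one (hc : c.Admissible) : whittle β c 1 = c.B := by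
  rcases le_or_gt c.p01 c.p11 with hp | hp
  · rw [whittle_pos_outer hp (Or.inr hc.p11_mem.2), one_mul]
  · rw [whittle_neg_outer hp (Or.inr hc.p01_mem.2), one_mul]

/-- The closed form gives an index: passivity is optimal exactly for the subsidies `m ≥ W(ω)`. -/
lemma gap_nonneg_iff_and_mem (hc : c.Admissible) (hβ₀ : 0 ≤ β) (hβ₁ : β < 1) (hx : c.memory < 1)
    (hω : ω ∈ Icc (0 : ℝ) 1) :
    (∀ m, 0 ≤ gap c β m ω ↔ whittle β c ω ≤ m) ∧ whittle β c ω ∈ Icc 0 c.B := by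
  have hB := hc.B_mem.1
  -- At ω = 1 the gap vanishes only at m = B, where `whittle_eq_of_gap_eq_zero` does not apply.
  rcases hω.2.eq_or_lt with rfl | hω1
  · rw [whittle_one hc]
    exact ⟨fun m => by rw [gap_one, sub_nonneg], hB.le, le_rfl⟩
  have hωB : 0 ≤ ω * c.B := mul_nonneg hω.1 hB.le
  have hωB' : ω * c.B < c.B := by nlinarith
  have hcont := continuous_gap hc hβ₀ hβ₁ hω
  have key : ∀ m, m < c.B → gap c β m ω = 0 → whittle β c ω = m := fun m h1 h =>
    whittle_eq_of_gap_eq_zero hc hβ₀ hβ₁ hx h1 hω h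
  have hgB : ∀ m, c.B ≤ m → 0 < gap c β m ω := fun m hm => by
    rw [gap_of_B_le hc hβ₀ hβ₁ hm hω]; linarith
  have hg0 : gap c β 0 ω ≤ 0 := by linarith [gap_le (m := 0) hc hβ₀ hβ₁ hω]
  -- As a function of m the gap goes from nonpositive at 0 to positive at B, and by `key` each zero
  -- below B equals W(ω). So the zero is unique, and a wrong sign on either side of it would produce
  -- a second one.
  obtain ⟨m₀, hm₀, hgm₀⟩ := intermediate_value_Icc hB.le hcont.continuousOn
    ⟨hg0, (hgB _ le_rfl).le⟩
  have hm₀B : m₀ < c.B := hm₀.2.lt_of_ne fun he => by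
    have := hgB m₀ he.ge; simp only at hgm₀; linarith
  have hW := key m₀ hm₀B hgm₀
  refine ⟨fun m => ?_, by rw [hW]; exact hm₀⟩
  rw [hW]
  constructor
  · intro h
    by_contra! hlt
    rcases lt_or_ge m 0 with hneg | hpos
    · linarith [gap_le (m := m) hc hβ₀ hβ₁ hω]
    · obtain ⟨m₁, hm₁, hg₁⟩ := intermediate_value_Icc hpos hcont.continuousOn ⟨hg0, h⟩
      have := key m₁ (by linarith [hm₁.2]) hg₁
      linarith [hm₁.2]
  · intro h
    by_contra! hneg
    rcases le_or_gt c.B m with hBm | hBm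
    · linarith [hgB m hBm]
    · obtain ⟨m₁, hm₁, hg₁⟩ := intermediate_value_Icc hBm.le hcont.continuousOn
        ⟨hneg.le, (hgB _ le_rfl).le⟩
      have hm₁B : m₁ < c.B := hm₁.2.lt_of_ne fun he => by
        have := hgB m₁ he.ge; simp only at hg₁; linarith
      have h1 := key m₁ hm₁B hg₁
      have : m = m₀ := by linarith [hm₁.1]
      rw [this] at hneg
      simp only at hgm₀
      linarith

lemma gap_nonneg_iff (hc : c.Admissible) (hβ₀ : 0 ≤ β) (hβ₁ : β < 1) (hx : c.memory < 1)
    (hω : ω ∈ Icc (0 : ℝ) 1) : 0 ≤ gap c β m ω ↔ whittle β c ω ≤ m :=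
  (gap_nonneg_iff_and_mem hc hβ₀ hβ₁ hx hω).1 m

lemma whittle_nonneg (hc : c.Admissible) (hβ₀ : 0 ≤ β) (hβ₁ : β < 1) (hx : c.memory < 1)
    (hω : ω ∈ Icc (0 : ℝ) 1) : 0 ≤ whittle β c ω :=
  (gap_nonneg_iff_and_mem hc hβ₀ hβ₁ hx hω).2.1

lemma whittle_le_one (hc : c.Admissible) (hβ₀ : 0 ≤ β) (hβ₁ : β < 1) (hx : c.memory < 1)
    (hω : ω ∈ Icc (0 : ℝ) 1) : whittle β c ω ≤ 1 :=
  (gap_nonneg_iff_and_mem hc hβ₀ hβ₁ hx hω).2.2.trans hc.B_mem.2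

/-- Follows from indexability and the threshold structure, without comparing branches of the closed
form. -/
lemma whittle_mono (hc : c.Admissible) (hβ₀ : 0 ≤ β) (hβ₁ : β < 1) (hx : c.memory < 1)
    {z : ℝ} (hz : z ∈ Icc (0 : ℝ) 1) (hω : ω ∈ Icc (0 : ℝ) 1) (h : z ≤ ω) :
    whittle β c z ≤ whittle β c ω := by
  rw [← gap_nonneg_iff hc hβ₀ hβ₁ hx hz]
  exact gap_nonneg_of_le hc hβ₀ hβ₁ hω
    ((gap_nonneg_iff hc hβ₀ hβ₁ hx hω).2 le_rfl) hz.1 h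

/-! ### Index policies -/

/-- The policy that activates the beliefs with an index above `m`. -/
def indexPolicy (c : Channel) (β m : ℝ) : Policy :=
  stationaryPolicy fun ω => (Timed.lt m (whittle β c ω)).val

lemma totalReward_indexPolicy_eq_value (hc : c.Admissible) (hβ₀ : 0 ≤ β) (hβ₁ : β < 1)
    (hx : c.memory < 1) (m : ℝ) (hω : ω ∈ Icc (0 : ℝ) 1) :
    c.totalReward β m (indexPolicy c β m) ω = c.value β m ω := by
  obtain ⟨-, -, M, hM⟩ := value_facts hc hβ₀ hβ₁ m
  refine totalReward_stationary_unique hc hβ₀ hβ₁ (fun z hz => ?_) hM hω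
  by_cases h : whittle β c z ≤ m
  · simp [h.not_gt, value_eq_passive hc hβ₀ hβ₁ hz ((gap_nonneg_iff hc hβ₀ hβ₁ hx hz).2 h)]
  · have := value_eq_active hc hβ₀ hβ₁ hz
      (not_le.1 (mt (gap_nonneg_iff hc hβ₀ hβ₁ hx hz).1 h)).le
    simpa [not_le.1 h, activeIncome] using this

/-- The income of an index policy from `z` on, in terms of the crossing time `L`. -/
lemma totalReward_indexPolicy_of_passive (hc : c.Admissible) (hβ₀ : 0 ≤ β) (hβ₁ : β < 1) (m μ : ℝ)
    {z : ℝ} (hz : z ∈ Icc (0 : ℝ) 1) {L : ℕ} (hL : ∀ k < L, whittle β c (c.update^[k] z) ≤ μ) :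
    c.totalReward β m (indexPolicy c β μ) z = (1 - β ^ L) / (1 - β) * m +
      β ^ L * c.totalReward β m (indexPolicy c β μ) (c.update^[L] z) := by
  have hb : 1 - β ≠ 0 := by linarith
  induction L with
  | zero => simp
  | succ L ih =>
    rw [ih fun k hk => hL k (hk.trans L.lt_succ_self),
      totalReward_eq hc hβ₀ hβ₁ m _ (hc.iterate_mem hz L), Function.iterate_succ_apply']
    have hp : indexPolicy c β μ 0 (c.update^[L] z) = false := by
      simpa [indexPolicy, stationaryPolicy, ← Bool.not_eq_true] using hL L L.lt_succ_self
    rw [hp]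
    simp only [Bool.false_eq_true, if_false]
    rw [show (indexPolicy c β μ).shift = indexPolicy c β μ from rfl]
    field_simp
    ring

/-- The subsidy `m` that is paid and the threshold `μ` of the policy are kept apart: with the policy
frozen the reward is affine in `m`, which later gives the subgradient. -/
lemma totalReward_indexPolicy_of_crossing (hc : c.Admissible) (hβ₀ : 0 ≤ β) (hβ₁ : β < 1) (m μ : ℝ)
    {z : ℝ} (hz : z ∈ Icc (0 : ℝ) 1) {L : ℕ} (hL : ∀ k < L, whittle β c (c.update^[k] z) ≤ μ)
    (hL' : μ < whittle β c (c.update^[L] z)) :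
    c.totalReward β m (indexPolicy c β μ) z = (1 - β ^ L) / (1 - β) * m +
      β ^ L * activeIncome c β (c.totalReward β m (indexPolicy c β μ)) (c.update^[L] z) := by
  rw [totalReward_indexPolicy_of_passive hc hβ₀ hβ₁ m μ hz hL,
    totalReward_eq hc hβ₀ hβ₁ m _ (hc.iterate_mem hz L)]
  have hp : indexPolicy c β μ 0 (c.update^[L] z) = true := by
    simp [indexPolicy, stationaryPolicy, hL']
  rw [hp]
  rfl

lemma totalReward_indexPolicy_of_never (hc : c.Admissible) (hβ₀ : 0 ≤ β) (hβ₁ : β < 1) (m μ : ℝ)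
    {z : ℝ} (hz : z ∈ Icc (0 : ℝ) 1) (hL : ∀ k, whittle β c (c.update^[k] z) ≤ μ) :
    c.totalReward β m (indexPolicy c β μ) z = 1 / (1 - β) * m := by
  set v := c.totalReward β m (indexPolicy c β μ) with hv
  have hb : 1 - β ≠ 0 := by linarith
  have key : ∀ n : ℕ, |v z - 1 / (1 - β) * m| ≤
      β ^ n * ((1 - β)⁻¹ * max 1 |m| + |1 / (1 - β) * m|) := fun n => by
    rw [hv, totalReward_indexPolicy_of_passive hc hβ₀ hβ₁ m μ hz (L := n) fun k _ => hL k, ← hv,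
      show (1 - β ^ n) / (1 - β) * m + β ^ n * v (c.update^[n] z) - 1 / (1 - β) * m =
        β ^ n * (v (c.update^[n] z) - 1 / (1 - β) * m) by field_simp; ring,
      abs_mul, abs_of_nonneg (pow_nonneg hβ₀ n)]
    exact mul_le_mul_of_nonneg_left
      ((abs_sub _ _).trans (add_le_add_left
        (totalReward_abs_le hc hβ₀ hβ₁ m _ (hc.iterate_mem hz n)) _)) (pow_nonneg hβ₀ n)
  have h0 : |v z - 1 / (1 - β) * m| ≤ 0 :=
    ge_of_tendsto' (tendsto_pow_mul_zero hβ₀ hβ₁ _) key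
  linarith [abs_nonpos_iff.1 h0]

/-! ### The modulus of continuity of the index at the limit -/

lemma memory_nonneg (hp : c.p01 ≤ c.p11) : 0 ≤ c.memory := sub_nonneg.2 hp

lemma p01_le_limit (hc : c.Admissible) (hx : c.memory < 1) (hp : c.p01 ≤ c.p11) :
    c.p01 ≤ c.limit := by
  have := p01_sub_limit hx
  have := mul_nonneg (memory_nonneg hp) (limit_mem hc hx).1
  linarith

lemma limit_le_p11 (hc : c.Admissible) (hx : c.memory < 1) (hp : c.p01 ≤ c.p11) :
    c.limit ≤ c.p11 := by
  have := p11_sub_limit hx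
  have := mul_nonneg (memory_nonneg hp) (sub_nonneg.2 (limit_mem hc hx).2)
  linarith

/-- The formula for the branch right of the limit also holds at the limit when this coincides with
p01 or p11: then either the limit is 0 or it equals p11, and the denominator is 1 in the latter
case. -/
lemma whittle_limit (hc : c.Admissible) (hx : c.memory < 1)
    (hp : c.p01 ≤ c.p11) :
    whittle β c c.limit = c.limit / (1 - β * c.p11 + β * c.limit) * c.B := by
  have h0 := p01_sub_limit hx
  have h1 := p11_sub_limit hx
  have outer : c.memory * c.limit = 0 ∨ c.memory * (1 - c.limit) = 0 →
      c.limit * c.B = c.limit / (1 - β * c.p11 + β * c.limit) * c.B := fun h => by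
    by_cases hl : c.limit = 0
    · simp [hl]
    · have h2 : c.memory * (1 - c.limit) = 0 := by
        rcases h with h | h
        · rcases mul_eq_zero.1 h with h | h
          · rw [h, zero_mul]
          · exact absurd h hl
        · exact h
      rw [show 1 - β * c.p11 + β * c.limit = 1 by linear_combination (-β) * h1 - β * h2, div_one]
  rcases (p01_le_limit hc hx hp).eq_or_lt with h | h
  · rw [whittle_pos_outer hp (Or.inl h.ge)]
    exact outer (Or.inl (by linarith))
  rcases (limit_le_p11 hc hx hp).eq_or_lt with h' | h'
  · rw [whittle_pos_outer hp (Or.inr h'.ge)]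
    exact outer (Or.inr (by linarith))
  exact whittle_pos_right hp h h' le_rfl

/-- No lower bound on ω is assumed, because the halving search may test negative points. -/
lemma whittle_limit_sub_le_of_le_p01 (hc : c.Admissible) (hβ₀ : 0 ≤ β) (hβ₁ : β < 1)
    (hx : c.memory < 1) (hp : c.p01 ≤ c.p11) (hω : ω ≤ c.p01) :
    (1 - β) * (whittle β c c.limit - whittle β c ω) ≤ 2 * (c.limit - ω) := by
  rw [whittle_limit hc hx hp, whittle_pos_outer hp (Or.inl hω)]
  have h0 := p01_sub_limit hx
  have h1 := p11_sub_limit hx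
  have hl := limit_mem hc hx
  have hm := memory_nonneg hp
  have hPp : β * c.p11 ≤ β := mul_le_of_le_one_right hβ₀ hc.p11_mem.2
  have hbl : 0 ≤ β * c.limit := mul_nonneg hβ₀ hl.1
  have hB := hc.B_mem
  set e := c.limit - ω with he
  have hle : c.limit - c.p01 ≤ e := by linarith
  set H := 1 - β * c.p11 + β * c.limit with hH
  have hHpos : 0 < H := by linarith
  have e0 : 0 ≤ e := by linarith [p01_le_limit hc hx hp]
  -- Both limit·(p11 - limit) and (limit - p01)·(1 - limit) equal memory·limit·(1 - limit).
  have h2 : c.limit * (c.p11 - c.limit) ≤ e := by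
    have : c.limit * (c.p11 - c.limit) = (c.limit - c.p01) * (1 - c.limit) := by
      rw [h1, show c.limit - c.p01 = c.memory * c.limit by linarith]; ring
    rw [this]
    have h3 : 0 ≤ c.limit - c.p01 := by linarith [mul_nonneg hm hl.1]
    nlinarith [hl.1]
  have h4 : c.limit / H - ω ≤ (1 + β / H) * e := by
    rw [div_sub' hHpos.ne', div_le_iff₀ hHpos]
    have : (1 + β / H) * e * H = (H + β) * e := by field_simp
    rw [this]
    have h5 : c.limit - H * ω = H * e + β * (c.limit * (c.p11 - c.limit)) := by rw [he, hH]; ring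
    rw [h5]
    linarith [mul_le_mul_of_nonneg_left h2 hβ₀]
  have h6 : (1 - β) * (1 + β / H) ≤ 2 := by
    have : (1 - β) * (β / H) ≤ 1 := by
      rw [← mul_div_assoc, div_le_one hHpos]
      nlinarith
    nlinarith
  have h7 : (1 - β) * (c.limit / H - ω) ≤ 2 * e := by
    calc _ ≤ (1 - β) * ((1 + β / H) * e) := mul_le_mul_of_nonneg_left h4 (by linarith)
      _ = (1 - β) * (1 + β / H) * e := by ring
      _ ≤ _ := mul_le_mul_of_nonneg_right h6 e0
  calc (1 - β) * (c.limit / H * c.B - ω * c.B) = c.B * ((1 - β) * (c.limit / H - ω)) := by ring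
    _ ≤ c.B * (2 * e) := mul_le_mul_of_nonneg_left h7 hB.1.le
    _ ≤ 2 * e := mul_le_of_le_one_left (by linarith) hB.2

/-- The difference of the two closed forms is B·F/(H·D), where D ≥ (1-β)^3 by `pos_left_denominator`
and F is at most 3H times the distance to the limit. Both bounds are uniform in the crossing time n.
-/
lemma whittle_limit_sub_le_of_p01_lt (hc : c.Admissible) (hβ₀ : 0 ≤ β) (hβ₁ : β < 1)
    (hx : c.memory < 1) (hp : c.p01 ≤ c.p11) (hω : c.p01 < ω) (hωl : ω < c.limit) :
    (1 - β) ^ 3 * (whittle β c c.limit - whittle β c ω) ≤ 3 * (c.limit - ω) := by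
  have h0 := memory_nonneg hp
  have hl := limit_mem hc hx
  have hB := hc.B_mem
  have hb1 : 0 < 1 - β := by linarith
  have hPp : β * c.p11 ≤ β := mul_le_of_le_one_right hβ₀ hc.p11_mem.2
  set n := (crossing c c.p01 ω).val with hn
  obtain ⟨hn1, hn2⟩ := crossing_spec (ω := c.p01) h0 hx hωl
  rw [← hn] at hn1 hn2
  rw [whittle_limit hc hx hp,
    whittle_pos_left hp hx hω (hωl.trans_le (limit_le_p11 hc hx hp)) hωl hn.symm rfl rfl rfl]
  set s := c.update^[n] c.p01 with hs
  have hden := pos_left_denominator hc hβ₀ hβ₁ hn2 hs rfl rfl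
  have hsm : s ∈ Icc (0 : ℝ) 1 := hc.iterate_mem hc.p01_mem n
  have hqp := pos_left_q_pos hc hβ₀ hβ₁ n hsm.1
  have hsl : s ≤ c.limit := iterate_le_limit h0 hx (p01_le_limit hc hx hp) n
  have hbn0 : 0 ≤ β ^ n := pow_nonneg hβ₀ n
  have hbn1 : β ^ n ≤ 1 := pow_le_one₀ hβ₀ hβ₁.le
  have hbp : 0 ≤ β * c.p11 := mul_nonneg hβ₀ hc.p11_mem.1
  set P := 1 - β * c.p11 with hP
  have hP0 : 1 - β ≤ P := by linarith
  have hP1 : P ≤ 1 := by linarith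
  set q := P * (1 - β ^ (n + 1)) + (1 - β) * β ^ (n + 1) * s with hq
  set y := c.update ω with hy
  set e := c.limit - ω with he
  have hy' : ω - β * y = (1 - β) * c.limit - (1 - β * c.memory) * e := by
    have := update_sub_limit hx ω
    rw [← hy] at this
    rw [he]
    linear_combination (-β) * this
  set r := (1 - β * c.memory) * e with hr
  have he0 : 0 < e := sub_pos.2 hωl
  have hr1 : r ≤ e := by
    have := mul_nonneg (mul_nonneg hβ₀ h0) he0.le
    rw [hr]; nlinarith
  have hr0 : 0 ≤ r := by
    refine mul_nonneg ?_ he0.le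
    nlinarith
  rw [hy'] at hden ⊢
  set E := β * P - β * ((1 - β) * c.limit - r) with hE
  set H := P + β * c.limit with hH
  have hHpos : 0 < H := by have := mul_nonneg hβ₀ hl.1; linarith
  set b := β ^ n with hb
  set D := P * (q - (1 - b) * E) with hD
  have hPpos : 0 < P := by linarith
  have hD3 : (1 - β) ^ 3 ≤ D := by
    calc (1 - β) ^ 3 = (1 - β) * ((1 - β) * (1 - β)) := by ring
      _ ≤ P * ((1 - β) * P) := by gcongr
      _ ≤ D := by rw [hD]; gcongr
  have hDpos : 0 < D := lt_of_lt_of_le (by positivity) hD3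
  have hF : c.limit * D - H * ((((1 - β) * c.limit - r)) * q + b * s * (1 - β) * E) ≤
      3 * H * e := by
    have hg0 : 0 ≤ c.limit - s := by linarith
    have hg1 : c.limit - s ≤ e := by linarith
    have hk : q = P * (1 - β * b) + (1 - β) * (β * b) * s := by rw [hq, hb, pow_succ]; ring
    have hbb : β * b ≤ 1 := mul_le_one₀ hβ₁.le hbn0 hbn1
    have hbb0 : 0 ≤ β * b := mul_nonneg hβ₀ hbn0
    -- Every term on the right carries a factor r or limit - s. Both are at most e, the latter
    -- because s already exceeds ω.
    have id1 : c.limit * D - H * ((((1 - β) * c.limit - r)) * q + b * s * (1 - β) * E) =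
        H * (r * (P * (1 - β * b) + (1 - β) * (β * b) * c.limit) +
          (c.limit - s) * (β * b * (1 - β) * P) - b * (1 - β) * β * c.limit * r) -
        c.limit * P * ((1 - β) * (β * b) * (c.limit - s) + (1 - b) * β * r) := by
      rw [hD, hk, hE, hH]; ring
    rw [id1]
    have t1 : 0 ≤ c.limit * P * ((1 - β) * (β * b) * (c.limit - s) + (1 - b) * β * r) := by
      have := hl.1
      have : 0 ≤ 1 - b := by linarith
      positivity
    have t2 : 0 ≤ b * (1 - β) * β * c.limit * r := by
      have := hl.1
      positivity
    have t3 : P * (1 - β * b) + (1 - β) * (β * b) * c.limit ≤ 2 := by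
      have a1 : P * (1 - β * b) ≤ 1 := mul_le_one₀ hP1 (by linarith) (by linarith)
      have a2 : (1 - β) * (β * b) * c.limit ≤ 1 :=
        mul_le_one₀ (mul_le_one₀ (by linarith) hbb0 hbb) hl.1 hl.2
      linarith
    have t4 : β * b * (1 - β) * P ≤ 1 :=
      mul_le_one₀ (mul_le_one₀ hbb (by linarith) (by linarith)) hPpos.le hP1
    have t5 : r * (P * (1 - β * b) + (1 - β) * (β * b) * c.limit) ≤ 2 * e := by
      have := mul_le_mul_of_nonneg_left t3 hr0; linarith
    have t6 : (c.limit - s) * (β * b * (1 - β) * P) ≤ e := by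
      have := mul_le_mul_of_nonneg_left t4 hg0; linarith
    have t7 : H * (r * (P * (1 - β * b) + (1 - β) * (β * b) * c.limit) +
          (c.limit - s) * (β * b * (1 - β) * P) - b * (1 - β) * β * c.limit * r) ≤
        H * (3 * e) := mul_le_mul_of_nonneg_left (by linarith) hHpos.le
    linarith
  set F := c.limit * D - H * ((((1 - β) * c.limit - r)) * q + b * s * (1 - β) * E) with hFdef
  have id2 : c.limit / H * c.B - ((1 - β) * c.limit - r + b * s / q * (1 - β) * E) /
      (P - P * (1 - b) / q * E) * c.B = c.B * (F / (H * D)) := by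
    have hq0 := hqp.ne'
    have hH0 := hHpos.ne'
    have hD0 := hDpos.ne'
    have h1 : P - P * (1 - b) / q * E = D / q := by rw [hD]; field_simp
    have h2 : (1 - β) * c.limit - r + b * s / q * (1 - β) * E =
        (((1 - β) * c.limit - r) * q + b * s * (1 - β) * E) / q := by field_simp
    rw [h1, h2, div_div_div_cancel_right₀ hq0, hFdef]
    field_simp
  rw [id2]
  have h3 : F / (H * D) ≤ 3 * e / D := by
    rw [div_le_div_iff₀ (by positivity) hDpos]
    calc F * D ≤ 3 * H * e * D := mul_le_mul_of_nonneg_right hF hDpos.le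
      _ = _ := by ring
  have h4 : 0 ≤ 3 * e / D := by positivity
  calc (1 - β) ^ 3 * (c.B * (F / (H * D))) ≤ (1 - β) ^ 3 * (c.B * (3 * e / D)) := by
        have := hB.1
        gcongr
    _ ≤ (1 - β) ^ 3 * (3 * e / D) := by
        have := mul_le_of_le_one_left h4 hB.2
        gcongr
    _ = 3 * e * ((1 - β) ^ 3 / D) := by ring
    _ ≤ 3 * e * 1 := by
        gcongr
        exact (div_le_one hDpos).2 hD3
    _ = 3 * e := mul_one _

lemma whittle_limit_sub_le (hc : c.Admissible) (hβ₀ : 0 ≤ β) (hβ₁ : β < 1)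
    (hx : c.memory < 1) (hp : c.p01 ≤ c.p11) (hωl : ω < c.limit) :
    whittle β c c.limit - whittle β c ω ≤ 3 / (1 - β) ^ 3 * (c.limit - ω) := by
  have hb1 : 0 < 1 - β := by linarith
  have h3 : 0 < (1 - β) ^ 3 := by positivity
  rw [div_mul_eq_mul_div, le_div_iff₀ h3, mul_comm]
  rcases le_or_gt ω c.p01 with h | h
  · have h1 := whittle_limit_sub_le_of_le_p01 hc hβ₀ hβ₁ hx hp h
    have h2 : (1 - β) ^ 2 ≤ 1 := pow_le_one₀ hb1.le (by linarith)
    calc (1 - β) ^ 3 * (whittle β c c.limit - whittle β c ω) =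
        (1 - β) ^ 2 * ((1 - β) * (whittle β c c.limit - whittle β c ω)) := by ring
      _ ≤ (1 - β) ^ 2 * (2 * (c.limit - ω)) := by gcongr
      _ ≤ 1 * (2 * (c.limit - ω)) := by
        have : 0 ≤ c.limit - ω := by linarith
        gcongr
      _ ≤ _ := by linarith
  · exact whittle_limit_sub_le_of_p01_lt hc hβ₀ hβ₁ hx hp h hωl

/-! ### The preparation of the arms -/

/-- The indices of `z, 𝒯(z), ..., 𝒯ⁿ(z)`. -/
def whittleList (β : ℝ) (c : Channel) (z : ℝ) (n : ℕ) : List ℝ :=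
  (List.range (n + 1)).map fun k => whittle β c (c.update^[k] z)

lemma mem_whittleList {z w : ℝ} {n : ℕ} :
    w ∈ whittleList β c z n ↔ ∃ k ≤ n, whittle β c (c.update^[k] z) = w := by
  simp [whittleList]

lemma length_whittleList (z : ℝ) (n : ℕ) : (whittleList β c z n).length = n + 1 := by
  simp [whittleList]

lemma indices_val (β : ℝ) (c : Channel) (n : ℕ) :
    ∀ z : ℝ, (indices β c n z).val = whittleList β c z n := by
  induction n with
  | zero => intro z; simp [indices, whittleList, whittle]
  | succ n ih =>
    intro z
    rw [whittleList, List.range_succ_eq_map]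
    simp [indices, ih, whittleList, whittle, step_val, Function.comp_def]

namespace Timed

/-- Step counts live in `ℕ∞`; replacing a bounded one by a natural number lets `omega` do the
accounting. -/
lemma exists_steps {α : Type} {x : Timed α} {b : ℕ} (h : x.steps ≤ b) :
    ∃ n : ℕ, x.steps = n ∧ n ≤ b := by
  obtain ⟨n, hn⟩ := ENat.ne_top_iff_exists.1 (ne_top_of_le_ne_top (ENat.natCast_ne_top b) h)
  exact ⟨n, hn.symm, by rw [← hn] at h; exact_mod_cast h⟩

end Timed

lemma indices_steps_le (β : ℝ) (c : Channel) (n : ℕ) :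
    ∀ z : ℝ, (indices β c n z).steps ≤ (126 * (n + 1) : ℕ) := by
  induction n with
  | zero =>
    intro z
    obtain ⟨i, hi, hi'⟩ := Timed.exists_steps (b := 120) (index_steps_le β c z)
    simp only [indices, Timed.bind_steps, Timed.pure_steps, Timed.tick_steps, hi]
    norm_cast
    omega
  | succ n ih =>
    intro z
    obtain ⟨i, hi, hi'⟩ := Timed.exists_steps (b := 120) (index_steps_le β c z)
    obtain ⟨j, hj, hj'⟩ := Timed.exists_steps (ih (step c z).val)
    simp only [indices, Timed.bind_steps, Timed.pure_steps, Timed.tick_steps, hi, hj]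
    simp only [step, Timed.add_steps, Timed.mul_steps, Timed.sub_steps, Timed.const_steps,
      Timed.one_steps]
    norm_cast
    omega

lemma search_steps_le {test : ℕ → Timed Bool} {b n : ℕ} (hb : ∀ k, (test k).steps ≤ b)
    (hn : (test n).val = true) : (Timed.search test).steps ≤ ((n + 1) * (b + 1) : ℕ) := by
  have hle : sInf {n | (test n).val = true} ≤ n := Nat.sInf_le hn
  rw [Timed.search, if_pos ⟨n, hn⟩]
  calc ∑ k ∈ Finset.range (sInf {n | (test n).val = true} + 1), ((test k).steps + 1)
      ≤ ∑ _k ∈ Finset.range (sInf {n | (test n).val = true} + 1), ((b + 1 : ℕ) : ℕ∞) :=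
        Finset.sum_le_sum fun k _ => by
          rw [Nat.cast_add, Nat.cast_one]; exact add_le_add_left (hb k) 1
    _ = ((sInf {n | (test n).val = true} + 1) * (b + 1) : ℕ) := by
        rw [Finset.sum_const, Finset.card_range, nsmul_eq_mul, ← Nat.cast_mul]
    _ ≤ _ := by gcongr

/-- By the Lipschitz bound the test succeeds after at most n₀ halvings, where n₀ depends on β only.
Hence the point found keeps distance at least η/2^n₀ from the limit, which bounds the crossing
times. -/
lemma searchBar_spec (hc : c.Admissible) (hβ₀ : 0 ≤ β) (hβ₁ : β < 1) (hx : c.memory < 1)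
    (hp : c.p01 ≤ c.p11) {η : ℝ} (hη : 0 < η) {n₀ : ℕ} (hn₀ : 3 / (1 - β) ^ 3 ≤ 2 ^ n₀) :
    (searchBar β c η c.limit).val < c.limit ∧
    η / 2 ^ n₀ ≤ c.limit - (searchBar β c η c.limit).val ∧
    whittle β c c.limit - whittle β c (searchBar β c η c.limit).val ≤ η ∧
    (searchBar β c η c.limit).steps ≤ (126 * (n₀ + 1) + 123 : ℕ) := by
  have htest : whittle β c c.limit - whittle β c (c.limit - η / 2 ^ n₀) ≤ η := by
    have hlt : c.limit - η / 2 ^ n₀ < c.limit := sub_lt_self _ (by positivity)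
    refine (whittle_limit_sub_le hc hβ₀ hβ₁ hx hp hlt).trans ?_
    rw [sub_sub_cancel]
    calc 3 / (1 - β) ^ 3 * (η / 2 ^ n₀) ≤ 2 ^ n₀ * (η / 2 ^ n₀) := by gcongr
      _ = η := by field_simp
  set test : ℕ → Timed Bool := fun n => do
    let w ← index β c (← (c.limit - η / 2 ^ n : Timed ℝ))
    Timed.le (← ((index β c c.limit).val - w : Timed ℝ)) η with htest_def
  have hval : ∀ n, (test n).val = true ↔
      whittle β c c.limit - whittle β c (c.limit - η / 2 ^ n) ≤ η := fun n => by
    simp [htest_def, whittle]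
  have hsteps : ∀ n, (test n).steps ≤ (125 : ℕ) := fun n => by
    obtain ⟨i, hi, hi'⟩ := Timed.exists_steps (b := 120)
      (index_steps_le β c (Timed.val ((c.limit : Timed ℝ) - (η : Timed ℝ) / 2 ^ n)))
    simp only [htest_def, Timed.bind_steps, Timed.sub_steps, Timed.div_steps, Timed.pow_steps,
      Timed.const_steps, Timed.two_steps, Timed.le_steps, hi]
    norm_cast
    omega
  have hn₀' : (test n₀).val = true := (hval n₀).2 htest
  set n := (Timed.search test).val with hn
  have hnle : n ≤ n₀ := Nat.sInf_le hn₀'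
  have hnt : (test n).val = true := Nat.sInf_mem (s := {n | (test n).val = true}) ⟨n₀, hn₀'⟩
  have hv : (searchBar β c η c.limit).val = c.limit - η / 2 ^ n := rfl
  rw [hv]
  refine ⟨sub_lt_self _ (by positivity), ?_, (hval n).1 hnt, ?_⟩
  · rw [sub_sub_cancel]
    gcongr
    norm_num
  · obtain ⟨i, hi, hi'⟩ := Timed.exists_steps (b := 120) (index_steps_le β c c.limit)
    obtain ⟨j, hj, hj'⟩ := Timed.exists_steps (search_steps_le hsteps hn₀')
    have hs : (searchBar β c η c.limit).steps =
        (index β c c.limit).steps + ((Timed.search test).steps + 3) := rfl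
    rw [hs, hi, hj]
    norm_cast
    omega

lemma crossing_le (h₀ : 0 ≤ c.memory) (hx : c.memory < 1) {θ : ℝ} (hθ : θ < c.limit) {k : ℕ}
    (hk : θ < c.update^[k] ω) : (crossing c ω θ).val ≤ k := by
  by_contra! h
  exact hk.not_ge ((crossing_spec h₀ hx hθ).2 k h)

/-- After k steps the orbit is at most r^k below the limit, since its initial distance below is at
most 1. -/
lemma crossing_le_of_pow_lt (hc : c.Admissible) (h₀ : 0 ≤ c.memory) (hx : c.memory < 1) {θ r : ℝ}
    (hθ : θ < c.limit) (hr : c.memory ≤ r) (hω : ω ∈ Icc (0 : ℝ) 1) {k : ℕ}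
    (hk : r ^ k < c.limit - θ) : (crossing c ω θ).val ≤ k := by
  refine crossing_le h₀ hx hθ ?_
  rw [iterate_update hx]
  have h1 : c.memory ^ k ≤ r ^ k := pow_le_pow_left₀ h₀ hr k
  have h2 := pow_nonneg h₀ k
  have h3 := (limit_mem hc hx).2
  nlinarith [hω.1]

lemma prepareArm_val_neg (hp : c.p11 < c.p01) (η : ℝ) :
    (prepareArm β η c ω).val = ⟨c, ⟨c.p01, 0, whittleList β c c.p01 0⟩,
      ⟨c.p11, 0, whittleList β c c.p11 1⟩,
      ⟨ω, 0, if ω < c.limit then whittleList β c ω 1 else whittleList β c ω 0⟩, none⟩ := by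
  simp only [prepareArm, Timed.bind_val, Timed.ite_val, Timed.lt_val_iff, hp, if_true,
    stationary_val, indices_val, Timed.pure_val]
  split_ifs <;> rfl

lemma prepareArm_val_pos_lt (hx : c.memory < 1) (hp : c.p01 ≤ c.p11) {η : ℝ} (hω : ω < c.limit)
    {l d : ℕ} (hl : (crossing c c.p01 (searchBar β c η c.limit).val).val = l)
    (hd : (crossing c ω (searchBar β c η c.limit).val).val = d) :
    (prepareArm β η c ω).val = ⟨c, ⟨c.p01, 0, whittleList β c c.p01 l⟩,
      ⟨c.p11, 0, whittleList β c c.p11 0⟩, ⟨ω, 0, whittleList β c ω d⟩,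
      some (min (whittle β c (c.update^[l] c.p01)) (whittle β c (c.update^[d] ω)),
        whittle β c c.limit)⟩ := by
  simp only [prepareArm, Timed.bind_val, Timed.lt_val_iff, hp.not_gt, if_false,
    stationary_val, indices_val, Timed.pure_val, hω, if_true, hl, hd, stepIter_val hx,
    Timed.le_val_iff, whittle, min_def]

lemma prepareArm_val_pos_ge (hx : c.memory < 1) (hp : c.p01 ≤ c.p11) {η : ℝ} (hω : c.limit ≤ ω)
    {l : ℕ} (hl : (crossing c c.p01 (searchBar β c η c.limit).val).val = l) :
    (prepareArm β η c ω).val = ⟨c, ⟨c.p01, 0, whittleList β c c.p01 l⟩,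
      ⟨c.p11, 0, whittleList β c c.p11 0⟩, ⟨ω, 0, whittleList β c ω 0⟩,
      some (whittle β c (c.update^[l] c.p01), whittle β c c.limit)⟩ := by
  simp only [prepareArm, Timed.bind_val, Timed.lt_val_iff, hp.not_gt, if_false,
    stationary_val, indices_val, Timed.pure_val, hω.not_gt, hl, stepIter_val hx, whittle]

/-! ### Invariants of a prepared arm -/

/-- Whether `m` lies outside the gray area. -/
def Arm.Clear (a : Arm) (m : ℝ) : Prop := ∀ g, a.gray = some g → m < g.1 ∨ g.2 ≤ m

/-- The track of the belief `z` from the beginning on. -/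
structure Track.Starts (β : ℝ) (c : Channel) (z : ℝ) (t : Track) : Prop where
  z_eq : t.z = z
  passed_eq : t.passed = 0
  rest_eq : ∃ n, t.rest = whittleList β c z n

/-- If the calculated indices do not exceed `m`, then neither do the others. -/
def Track.Decides (β : ℝ) (c : Channel) (t : Track) (m : ℝ) : Prop :=
  (∀ w ∈ t.rest, w ≤ m) → ∀ k, whittle β c (c.update^[k] t.z) ≤ m

/-- What the preparation of an arm achieves. -/
structure Arm.Prepared (β η : ℝ) (c : Channel) (ω : ℝ) (a : Arm) : Prop where
  c_eq : a.c = c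
  t01 : a.t01.Starts β c c.p01
  t11 : a.t11.Starts β c c.p11
  t1 : a.t1.Starts β c ω
  gray_neg : c.p11 < c.p01 → a.gray = none
  gray_length : ∀ g, a.gray = some g → g.2 - g.1 ≤ η
  gray_mem : ∀ g, a.gray = some g → g.1 ∈ a.t01.rest ∨ g.1 ∈ a.t1.rest
  gray_le : ∀ g, a.gray = some g → g.2 ∈ Icc (0 : ℝ) 1
  decides01 : ∀ m, a.Clear m → a.t01.Decides β c m
  decides11 : ∀ m, a.Clear m → a.t11.Decides β c m
  decides1 : ∀ m, a.Clear m → a.t1.Decides β c m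

/-- One index suffices from above the limit and two from below, because the largest belief of the
orbit is then the first or the second one. -/
lemma prepareArm_spec_neg (hc : c.Admissible) (hβ₀ : 0 ≤ β) (hβ₁ : β < 1) (hp : c.p11 < c.p01)
    (hω : ω ∈ Icc (0 : ℝ) 1) (η : ℝ) :
    (prepareArm β η c ω).val.Prepared β η c ω := by
  have h0 : c.memory ≤ 0 := sub_nonpos.2 hp.le
  have hx : c.memory < 1 := by linarith
  have l0 : c.limit ≤ c.p01 := by
    have := p01_sub_limit hx
    nlinarith [mul_nonneg (neg_nonneg.2 h0) (limit_mem hc hx).1]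
  have l1 : c.p11 ≤ c.limit := by
    have := p11_sub_limit hx
    nlinarith [mul_nonneg (neg_nonneg.2 h0) (sub_nonneg.2 (limit_mem hc hx).2)]
  have zero : ∀ {z : ℝ}, z ∈ Icc (0 : ℝ) 1 → c.limit ≤ z →
      ∀ m, (∀ w ∈ whittleList β c z 0, w ≤ m) → ∀ k, whittle β c (c.update^[k] z) ≤ m :=
    fun hz hzl m h k => (whittle_mono hc hβ₀ hβ₁ hx (hc.iterate_mem hz k) hz
      (iterate_le_self hc hx hzl k)).trans (h _ (mem_whittleList.2 ⟨0, le_rfl, rfl⟩))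
  have one : ∀ {z : ℝ}, z ∈ Icc (0 : ℝ) 1 → z ≤ c.limit →
      ∀ m, (∀ w ∈ whittleList β c z 1, w ≤ m) → ∀ k, whittle β c (c.update^[k] z) ≤ m :=
    fun hz hzl m h k => (whittle_mono hc hβ₀ hβ₁ hx (hc.iterate_mem hz k) (hc.update_mem hz)
      (iterate_le_update hc h0 hzl k)).trans (h _ (mem_whittleList.2 ⟨1, le_rfl, rfl⟩))
  rw [prepareArm_val_neg hp]
  refine ⟨rfl, ⟨rfl, rfl, 0, rfl⟩, ⟨rfl, rfl, 1, rfl⟩, ⟨rfl, rfl, ?_⟩, fun _ => rfl, nofun, nofun,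
    nofun, fun m _ => zero hc.p01_mem l0 m, fun m _ => one hc.p11_mem l1 m, fun m _ => ?_⟩
  · by_cases h : ω < c.limit
    · exact ⟨1, if_pos h⟩
    · exact ⟨0, if_neg h⟩
  · unfold Track.Decides
    by_cases h : ω < c.limit
    · simp only [h, if_true]; exact one hω h.le m
    · simp only [h, if_false]; exact zero hω (not_lt.1 h) m

lemma prepareArm_spec_pos (hc : c.Admissible) (hβ₀ : 0 ≤ β) (hβ₁ : β < 1) (hx : c.memory < 1)
    (hp : c.p01 ≤ c.p11) (hω : ω ∈ Icc (0 : ℝ) 1) {η : ℝ} (hη : 0 < η) {n₀ : ℕ}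
    (hn₀ : 3 / (1 - β) ^ 3 ≤ 2 ^ n₀) : (prepareArm β η c ω).val.Prepared β η c ω := by
  have h0 := memory_nonneg hp
  obtain ⟨hbar, -, hbar2, -⟩ := searchBar_spec hc hβ₀ hβ₁ hx hp hη hn₀
  have hlm := limit_mem hc hx
  set θ := (searchBar β c η c.limit).val with hθ
  have rise : ∀ {z : ℝ}, z ∈ Icc (0 : ℝ) 1 → z ≤ c.limit → ∀ k,
      whittle β c (c.update^[k] z) ≤ whittle β c c.limit := fun hz hzl k =>
    whittle_mono hc hβ₀ hβ₁ hx (hc.iterate_mem hz k) hlm (iterate_le_limit h0 hx hzl k)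
  have fall : ∀ {z : ℝ}, z ∈ Icc (0 : ℝ) 1 → c.limit ≤ z →
      ∀ m, (∀ w ∈ whittleList β c z 0, w ≤ m) → ∀ k, whittle β c (c.update^[k] z) ≤ m :=
    fun hz hzl m h k => (whittle_mono hc hβ₀ hβ₁ hx (hc.iterate_mem hz k) hz
      (iterate_le_self hc hx hzl k)).trans (h _ (mem_whittleList.2 ⟨0, le_rfl, rfl⟩))
  have short : ∀ {z : ℝ}, z ∈ Icc (0 : ℝ) 1 →
      whittle β c c.limit - whittle β c (c.update^[(crossing c z θ).val] z) ≤ η := fun {z} hz => by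
    have h1 := (crossing_spec (ω := z) h0 hx hbar).1
    have hmem := hc.iterate_mem hz (crossing c z θ).val
    have h2 : whittle β c θ ≤ whittle β c (c.update^[(crossing c z θ).val] z) := by
      -- The point found by halving may be negative. Then its closed-form index is θB ≤ 0, which
      -- replaces monotonicity on [0, 1].
      rcases le_or_gt 0 θ with h | h
      · exact whittle_mono hc hβ₀ hβ₁ hx ⟨h, h1.le.trans hmem.2⟩ hmem h1.le
      · rw [whittle_pos_outer hp (Or.inl (h.le.trans hc.p01_mem.1))]
        exact (mul_nonpos_of_nonpos_of_nonneg h.le hc.B_mem.1.le).trans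
          (whittle_nonneg hc hβ₀ hβ₁ hx hmem)
    linarith
  -- Below the gray area the last calculated index exceeds m, so the premise of `Track.Decides`
  -- fails; above it, m dominates W(limit) and hence the whole orbit.
  have decide : ∀ {z lo : ℝ} {n : ℕ}, z ∈ Icc (0 : ℝ) 1 → z ≤ c.limit →
      lo ≤ whittle β c (c.update^[n] z) → ∀ m, (m < lo ∨ whittle β c c.limit ≤ m) →
      (∀ w ∈ whittleList β c z n, w ≤ m) → ∀ k, whittle β c (c.update^[k] z) ≤ m := by
    intro z lo n hz hzl hlo m hm h k
    rcases hm with hm | hm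
    · have := h _ (mem_whittleList.2 ⟨n, le_rfl, rfl⟩)
      linarith
    · exact (rise hz hzl k).trans hm
  have l0 := p01_le_limit hc hx hp
  have l1 := limit_le_p11 hc hx hp
  have hhi : whittle β c c.limit ∈ Icc (0 : ℝ) 1 :=
    ⟨whittle_nonneg hc hβ₀ hβ₁ hx hlm, whittle_le_one hc hβ₀ hβ₁ hx hlm⟩
  rcases lt_or_ge ω c.limit with hωl | hωl
  · rw [prepareArm_val_pos_lt hx hp hωl rfl rfl, ← hθ]
    set l := (crossing c c.p01 θ).val with hl
    set d := (crossing c ω θ).val with hd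
    refine ⟨rfl, ⟨rfl, rfl, l, rfl⟩, ⟨rfl, rfl, 0, rfl⟩, ⟨rfl, rfl, d, rfl⟩, fun h => (hp.not_gt h).elim,
      ?_, ?_, ?_, fun m hm => decide hc.p01_mem l0 (min_le_left _ _) m (hm _ rfl),
      fun m _ => fall hc.p11_mem l1 m, fun m hm => decide hω hωl.le (min_le_right _ _) m (hm _ rfl)⟩
    · rintro g ⟨⟩
      simp only
      rcases min_choice (whittle β c (c.update^[l] c.p01)) (whittle β c (c.update^[d] ω)) with h | h
      · rw [h]; exact short hc.p01_mem
      · rw [h]; exact short hω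
    · rintro g ⟨⟩
      simp only
      rcases min_choice (whittle β c (c.update^[l] c.p01)) (whittle β c (c.update^[d] ω)) with h | h
      · rw [h]; exact Or.inl (mem_whittleList.2 ⟨l, le_rfl, rfl⟩)
      · rw [h]; exact Or.inr (mem_whittleList.2 ⟨d, le_rfl, rfl⟩)
    · rintro g ⟨⟩; exact hhi
  · rw [prepareArm_val_pos_ge hx hp hωl rfl, ← hθ]
    set l := (crossing c c.p01 θ).val with hl
    refine ⟨rfl, ⟨rfl, rfl, l, rfl⟩, ⟨rfl, rfl, 0, rfl⟩, ⟨rfl, rfl, 0, rfl⟩, fun h => (hp.not_gt h).elim,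
      ?_, ?_, ?_, fun m hm => decide hc.p01_mem l0 le_rfl m (hm _ rfl),
      fun m _ => fall hc.p11_mem l1 m, fun m _ => fall hω hωl m⟩
    · rintro g ⟨⟩; exact short hc.p01_mem
    · rintro g ⟨⟩; exact Or.inl (mem_whittleList.2 ⟨l, le_rfl, rfl⟩)
    · rintro g ⟨⟩; exact hhi

lemma prepareArm_spec (hc : c.Admissible) (hβ₀ : 0 ≤ β) (hβ₁ : β < 1) (hx : c.memory < 1)
    (hω : ω ∈ Icc (0 : ℝ) 1) {η : ℝ} (hη : 0 < η) {n₀ : ℕ}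
    (hn₀ : 3 / (1 - β) ^ 3 ≤ 2 ^ n₀) : (prepareArm β η c ω).val.Prepared β η c ω := by
  rcases le_or_gt c.p01 c.p11 with hp | hp
  · exact prepareArm_spec_pos hc hβ₀ hβ₁ hx hp hω hη hn₀
  · exact prepareArm_spec_neg hc hβ₀ hβ₁ hp hω η

/-! ### Size and cost of the preparation -/

/-- The number of calculated indices that are still ahead. -/
def Arm.size (a : Arm) : ℕ := a.t01.rest.length + a.t11.rest.length + a.t1.rest.length

lemma stationary_steps (c : Channel) : (stationary c).steps = 3 := rfl

lemma stepIter_steps (c : Channel) (k : ℕ) (ω : ℝ) : (stepIter c k ω).steps = 9 := by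
  simp only [stepIter, Timed.bind_steps, Timed.sub_steps, Timed.const_steps, Timed.div_steps,
    Timed.mul_steps, Timed.pow_steps, Timed.one_steps]
  norm_num

lemma prepareArm_steps_neg (hp : c.p11 < c.p01) (η : ℝ) :
    (prepareArm β η c ω).steps ≤ (800 : ℕ) := by
  obtain ⟨i₁, hi₁, hi₁'⟩ := Timed.exists_steps (indices_steps_le β c 0 c.p01)
  obtain ⟨i₂, hi₂, hi₂'⟩ := Timed.exists_steps (indices_steps_le β c 1 c.p11)
  obtain ⟨i₃, hi₃, hi₃'⟩ := Timed.exists_steps (indices_steps_le β c 1 ω)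
  obtain ⟨i₄, hi₄, hi₄'⟩ := Timed.exists_steps (indices_steps_le β c 0 ω)
  simp only [prepareArm, Timed.bind_steps, Timed.ite_steps, Timed.lt_val_iff, hp,
    if_true, stationary_val, stationary_steps, Timed.lt_steps, Timed.pure_steps, hi₁, hi₂, hi₃,
    hi₄]
  split_ifs <;> norm_cast <;> omega

set_option maxHeartbeats 1000000 in
lemma prepareArm_steps_pos_lt (hx : c.memory < 1) (hp : c.p01 ≤ c.p11) {η : ℝ}
    (hωl : ω < c.limit) {l d s : ℕ} (hs : (searchBar β c η c.limit).steps ≤ s)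
    (hl : (crossing c c.p01 (searchBar β c η c.limit).val).val = l)
    (hd : (crossing c ω (searchBar β c η c.limit).val).val = d) :
    (prepareArm β η c ω).steps ≤ (s + 126 * l + 126 * d + 900 : ℕ) := by
  obtain ⟨i₁, hi₁, hi₁'⟩ := Timed.exists_steps (b := 120) (index_steps_le β c c.limit)
  obtain ⟨i₂, hi₂, hi₂'⟩ := Timed.exists_steps hs
  obtain ⟨i₃, hi₃, hi₃'⟩ := Timed.exists_steps (b := 20)
    (crossing_steps_le c c.p01 (searchBar β c η c.limit).val)
  obtain ⟨i₄, hi₄, hi₄'⟩ := Timed.exists_steps (indices_steps_le β c l c.p01)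
  obtain ⟨i₅, hi₅, hi₅'⟩ := Timed.exists_steps (indices_steps_le β c 0 c.p11)
  obtain ⟨i₆, hi₆, hi₆'⟩ := Timed.exists_steps (b := 120)
    (index_steps_le β c (c.update^[l] c.p01))
  obtain ⟨i₇, hi₇, hi₇'⟩ := Timed.exists_steps (b := 20)
    (crossing_steps_le c ω (searchBar β c η c.limit).val)
  obtain ⟨i₈, hi₈, hi₈'⟩ := Timed.exists_steps (indices_steps_le β c d ω)
  obtain ⟨i₉, hi₉, hi₉'⟩ := Timed.exists_steps (b := 120) (index_steps_le β c (c.update^[d] ω))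
  simp only [prepareArm, Timed.bind_steps, Timed.lt_val_iff, hp.not_gt, if_false, stationary_val,
    stationary_steps, Timed.lt_steps, Timed.le_steps, Timed.pure_steps, hωl, if_true, hl, hd,
    stepIter_val hx, stepIter_steps, hi₁, hi₂, hi₃, hi₄, hi₅, hi₆, hi₇, hi₈, hi₉]
  norm_cast
  omega

lemma prepareArm_steps_pos_ge (hx : c.memory < 1) (hp : c.p01 ≤ c.p11) {η : ℝ}
    (hωl : c.limit ≤ ω) {l s : ℕ} (hs : (searchBar β c η c.limit).steps ≤ s)
    (hl : (crossing c c.p01 (searchBar β c η c.limit).val).val = l) :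
    (prepareArm β η c ω).steps ≤ (s + 126 * l + 900 : ℕ) := by
  obtain ⟨i₁, hi₁, hi₁'⟩ := Timed.exists_steps (b := 120) (index_steps_le β c c.limit)
  obtain ⟨i₂, hi₂, hi₂'⟩ := Timed.exists_steps hs
  obtain ⟨i₃, hi₃, hi₃'⟩ := Timed.exists_steps (b := 20)
    (crossing_steps_le c c.p01 (searchBar β c η c.limit).val)
  obtain ⟨i₄, hi₄, hi₄'⟩ := Timed.exists_steps (indices_steps_le β c l c.p01)
  obtain ⟨i₅, hi₅, hi₅'⟩ := Timed.exists_steps (indices_steps_le β c 0 c.p11)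
  obtain ⟨i₆, hi₆, hi₆'⟩ := Timed.exists_steps (b := 120)
    (index_steps_le β c (c.update^[l] c.p01))
  obtain ⟨i₈, hi₈, hi₈'⟩ := Timed.exists_steps (indices_steps_le β c 0 ω)
  simp only [prepareArm, Timed.bind_steps, Timed.lt_val_iff, hp.not_gt, if_false, stationary_val,
    stationary_steps, Timed.lt_steps, Timed.pure_steps, hωl.not_gt, hl, stepIter_val hx,
    stepIter_steps, hi₁, hi₂, hi₃, hi₄, hi₅, hi₆, hi₈]
  norm_cast
  omega

lemma prepareArm_bounds (hc : c.Admissible) (hβ₀ : 0 ≤ β) (hβ₁ : β < 1) (hx : c.memory < 1)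
    (hω : ω ∈ Icc (0 : ℝ) 1) {η r : ℝ} (hη : 0 < η) {n₀ k : ℕ}
    (hn₀ : 3 / (1 - β) ^ 3 ≤ 2 ^ n₀) (hr : c.memory ≤ r) (hk : r ^ k < η / 2 ^ n₀) :
    -- Positively correlated arms have at most (k + 1) + 1 + (k + 1) indices, negatively correlated
    -- ones at most 1 + 2 + 2.
    (prepareArm β η c ω).val.size ≤ 2 * k + 5 ∧
      (prepareArm β η c ω).steps ≤ (126 * n₀ + 252 * k + 1400 : ℕ) := by
  rcases le_or_gt c.p01 c.p11 with hp | hp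
  · have h0 := memory_nonneg hp
    obtain ⟨hbar, hbar1, -, hbar2⟩ := searchBar_spec hc hβ₀ hβ₁ hx hp hη hn₀
    have hcr : ∀ {z : ℝ}, z ∈ Icc (0 : ℝ) 1 →
        (crossing c z (searchBar β c η c.limit).val).val ≤ k := fun hz =>
      crossing_le_of_pow_lt hc h0 hx hbar hr hz (hk.trans_le hbar1)
    have hlk := hcr hc.p01_mem
    have hdk := hcr hω
    generalize hl : (crossing c c.p01 (searchBar β c η c.limit).val).val = l at hlk
    generalize hd : (crossing c ω (searchBar β c η c.limit).val).val = d at hdk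
    rcases lt_or_ge ω c.limit with hωl | hωl
    · constructor
      · rw [prepareArm_val_pos_lt hx hp hωl hl hd, Arm.size]
        simp only [length_whittleList]
        omega
      · refine (prepareArm_steps_pos_lt hx hp hωl hbar2 hl hd).trans (Nat.cast_le.2 ?_)
        omega
    · constructor
      · rw [prepareArm_val_pos_ge hx hp hωl hl, Arm.size]
        simp only [length_whittleList]
        omega
      · refine (prepareArm_steps_pos_ge hx hp hωl hbar2 hl).trans (Nat.cast_le.2 ?_)
        omega
  · constructor
    · rw [prepareArm_val_neg hp, Arm.size]
      simp only [length_whittleList]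
      split_ifs <;> simp only [length_whittleList] <;> omega
    · refine (prepareArm_steps_neg hp η).trans (Nat.cast_le.2 ?_)
      omega

/-! ### Tracks and arms at a given subsidy -/

/-- The track at subsidy `u`. -/
def Track.at (t : Track) (u : ℝ) : Track :=
  ⟨t.z, t.passed + (t.rest.takeWhile fun w => (Timed.le w u).val).length,
    t.rest.dropWhile fun w => (Timed.le w u).val⟩

/-- The arm at subsidy `u`. -/
def Arm.at (a : Arm) (u : ℝ) : Arm := ⟨a.c, a.t01.at u, a.t11.at u, a.t1.at u, a.gray⟩

/-- What is removed at u would also be removed at v. So the state of the arms depends on the last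
visited subsidy only, not on the regions that were skipped. -/
lemma Track.at_at (t : Track) {u v : ℝ} (h : u ≤ v) : (t.at u).at v = t.at v := by
  obtain ⟨z, n, l⟩ := t
  induction l generalizing n with
  | nil => simp [Track.at]
  | cons w l ih =>
    have ih := ih (n + 1)
    by_cases hw : w ≤ u
    · have hw' : w ≤ v := hw.trans h
      simp only [Track.at, List.takeWhile_cons, List.dropWhile_cons, Timed.le_val_iff, hw, hw',
        if_true, List.length_cons, Track.mk.injEq, true_and] at ih ⊢
      exact ⟨by omega, ih.2⟩
    · simp only [Track.at, List.takeWhile_cons, List.dropWhile_cons, Timed.le_val_iff, hw,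
        if_false, List.length_nil, add_zero]

lemma Arm.at_at (a : Arm) {u v : ℝ} (h : u ≤ v) : (a.at u).at v = a.at v := by
  simp [Arm.at, Track.at_at _ h]

lemma Track.at_eq_self {t : Track} {u : ℝ} (h : ∀ w ∈ t.rest, u < w) : t.at u = t := by
  obtain ⟨z, n, l⟩ := t
  cases l with
  | nil => simp [Track.at]
  | cons w l =>
    have hw : ¬ w ≤ u := (h w (by simp)).not_ge
    simp [Track.at, hw]

lemma Track.at_congr {t : Track} {u v : ℝ} (h : ∀ w ∈ t.rest, w ≤ u ↔ w ≤ v) :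
    t.at u = t.at v := by
  obtain ⟨z, n, l⟩ := t
  induction l generalizing n with
  | nil => simp [Track.at]
  | cons w l ih =>
    have ih := ih 0 fun x hx => h x (List.mem_cons_of_mem _ hx)
    have hw := h w (by simp)
    simp only [Track.at, List.takeWhile_cons, List.dropWhile_cons, Timed.le_val_iff, hw,
      Track.mk.injEq, true_and, add_right_inj, zero_add] at ih ⊢
    split_ifs
    · simpa using ih
    · exact ⟨rfl, rfl⟩

lemma advanceList_val (m : ℝ) (l : List ℝ) : ∀ k, (advanceList m k l).val =
    (k + (l.takeWhile fun w => (Timed.le w m).val).length,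
      l.dropWhile fun w => (Timed.le w m).val) := by
  induction l with
  | nil => intro k; simp [advanceList]
  | cons w l ih =>
    intro k
    by_cases hw : w ≤ m
    · simp [advanceList, hw, ih, add_assoc, add_comm 1]
    · simp [advanceList, hw]

lemma advanceList_steps (m : ℝ) (l : List ℝ) : ∀ k, (advanceList m k l).steps ≤
    ((2 * (l.takeWhile fun w => (Timed.le w m).val).length + 2 : ℕ) : ℕ∞) := by
  induction l with
  | nil => intro k; simp [advanceList]
  | cons w l ih =>
    intro k
    by_cases hw : w ≤ m
    · obtain ⟨i, hi, hi'⟩ := Timed.exists_steps (ih (k + 1))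
      simp only [advanceList, Timed.bind_steps, Timed.tick_steps, Timed.le_steps, Timed.le_val_iff,
        hw, if_true, hi, List.takeWhile_cons, List.length_cons]
      norm_cast
      omega
    · simp only [advanceList, Timed.bind_steps, Timed.tick_steps, Timed.le_steps, Timed.le_val_iff,
        hw, if_false, List.takeWhile_cons, Timed.pure_steps, List.length_nil]
      norm_num

lemma advanceTrack_val (m : ℝ) (t : Track) : (advanceTrack m t).val = t.at m := by
  simp [advanceTrack, advanceList_val, Track.at]

/-- Amortized cost: twice the number of remaining indices is a potential that pays for the removals.
-/
lemma advanceTrack_steps (m : ℝ) (t : Track) :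
    ∃ n : ℕ, (advanceTrack m t).steps = n ∧ n + 2 * (t.at m).rest.length ≤
      2 * t.rest.length + 2 := by
  obtain ⟨i, hi, hi'⟩ := Timed.exists_steps (advanceList_steps m t.rest t.passed)
  refine ⟨i, by simp [advanceTrack, hi], ?_⟩
  have h : (t.rest.takeWhile fun w => (Timed.le w m).val).length +
      (t.rest.dropWhile fun w => (Timed.le w m).val).length = t.rest.length := by
    rw [← List.length_append, List.takeWhile_append_dropWhile]
  simp only [Track.at]
  omega

/-- The number of calculated indices of all arms that are still ahead. -/
def totalSize (as : List Arm) : ℕ := (as.map Arm.size).sum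

lemma advance_val (m : ℝ) (as : List Arm) : (advance m as).val = as.map fun a => a.at m := by
  induction as with
  | nil => simp [advance]
  | cons a as ih => simp [advance, ih, advanceTrack_val, Arm.at]

lemma advance_steps (m : ℝ) (as : List Arm) :
    ∃ n : ℕ, (advance m as).steps = n ∧ n + 2 * totalSize (as.map fun a => a.at m) ≤
      2 * totalSize as + 7 * as.length + 1 := by
  induction as with
  | nil => exact ⟨1, by simp [advance], by simp [totalSize]⟩
  | cons a as ih =>
    obtain ⟨n, hn, hn'⟩ := ih
    obtain ⟨i, hi, hi'⟩ := advanceTrack_steps m a.t01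
    obtain ⟨j, hj, hj'⟩ := advanceTrack_steps m a.t11
    obtain ⟨k, hk, hk'⟩ := advanceTrack_steps m a.t1
    refine ⟨1 + (i + (j + (k + n))), ?_, ?_⟩
    · simp only [advance, Timed.bind_steps, Timed.tick_steps, Timed.pure_steps, hi, hj, hk, hn]
      norm_cast
    · simp only [totalSize, List.map_cons, List.sum_cons, Arm.size, Arm.at,
        List.length_cons] at hn' ⊢
      omega

/-! ### Passive time and value -/

lemma takeWhile_map_range' (f : ℕ → ℝ) (p : ℝ → Bool) (n : ℕ) : ∀ s,
    (((List.range' s n).map f).dropWhile p = [] ∧ ∀ k < n, p (f (s + k)) = true) ∨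
    (((List.range' s n).map f).dropWhile p ≠ [] ∧
      (∀ k < (((List.range' s n).map f).takeWhile p).length, p (f (s + k)) = true) ∧
      p (f (s + (((List.range' s n).map f).takeWhile p).length)) = false) := by
  induction n with
  | zero => intro s; simp
  | succ n ih =>
    intro s
    rw [List.range'_succ, List.map_cons, List.takeWhile_cons, List.dropWhile_cons]
    by_cases h : p (f s) = true
    · simp only [h, if_true, List.length_cons]
      have key : ∀ N, (∀ k < N, p (f (s + 1 + k)) = true) → ∀ k < N + 1, p (f (s + k)) = true := by
        intro N hN k hk
        cases k with
        | zero => exact h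
        | succ k =>
          rw [← Nat.add_assoc, Nat.add_right_comm]
          exact hN k (by omega)
      rcases ih (s + 1) with ⟨h1, h2⟩ | ⟨h1, h2, h3⟩
      · exact Or.inl ⟨h1, key n h2⟩
      · refine Or.inr ⟨h1, key _ h2, ?_⟩
        rw [← Nat.add_assoc, Nat.add_right_comm]
        exact h3
    · right
      simp only [h]
      simpa using h

/-- A track at a subsidy `m` that it decides knows the crossing time. -/
lemma Track.Starts.at_cases {t : Track} {z : ℝ} (ht : t.Starts β c z) (hd : t.Decides β c m) :
    ((t.at m).rest = [] ∧ ∀ k, whittle β c (c.update^[k] z) ≤ m) ∨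
    ((t.at m).rest ≠ [] ∧ (∀ k < (t.at m).passed, whittle β c (c.update^[k] z) ≤ m) ∧
      m < whittle β c (c.update^[(t.at m).passed] z)) := by
  obtain ⟨hz, hp, n, hr⟩ := ht
  have h := takeWhile_map_range' (fun k => whittle β c (c.update^[k] z))
    (fun w => (Timed.le w m).val) (n + 1) 0
  rw [← List.range_eq_range'] at h
  simp only [Track.at, hp, hr, zero_add, whittleList] at h ⊢
  rcases h with ⟨h1, h2⟩ | ⟨h1, h2, h3⟩
  · refine Or.inl ⟨h1, ?_⟩
    rw [← hz]
    refine hd fun w hw => ?_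
    rw [hr, mem_whittleList] at hw
    obtain ⟨k, hk, rfl⟩ := hw
    simpa using h2 k (by omega)
  · refine Or.inr ⟨h1, fun k hk => by simpa using h2 k hk, ?_⟩
    rw [← Bool.not_eq_true, Timed.le_val_iff, not_le] at h3
    exact h3

/-- The relation that `crossingData` is meant to satisfy for the income `J` of a policy. -/
structure IsCrossingData (c : Channel) (β μ : ℝ) (J : ℝ → ℝ) (z : ℝ) (x : ℝ × ℝ × ℝ) : Prop where
  b_mem : x.2.1 ∈ Icc (0 : ℝ) 1
  s_mem : x.2.2 ∈ Icc (0 : ℝ) 1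
  eq : J z = x.1 * μ + x.2.1 * (c.B * x.2.2 + β * (x.2.2 * J c.p11 + (1 - x.2.2) * J c.p01))

lemma isCrossingData (hc : c.Admissible) (hβ₀ : 0 ≤ β) (hβ₁ : β < 1) (hx : c.memory < 1)
    {t : Track} {z : ℝ} (hz : z ∈ Icc (0 : ℝ) 1) (ht : t.Starts β c z) (hd : t.Decides β c m)
    (μ : ℝ) :
    IsCrossingData c β μ (c.totalReward β μ (indexPolicy c β m)) z
      (crossingData β c (t.at m)).val := by
  rcases ht.at_cases hd with ⟨h1, h2⟩ | ⟨h1, h2, h3⟩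
  · have hv : (crossingData β c (t.at m)).val = (1 / (1 - β), 0, 0) := by
      unfold crossingData
      rw [h1]
      rfl
    rw [hv]
    refine ⟨by simp, by simp, ?_⟩
    rw [totalReward_indexPolicy_of_never hc hβ₀ hβ₁ μ m hz h2]
    ring
  · obtain ⟨w, l, hw⟩ := List.exists_cons_of_ne_nil h1
    have hv : (crossingData β c (t.at m)).val = ((1 - β ^ (t.at m).passed) / (1 - β),
        β ^ (t.at m).passed, c.update^[(t.at m).passed] z) := by
      have hz' : (t.at m).z = z := ht.z_eq
      unfold crossingData
      rw [hw]
      simp [stepIter_val hx, hz']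
    rw [hv]
    refine ⟨⟨pow_nonneg hβ₀ _, pow_le_one₀ hβ₀ hβ₁.le⟩, hc.iterate_mem hz _, ?_⟩
    rw [totalReward_indexPolicy_of_crossing hc hβ₀ hβ₁ μ m hz h2 h3]
    unfold activeIncome
    ring

lemma crossingData_steps_le (β : ℝ) (c : Channel) (t : Track) :
    (crossingData β c t).steps ≤ (20 : ℕ) := by
  unfold crossingData
  split <;> simp [stepIter_steps] <;> norm_num

/-- The solution of the linear equations of `income`. -/
def incomeFormula (β m B : ℝ) (x₀ x₁ x : ℝ × ℝ × ℝ) : ℝ :=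
  let d := (1 - β * x₀.2.1 * (1 - x₀.2.2)) * (1 - β * x₁.2.1 * x₁.2.2) -
    β * x₀.2.1 * x₀.2.2 * (β * x₁.2.1 * (1 - x₁.2.2))
  let r₀ := x₀.1 * m + x₀.2.1 * (B * x₀.2.2)
  let r₁ := x₁.1 * m + x₁.2.1 * (B * x₁.2.2)
  x.1 * m + x.2.1 * (B * x.2.2) + β * x.2.1 *
    (x.2.2 * ((r₁ * (1 - β * x₀.2.1 * (1 - x₀.2.2)) + β * x₁.2.1 * (1 - x₁.2.2) * r₀) / d) +
      (1 - x.2.2) * ((r₀ * (1 - β * x₁.2.1 * x₁.2.2) + β * x₀.2.1 * x₀.2.2 * r₁) / d))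

lemma income_val (β m B : ℝ) (a : Arm) : (income β m B a).val =
    incomeFormula β m B (crossingData β a.c a.t01).val (crossingData β a.c a.t11).val
      (crossingData β a.c a.t1).val := rfl

/-- With the crossing data fixed, the solution of the linear system is linear in the payments. The
coefficient of m is the passive time that the sweep computes. -/
lemma income_affine (β m B : ℝ) (a : Arm) :
    (income β m B a).val = m * (income β 1 0 a).val + (income β 0 B a).val := by
  simp only [income_val, incomeFormula]
  ring

lemma income_steps_le (β m B : ℝ) (a : Arm) : (income β m B a).steps ≤ (130 : ℕ) := by
  obtain ⟨i, hi, hi'⟩ := Timed.exists_steps (crossingData_steps_le β a.c a.t01)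
  obtain ⟨j, hj, hj'⟩ := Timed.exists_steps (crossingData_steps_le β a.c a.t11)
  obtain ⟨k, hk, hk'⟩ := Timed.exists_steps (crossingData_steps_le β a.c a.t1)
  simp only [income, Timed.bind_steps, Timed.add_steps, Timed.sub_steps, Timed.mul_steps,
    Timed.div_steps, Timed.const_steps, Timed.one_steps, hi, hj, hk]
  norm_cast
  omega

lemma incomeFormula_eq (hβ₀ : 0 ≤ β) (hβ₁ : β < 1) {μ z : ℝ} {J : ℝ → ℝ}
    {x₀ x₁ x : ℝ × ℝ × ℝ} (h₀ : IsCrossingData c β μ J c.p01 x₀)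
    (h₁ : IsCrossingData c β μ J c.p11 x₁) (h : IsCrossingData c β μ J z x) :
    incomeFormula β μ c.B x₀ x₁ x = J z := by
  obtain ⟨A₀, b₀, s₀⟩ := x₀
  obtain ⟨A₁, b₁, s₁⟩ := x₁
  obtain ⟨A, b, s⟩ := x
  obtain ⟨hb₀, hs₀, e₀⟩ := h₀
  obtain ⟨hb₁, hs₁, e₁⟩ := h₁
  obtain ⟨-, -, e⟩ := h
  simp only [incomeFormula] at *
  -- With u = βb₀ and v = βb₁ below 1, the determinant equals (1-u)(1-v) + u s₀ (1-v) + v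
  -- (1-s₁)(1-u).
  have hd : (1 - β * b₀ * (1 - s₀)) * (1 - β * b₁ * s₁) - β * b₀ * s₀ * (β * b₁ * (1 - s₁)) ≠ 0 := by
    have u0 : 0 ≤ β * b₀ := mul_nonneg hβ₀ hb₀.1
    have u1 : β * b₀ < 1 := (mul_le_of_le_one_right hβ₀ hb₀.2).trans_lt hβ₁
    have v0 : 0 ≤ β * b₁ := mul_nonneg hβ₀ hb₁.1
    have v1 : β * b₁ < 1 := (mul_le_of_le_one_right hβ₀ hb₁.2).trans_lt hβ₁
    have p := mul_pos (sub_pos.2 u1) (sub_pos.2 v1)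
    have q1 := mul_nonneg (mul_nonneg u0 hs₀.1) (sub_nonneg.2 v1.le)
    have q2 := mul_nonneg (mul_nonneg v0 (sub_nonneg.2 hs₁.2)) (sub_nonneg.2 u1.le)
    apply ne_of_gt
    nlinarith
  have j₁ : J c.p11 = ((A₁ * μ + b₁ * (c.B * s₁)) * (1 - β * b₀ * (1 - s₀)) +
      β * b₁ * (1 - s₁) * (A₀ * μ + b₀ * (c.B * s₀))) /
      ((1 - β * b₀ * (1 - s₀)) * (1 - β * b₁ * s₁) - β * b₀ * s₀ * (β * b₁ * (1 - s₁))) := by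
    rw [eq_div_iff hd]
    linear_combination (1 - β * b₀ * (1 - s₀)) * e₁ + β * b₁ * (1 - s₁) * e₀
  have j₀ : J c.p01 = ((A₀ * μ + b₀ * (c.B * s₀)) * (1 - β * b₁ * s₁) +
      β * b₀ * s₀ * (A₁ * μ + b₁ * (c.B * s₁))) /
      ((1 - β * b₀ * (1 - s₀)) * (1 - β * b₁ * s₁) - β * b₀ * s₀ * (β * b₁ * (1 - s₁))) := by
    rw [eq_div_iff hd]
    linear_combination (1 - β * b₁ * s₁) * e₀ + β * b₀ * s₀ * e₁
  rw [← j₁, ← j₀, e]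
  ring

lemma income_at_eq (hc : c.Admissible) (hβ₀ : 0 ≤ β) (hβ₁ : β < 1) (hx : c.memory < 1)
    (hω : ω ∈ Icc (0 : ℝ) 1) {η : ℝ} {a : Arm} (ha : a.Prepared β η c ω) (hm : a.Clear m) (μ : ℝ) :
    (income β μ c.B (a.at m)).val = c.totalReward β μ (indexPolicy c β m) ω := by
  rw [income_val]
  have hca : (a.at m).c = c := ha.c_eq
  rw [hca]
  exact incomeFormula_eq hβ₀ hβ₁
    (isCrossingData hc hβ₀ hβ₁ hx hc.p01_mem ha.t01 (ha.decides01 m hm) μ)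
    (isCrossingData hc hβ₀ hβ₁ hx hc.p11_mem ha.t11 (ha.decides11 m hm) μ)
    (isCrossingData hc hβ₀ hβ₁ hx hω ha.t1 (ha.decides1 m hm) μ)

lemma value_eq_income (hc : c.Admissible) (hβ₀ : 0 ≤ β) (hβ₁ : β < 1) (hx : c.memory < 1)
    (hω : ω ∈ Icc (0 : ℝ) 1) {η : ℝ} {a : Arm} (ha : a.Prepared β η c ω) (hm : a.Clear m) :
    c.value β m ω = (income β m c.B (a.at m)).val := by
  rw [income_at_eq hc hβ₀ hβ₁ hx hω ha hm, totalReward_indexPolicy_eq_value hc hβ₀ hβ₁ hx m hω]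

/-- The passive time is a subgradient of the value. -/
lemma value_subgradient (hc : c.Admissible) (hβ₀ : 0 ≤ β) (hβ₁ : β < 1) (hx : c.memory < 1)
    (hω : ω ∈ Icc (0 : ℝ) 1) {η : ℝ} {a : Arm} (ha : a.Prepared β η c ω) (hm : a.Clear m) (μ : ℝ) :
    c.value β m ω + (income β 1 0 (a.at m)).val * (μ - m) ≤ c.value β μ ω := by
  -- The left side is exactly the reward at subsidy μ of the policy that is optimal at m.
  refine le_trans (le_of_eq ?_)
    (totalReward_le_value hc hβ₀ hβ₁ μ (indexPolicy c β m) hω)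
  rw [← income_at_eq hc hβ₀ hβ₁ hx hω ha hm, value_eq_income hc hβ₀ hβ₁ hx hω ha hm,
    income_affine β m, income_affine β μ]
  ring

/-! ### Lists and sorting -/

lemma prepend_val (l acc : List ℝ) : (prepend l acc).val = l ++ acc := by
  induction l with
  | nil => rfl
  | cons a l ih => simp [prepend, ih]

lemma prepend_steps (l acc : List ℝ) : (prepend l acc).steps = (l.length + 1 : ℕ) := by
  induction l with
  | nil => simp [prepend]
  | cons a l ih =>
    simp only [prepend, Timed.bind_steps, Timed.tick_steps, Timed.pure_steps, ih, List.length_cons]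
    norm_cast
    omega

lemma count_val (l : List ℝ) : (count l).val = l.length := by
  induction l with
  | nil => rfl
  | cons a l ih => simp [count, ih]

lemma count_steps (l : List ℝ) : (count l).steps = (l.length + 1 : ℕ) := by
  induction l with
  | nil => simp [count]
  | cons a l ih =>
    simp only [count, Timed.bind_steps, Timed.tick_steps, Timed.pure_steps, ih, List.length_cons]
    norm_cast
    omega

/-- The indices that were calculated for an arm. -/
def Arm.points (a : Arm) : List ℝ :=
  (a.gray.map Prod.snd).toList ++ (a.t1.rest ++ (a.t11.rest ++ a.t01.rest))

lemma Arm.length_points_le (a : Arm) : a.points.length ≤ a.size + 1 := by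
  have : (a.gray.map Prod.snd).toList.length ≤ 1 := by cases a.gray <;> simp
  simp only [Arm.points, Arm.size, List.length_append]
  omega

lemma collect_val (as : List Arm) : (collect as).val = (as.map Arm.points).flatten := by
  induction as with
  | nil => rfl
  | cons a as ih =>
    obtain ⟨c, t01, t11, t1, g⟩ := a
    cases g <;> simp [collect, ih, prepend_val, Arm.points]

lemma length_collect_le (as : List Arm) : (collect as).val.length ≤ totalSize as + as.length := by
  rw [collect_val]
  induction as with
  | nil => simp
  | cons a as ih =>
    have := a.length_points_le
    simp only [totalSize, List.map_cons, List.flatten_cons, List.length_append, List.sum_cons,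
      List.length_cons] at ih ⊢
    omega

lemma collect_steps (as : List Arm) :
    (collect as).steps ≤ (totalSize as + 4 * as.length + 1 : ℕ) := by
  induction as with
  | nil => simp [collect]
  | cons a as ih =>
    obtain ⟨i, hi, hi'⟩ := Timed.exists_steps ih
    obtain ⟨c, t01, t11, t1, g⟩ := a
    cases g <;>
    · simp only [collect, Timed.bind_steps, Timed.tick_steps, Timed.pure_steps, hi, prepend_steps,
        totalSize, List.map_cons, List.sum_cons, Arm.size, List.length_cons]
      simp only [totalSize] at hi'
      norm_cast
      omega

lemma split_spec (l : List ℝ) : ((split l).val.1 ++ (split l).val.2).Perm l ∧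
    (split l).val.1.length = (l.length + 1) / 2 ∧ (split l).val.2.length = l.length / 2 ∧
    (split l).steps = (l.length + 1 : ℕ) := by
  induction l with
  | nil => simp [split]
  | cons a l ih =>
    obtain ⟨h1, h2, h3, h4⟩ := ih
    refine ⟨?_, ?_, ?_, ?_⟩
    · simp only [split, Timed.bind_val, Timed.pure_val, List.cons_append]
      exact (List.perm_append_comm.trans h1).cons a
    · simp only [split, Timed.bind_val, Timed.pure_val, List.length_cons]
      omega
    · simp only [split, Timed.bind_val, Timed.pure_val, List.length_cons]
      omega
    · simp only [split, Timed.bind_steps, Timed.tick_steps, Timed.pure_steps, h4, List.length_cons]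
      norm_cast
      omega

lemma merge_perm (u v : List ℝ) : (merge u v).val.Perm (u ++ v) := by
  induction u, v using merge.induct with
  | case1 v => simp [merge]
  | case2 u h => cases u <;> simp [merge]
  | case3 a u b v ih1 ih2 =>
    rw [merge]
    simp only [Timed.bind_val, Timed.ite_val, Timed.pure_val]
    split_ifs
    · exact ih1.cons a
    · exact (ih2.cons b).trans List.perm_middle.symm

lemma merge_sorted (u v : List ℝ) (hu : u.Pairwise (· ≤ ·)) (hv : v.Pairwise (· ≤ ·)) :
    (merge u v).val.Pairwise (· ≤ ·) := by
  induction u, v using merge.induct with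
  | case1 v => simpa [merge] using hv
  | case2 u h =>
    cases u with
    | nil => simp [merge]
    | cons a u => simpa [merge] using hu
  | case3 a u b v ih1 ih2 =>
    rw [merge]
    simp only [Timed.bind_val, Timed.ite_val, Timed.pure_val, Timed.le_val_iff]
    rw [List.pairwise_cons] at hu hv
    split_ifs with h
    · refine List.pairwise_cons.2 ⟨fun x hx => ?_, ih1 hu.2 (List.pairwise_cons.2 hv)⟩
      have hx' := (merge_perm _ _).mem_iff.1 hx
      simp only [List.mem_append, List.mem_cons] at hx'
      rcases hx' with hx' | rfl | hx'
      · exact hu.1 x hx'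
      · exact h
      · exact h.trans (hv.1 x hx')
    · refine List.pairwise_cons.2 ⟨fun x hx => ?_, ih2 (List.pairwise_cons.2 hu) hv.2⟩
      have hx' := (merge_perm _ _).mem_iff.1 hx
      simp only [List.mem_append, List.mem_cons] at hx'
      push Not at h
      rcases hx' with (rfl | hx') | hx'
      · exact h.le
      · exact h.le.trans (hu.1 x hx')
      · exact hv.1 x hx'

lemma merge_steps (u v : List ℝ) :
    (merge u v).steps ≤ (2 * (u.length + v.length) + 1 : ℕ) := by
  induction u, v using merge.induct with
  | case1 v => simp [merge]
  | case2 u h => cases u <;> simp [merge]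
  | case3 a u b v ih1 ih2 =>
    obtain ⟨i, hi, hi'⟩ := Timed.exists_steps ih1
    obtain ⟨j, hj, hj'⟩ := Timed.exists_steps ih2
    simp only [List.length_cons] at hi' hj'
    rw [merge]
    simp only [Timed.bind_steps, Timed.ite_steps, Timed.pure_steps, Timed.tick_steps,
      Timed.le_steps, hi, hj, List.length_cons]
    split_ifs <;> norm_cast <;> omega

/-- The argument n is only fuel. The cost is governed by any k with length at most 2^k, since both
halves then have length at most 2^(k-1). -/
lemma mergeSort_spec (n : ℕ) : ∀ l : List ℝ, l.length ≤ n →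
    (mergeSort n l).val.Perm l ∧ (mergeSort n l).val.Pairwise (· ≤ ·) ∧
    ∀ k, l.length ≤ 2 ^ k → (mergeSort n l).steps ≤ (8 * l.length * k + 1 : ℕ) := by
  induction n with
  | zero =>
    intro l hl
    obtain rfl : l = [] := List.length_eq_zero_iff.1 (by omega)
    simp [mergeSort]
  | succ n ih =>
    intro l hl
    match l with
    | [] => simp [mergeSort]
    | [a] => simp [mergeSort]
    | a :: b :: l =>
      obtain ⟨p1, p2, p3, p4⟩ := split_spec (a :: b :: l)
      set w := a :: b :: l with hw
      have hlen : w.length = l.length + 2 := by simp [hw]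
      set s := split w with hs
      obtain ⟨u1, u2, u3⟩ := ih s.val.1 (by omega)
      obtain ⟨v1, v2, v3⟩ := ih s.val.2 (by omega)
      have hval : (mergeSort (n + 1) w).val =
          (merge (mergeSort n s.val.1).val (mergeSort n s.val.2).val).val := rfl
      have hsteps : (mergeSort (n + 1) w).steps = 1 + (s.steps + ((mergeSort n s.val.1).steps +
          ((mergeSort n s.val.2).steps +
            (merge (mergeSort n s.val.1).val (mergeSort n s.val.2).val).steps))) := rfl
      refine ⟨?_, ?_, fun k hk => ?_⟩
      · rw [hval]
        exact (merge_perm _ _).trans ((u1.append v1).trans p1)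
      · rw [hval]
        exact merge_sorted _ _ u2 v2
      · cases k with
        | zero => rw [pow_zero] at hk; omega
        | succ k =>
          rw [pow_succ] at hk
          obtain ⟨i, hi, hi'⟩ := Timed.exists_steps (u3 k (by omega))
          obtain ⟨j, hj, hj'⟩ := Timed.exists_steps (v3 k (by omega))
          obtain ⟨r, hr, hr'⟩ := Timed.exists_steps
            (merge_steps (mergeSort n s.val.1).val (mergeSort n s.val.2).val)
          rw [u1.length_eq, v1.length_eq] at hr'
          rw [hsteps, p4, hi, hj, hr]
          norm_cast
          have hsum : s.val.1.length + s.val.2.length = w.length := by omega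
          have : 8 * s.val.1.length * k + 8 * s.val.2.length * k = 8 * w.length * k := by
            rw [← hsum]; ring
          rw [Nat.mul_succ]
          omega

/-! ### Sums over the arms -/

lemma totalPassive_val (β : ℝ) (as : List Arm) :
    (totalPassive β as).val = (as.map fun a => (income β 1 0 a).val).sum := by
  induction as with
  | nil => rfl
  | cons a as ih => simp [totalPassive, ih]

lemma totalPassive_steps (β : ℝ) (as : List Arm) :
    (totalPassive β as).steps ≤ (132 * as.length + 1 : ℕ) := by
  induction as with
  | nil => simp [totalPassive]
  | cons a as ih =>
    obtain ⟨i, hi, hi'⟩ := Timed.exists_steps ih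
    obtain ⟨j, hj, hj'⟩ := Timed.exists_steps (income_steps_le β 1 0 a)
    simp only [totalPassive, Timed.bind_steps, Timed.tick_steps, Timed.add_steps,
      Timed.const_steps, hi, hj, List.length_cons]
    norm_cast
    omega

lemma totalValue_val (β m : ℝ) (as : List Arm) :
    (totalValue β m as).val = (as.map fun a => (income β m a.c.B a).val).sum := by
  induction as with
  | nil => rfl
  | cons a as ih => simp [totalValue, ih]

lemma totalValue_steps (β m : ℝ) (as : List Arm) :
    (totalValue β m as).steps ≤ (132 * as.length + 1 : ℕ) := by
  induction as with
  | nil => simp [totalValue]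
  | cons a as ih =>
    obtain ⟨i, hi, hi'⟩ := Timed.exists_steps ih
    obtain ⟨j, hj, hj'⟩ := Timed.exists_steps (income_steps_le β m a.c.B a)
    simp only [totalValue, Timed.bind_steps, Timed.tick_steps, Timed.add_steps,
      Timed.const_steps, hi, hj, List.length_cons]
    norm_cast
    omega

lemma covered_val_iff (u v : ℝ) (as : List Arm) :
    (covered u v as).val = true ↔ ∃ a ∈ as, ∃ g, a.gray = some g ∧ g.1 ≤ u ∧ v ≤ g.2 := by
  induction as with
  | nil => simp [covered]
  | cons a as ih =>
    obtain ⟨c, t01, t11, t1, g⟩ := a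
    cases g with
    | none => simp [covered, ih]
    | some g =>
      obtain ⟨lo, hi⟩ := g
      simp only [covered, Timed.bind_val, Timed.ite_val, Timed.le_val_iff, Timed.pure_val,
        List.exists_mem_cons_iff, Option.some.injEq, exists_eq_left']
      split_ifs with h1 h2
      · simp [h1, h2]
      · rw [ih]; simp [h2]
      · rw [ih]; simp [h1]

lemma covered_steps (u v : ℝ) (as : List Arm) :
    (covered u v as).steps ≤ (3 * as.length + 1 : ℕ) := by
  induction as with
  | nil => simp [covered]
  | cons a as ih =>
    obtain ⟨i, hi, hi'⟩ := Timed.exists_steps ih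
    obtain ⟨c, t01, t11, t1, g⟩ := a
    cases g with
    | none =>
      simp only [covered, Timed.bind_steps, Timed.tick_steps, hi, List.length_cons]
      norm_cast
      omega
    | some g =>
      simp only [covered, Timed.bind_steps, Timed.ite_steps, Timed.le_steps, Timed.tick_steps,
        Timed.pure_steps, hi, List.length_cons]
      split_ifs <;> norm_cast <;> omega

lemma prepare_val (β η : ℝ) (l : List (Channel × ℝ)) :
    (prepare β η l).val = l.map fun p => (prepareArm β η p.1 p.2).val := by
  induction l with
  | nil => rfl
  | cons p l ih => simp [prepare, ih]

lemma prepare_steps {η : ℝ} {b : ℕ} {l : List (Channel × ℝ)}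
    (h : ∀ p ∈ l, (prepareArm β η p.1 p.2).steps ≤ b) :
    (prepare β η l).steps ≤ ((b + 1) * l.length + 1 : ℕ) := by
  induction l with
  | nil => simp [prepare]
  | cons p l ih =>
    obtain ⟨i, hi, hi'⟩ := Timed.exists_steps (ih fun q hq => h q (List.mem_cons_of_mem _ hq))
    obtain ⟨j, hj, hj'⟩ := Timed.exists_steps (h p List.mem_cons_self)
    simp only [prepare, Timed.bind_steps, Timed.tick_steps, Timed.pure_steps, hi, hj,
      List.length_cons]
    rw [Nat.mul_succ]
    norm_cast
    omega

/-! ### The sweep over the regions -/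

/-- `u` and `v` bound a region: no calculated index lies strictly between them. -/
def Region (S : Set ℝ) (u v : ℝ) : Prop := u ≤ v ∧ ∀ s ∈ S, s ≤ u ∨ v ≤ s

/-- The region `[u, v)` is contained in the gray area of some arm. -/
def Gray (as : List Arm) (u v : ℝ) : Prop :=
  ∃ a ∈ as, ∃ g, a.gray = some g ∧ g.1 ≤ u ∧ v ≤ g.2

lemma covered_at_iff (u v w : ℝ) (as : List Arm) :
    (covered u v (as.map fun a => a.at w)).val = true ↔ Gray as u v := by
  simp [covered_val_iff, Gray, Arm.at]

lemma map_at_at (as : List Arm) {u v : ℝ} (h : u ≤ v) :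
    ((as.map fun a => a.at u).map fun a => a.at v) = as.map fun a => a.at v := by
  simp [Arm.at_at _ h]

lemma sweep_val_cons (β κ : ℝ) (u v : ℝ) (l : List ℝ) (as : List Arm) :
    (sweep β κ (u :: v :: l) as).val =
      if u < v → (covered u v as).val = true then (sweep β κ (v :: l) as).val
      else if 0 ≤ (totalPassive β (advance u as).val).val - κ then (u, (advance u as).val)
      else (sweep β κ (v :: l) (advance u as).val).val := by
  rw [sweep]
  by_cases h : u < v
  · by_cases h' : (covered u v as).val = true <;> simp [h, h']
  · simp [h]

/-- A loop rule: `Inv` is kept at the left end of the current region and `Done` holds at the output.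
The arms are tracked as the original ones brought to the last visited subsidy `w ≤ u`, which may lag
behind u after skipped regions. -/
lemma sweep_spec {β κ e : ℝ} {as : List Arm} {S : Set ℝ} {Inv Done : ℝ → Prop}
    (skip : ∀ u v, Region S u v → (u < v → Gray as u v) → Inv u → Inv v)
    (next : ∀ u v, Region S u v → u < v → ¬ Gray as u v → Inv u →
      (totalPassive β (as.map fun a => a.at u)).val - κ < 0 → Inv v)
    (done : ∀ u v, Region S u v → u < v → ¬ Gray as u v → Inv u →
      0 ≤ (totalPassive β (as.map fun a => a.at u)).val - κ → Done u)
    (last : Inv e → Done e) (l : List ℝ) :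
    ∀ u w, w ≤ u → (u :: l).Pairwise (· ≤ ·) → (u :: l).getLast? = some e →
      (∀ s ∈ S, s ≤ u ∨ s ∈ l) → Inv u →
      ∃ m, (sweep β κ (u :: l) (as.map fun a => a.at w)).val = (m, as.map fun a => a.at m) ∧
        Done m := by
  induction l with
  | nil =>
    intro u w hw _ he _ hI
    obtain rfl : u = e := by simpa using he
    refine ⟨u, ?_, last hI⟩
    rw [sweep]
    simp only [Timed.bind_val, Timed.pure_val, advance_val, map_at_at _ hw]
  | cons v l ih =>
    intro u w hw hs he hS hI
    rw [List.pairwise_cons] at hs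
    have huv : u ≤ v := hs.1 v List.mem_cons_self
    have hR : Region S u v := ⟨huv, fun s hs' => (hS s hs').imp_right fun h => by
      rcases List.mem_cons.1 h with rfl | h
      · exact le_rfl
      · exact (List.pairwise_cons.1 hs.2).1 s h⟩
    have hS' : ∀ s ∈ S, s ≤ v ∨ s ∈ l := fun s hs' => by
      rcases hS s hs' with h | h
      · exact Or.inl (h.trans huv)
      · rcases List.mem_cons.1 h with rfl | h
        · exact Or.inl le_rfl
        · exact Or.inr h
    have he' : (v :: l).getLast? = some e := by rwa [List.getLast?_cons_cons] at he
    rw [sweep_val_cons, advance_val, map_at_at _ hw]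
    split_ifs with h1 h2
    · exact ih v w (hw.trans huv) hs.2 he' hS'
        (skip u v hR (fun h => (covered_at_iff u v w as).1 (h1 h)) hI)
    · rw [covered_at_iff] at h1
      push Not at h1
      exact ⟨u, rfl, done u v hR h1.1 h1.2 hI h2⟩
    · rw [covered_at_iff] at h1
      push Not at h1 h2
      exact ih v u huv hs.2 he' hS' (next u v hR h1.1 h1.2 hI h2)

lemma length_sweep (β κ : ℝ) (u : ℝ) (l : List ℝ) : ∀ as : List Arm,
    (sweep β κ (u :: l) as).val.2.length = as.length := by
  induction l generalizing u with
  | nil => intro as; rw [sweep]; simp [advance_val]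
  | cons v l ih =>
    intro as
    rw [sweep_val_cons]
    split_ifs
    · exact ih v as
    · simp [advance_val]
    · rw [ih, advance_val, List.length_map]

/-- Per region, 142 = 7 + 3 + 132 counts advancing, testing for gray and summing the passive times
over the arms. The term 2·totalSize is the potential that pays for all removals of indices in the
whole sweep. -/
lemma sweep_steps (β κ : ℝ) (l : List ℝ) : ∀ as : List Arm,
    (sweep β κ l as).steps ≤ (2 * totalSize as + (142 * as.length + 10) * l.length + 1 : ℕ) := by
  induction l with
  | nil => intro as; simp [sweep]
  | cons u l ih =>
    cases l with
    | nil =>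
      intro as
      obtain ⟨i, hi, hi'⟩ := advance_steps u as
      rw [sweep]
      simp only [Timed.bind_steps, Timed.tick_steps, Timed.pure_steps, hi, List.length_cons,
        List.length_nil]
      norm_cast
      omega
    | cons v l =>
      intro as
      obtain ⟨i, hi, hi'⟩ := advance_steps u as
      obtain ⟨j, hj, hj'⟩ := Timed.exists_steps (covered_steps u v as)
      obtain ⟨k, hk, hk'⟩ := Timed.exists_steps (ih as)
      obtain ⟨p, hp, hp'⟩ := Timed.exists_steps (totalPassive_steps β (advance u as).val)
      obtain ⟨q, hq, hq'⟩ := Timed.exists_steps (ih (advance u as).val)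
      have hlen : (advance u as).val.length = as.length := by rw [advance_val, List.length_map]
      have hsz : totalSize (advance u as).val = totalSize (as.map fun a => a.at u) := by
        rw [advance_val]
      rw [hlen] at hp' hq'
      rw [hsz] at hq'
      rw [sweep]
      simp only [Timed.bind_steps, Timed.tick_steps, Timed.pure_steps, Timed.ite_steps,
        Timed.lt_steps, Timed.le_steps, Timed.sub_steps, Timed.const_steps, hi, hj, hk, hp, hq,
        List.length_cons] at hk' hq' ⊢
      rw [Nat.mul_succ]
      split_ifs <;> norm_cast <;> omega

/-! ### The Lagrangian -/

lemma slotReward_allActive (c : Channel) (m m' : ℝ) (t : ℕ) : ∀ ω,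
    c.slotReward m t (stationaryPolicy fun _ => true) ω =
      c.slotReward m' t (stationaryPolicy fun _ => true) ω := by
  induction t with
  | zero => intro ω; simp [Channel.slotReward, stationaryPolicy]
  | succ t ih =>
    intro ω
    simp only [Channel.slotReward, stationaryPolicy_shift]
    rw [ih c.p11, ih c.p01, ih (c.update ω)]

/-- For m ≤ 0 the gap is nonpositive everywhere, so always activating is optimal and the subsidy is
never collected. -/
lemma value_of_nonpos (hc : c.Admissible) (hβ₀ : 0 ≤ β) (hβ₁ : β < 1) (hm : m ≤ 0)
    (hω : ω ∈ Icc (0 : ℝ) 1) : c.value β m ω = c.value β 0 ω := by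
  have key : ∀ μ ≤ 0, c.totalReward β μ (stationaryPolicy fun _ => true) ω = c.value β μ ω := by
    intro μ hμ
    obtain ⟨-, -, M, hM⟩ := value_facts hc hβ₀ hβ₁ μ
    refine totalReward_stationary_unique hc hβ₀ hβ₁ (fun z hz => ?_) hM hω
    have hg : gap c β μ z ≤ 0 :=
      (gap_le hc hβ₀ hβ₁ hz).trans (by linarith [mul_nonneg hz.1 hc.B_mem.1.le])
    simpa [activeIncome] using value_eq_active hc hβ₀ hβ₁ hz hg
  rw [← key m hm, ← key 0 le_rfl]
  unfold Channel.totalReward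
  simp only [slotReward_allActive c m 0]

/-- The arms of a bandit after their preparation. -/
structure PreparedBandit {N : ℕ} (K : ℕ) (β η : ℝ) (c : Fin N → Channel) (ω : Fin N → ℝ)
    (arm : Fin N → Arm) : Prop where
  beta_nonneg : 0 ≤ β
  beta_lt_one : β < 1
  lt : K < N
  admissible : ∀ i, (c i).Admissible
  memory_lt_one : ∀ i, (c i).memory < 1
  belief_mem : ∀ i, ω i ∈ Icc (0 : ℝ) 1
  prepared : ∀ i, (arm i).Prepared β η (c i) (ω i)

namespace PreparedBandit

variable {N K : ℕ} {η : ℝ} {C : Fin N → Channel} {w : Fin N → ℝ} {arm : Fin N → Arm}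

lemma continuous_lagrangian (h : PreparedBandit K β η C w arm) :
    Continuous (lagrangian β K C w) := by
  unfold lagrangian
  have : Continuous fun m => ∑ i, (C i).value β m (w i) :=
    continuous_finsetSum _ fun i _ =>
      continuous_value (h.admissible i) h.beta_nonneg h.beta_lt_one (h.belief_mem i)
  fun_prop

/-- The N values grow at rate at most 1/(1-β) each and (N-K)/(1-β) is subtracted. The resulting rate
K/(1-β) explains the factor 1/K in the gray bound. -/
lemma lagrangian_le (h : PreparedBandit K β η C w arm) {u v : ℝ} (huv : u ≤ v) :
    lagrangian β K C w v ≤ lagrangian β K C w u + K / (1 - β) * (v - u) := by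
  have hb : 0 < 1 - β := sub_pos.2 h.beta_lt_one
  have h1 : ∑ i, (C i).value β v (w i) ≤ ∑ i, ((C i).value β u (w i) + (v - u) / (1 - β)) :=
    Finset.sum_le_sum fun i _ =>
      (value_mono (h.admissible i) h.beta_nonneg h.beta_lt_one huv (h.belief_mem i)).2
  rw [Finset.sum_add_distrib, Finset.sum_const, Finset.card_univ, Fintype.card_fin,
    nsmul_eq_mul] at h1
  unfold lagrangian
  have : (N : ℝ) * ((v - u) / (1 - β)) - v * (N - K) / (1 - β) =
      K / (1 - β) * (v - u) - u * (N - K) / (1 - β) := by field_simp; ring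
  linarith

/-- To the left of 0 the values are constant and only the term -m(N-K)/(1-β) varies; K < N makes the
inequality strict. This starts the invariant of the sweep. -/
lemma lagrangian_zero_lt (h : PreparedBandit K β η C w arm) (hm : m < 0) :
    lagrangian β K C w 0 < lagrangian β K C w m := by
  have hb : 0 < 1 - β := sub_pos.2 h.beta_lt_one
  have hNK : (0 : ℝ) < N - K := sub_pos.2 (Nat.cast_lt.2 h.lt)
  unfold lagrangian
  rw [Finset.sum_congr rfl fun i _ => value_of_nonpos (h.admissible i) h.beta_nonneg
    h.beta_lt_one hm.le (h.belief_mem i)]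
  have : m * (N - K) / (1 - β) < 0 := div_neg_of_neg_of_pos (mul_neg_of_neg_of_pos hm hNK) hb
  rw [zero_mul, zero_div]
  linarith

lemma lagrangian_of_one_le (h : PreparedBandit K β η C w arm) (hm : 1 ≤ m) :
    lagrangian β K C w m = m * (K / (1 - β)) := by
  have hb : 1 - β ≠ 0 := (sub_pos.2 h.beta_lt_one).ne'
  unfold lagrangian
  rw [Finset.sum_congr rfl fun i _ => value_of_B_le (h.admissible i) h.beta_nonneg
    h.beta_lt_one ((h.admissible i).B_mem.2.trans hm) (h.belief_mem i), Finset.sum_const,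
    Finset.card_univ, Fintype.card_fin, nsmul_eq_mul]
  field_simp
  ring

/-- The right derivative of the Lagrangian as it is computed by the algorithm. -/
def slope (K : ℕ) (β : ℝ) (arm : Fin N → Arm) (u : ℝ) : ℝ :=
  ∑ i, (income β 1 0 ((arm i).at u)).val - (N - K) / (1 - β)

lemma totalPassive_ofFn (κ u : ℝ) (hκ : κ = ((N : ℝ) - K) / (1 - β)) :
    (totalPassive β ((List.ofFn arm).map fun a => a.at u)).val - κ = slope K β arm u := by
  rw [totalPassive_val, List.map_map, List.map_ofFn, List.sum_ofFn, slope, hκ]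
  rfl

lemma totalValue_ofFn (h : PreparedBandit K β η C w arm) {u : ℝ} (hu : ∀ i, (arm i).Clear u) :
    (totalValue β u ((List.ofFn arm).map fun a => a.at u)).val = ∑ i, (C i).value β u (w i) := by
  rw [totalValue_val, List.map_map, List.map_ofFn, List.sum_ofFn]
  refine Finset.sum_congr rfl fun i _ => ?_
  rw [value_eq_income (h.admissible i) h.beta_nonneg h.beta_lt_one (h.memory_lt_one i)
    (h.belief_mem i) (h.prepared i) (hu i)]
  have : ((arm i).at u).c = C i := (h.prepared i).c_eq
  simp only [Function.comp_apply, this]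

lemma lagrangian_subgradient (h : PreparedBandit K β η C w arm) {u : ℝ}
    (hu : ∀ i, (arm i).Clear u) (μ : ℝ) :
    lagrangian β K C w u + slope K β arm u * (μ - u) ≤ lagrangian β K C w μ := by
  have h1 : ∑ i, ((C i).value β u (w i) + (income β 1 0 ((arm i).at u)).val * (μ - u)) ≤
      ∑ i, (C i).value β μ (w i) :=
    Finset.sum_le_sum fun i _ => value_subgradient (h.admissible i) h.beta_nonneg h.beta_lt_one
      (h.memory_lt_one i) (h.belief_mem i) (h.prepared i) (hu i) μ
  rw [Finset.sum_add_distrib, ← Finset.sum_mul] at h1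
  unfold lagrangian slope
  have : μ * (N - K : ℝ) / (1 - β) = u * (N - K : ℝ) / (1 - β) + (N - K) / (1 - β) * (μ - u) := by
    ring
  linarith

/-- All calculated indices. -/
def points (arm : Fin N → Arm) : Set ℝ := {s | ∃ i, s ∈ (arm i).points}

/-- The end points of gray areas are calculated indices and so do not lie inside a region; a gray
area that meets a region contains it. -/
lemma clear_of_region {u v : ℝ} (h : PreparedBandit K β η C w arm) (hR : Region (points arm) u v)
    (hG : ¬ Gray (List.ofFn arm) u v) (hm : m ∈ Ico u v) (i : Fin N) : (arm i).Clear m := by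
  intro g hg
  have hi : arm i ∈ List.ofFn arm := List.mem_ofFn.2 ⟨i, rfl⟩
  have h1 : g.1 ∈ points arm := ⟨i, by
    rcases (h.prepared i).gray_mem g hg with h | h <;> simp [Arm.points, h]⟩
  have h2 : g.2 ∈ points arm := ⟨i, by simp [Arm.points, hg]⟩
  by_cases hu : g.1 ≤ u
  · right
    have hv : g.2 < v := not_le.1 fun hv => hG ⟨arm i, hi, g, hg, hu, hv⟩
    exact ((hR.2 _ h2).resolve_right hv.not_ge).trans hm.1
  · left
    exact hm.2.trans_le ((hR.2 _ h1).resolve_left hu)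

lemma at_eq_of_region {u v : ℝ} (hR : Region (points arm) u v) (hm : m ∈ Ico u v) (i : Fin N) :
    (arm i).at m = (arm i).at u := by
  have key : ∀ s ∈ (arm i).points, s ≤ m ↔ s ≤ u := fun s hs =>
    ⟨fun h => (hR.2 s ⟨i, hs⟩).resolve_right (h.trans_lt hm.2).not_ge, fun h => h.trans hm.1⟩
  unfold Arm.at
  rw [Track.at_congr (t := (arm i).t01) fun s hs => key s (by simp [Arm.points, hs]),
    Track.at_congr (t := (arm i).t11) fun s hs => key s (by simp [Arm.points, hs]),
    Track.at_congr (t := (arm i).t1) fun s hs => key s (by simp [Arm.points, hs])]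

/-- On a region outside the gray area, the Lagrangian is affine. -/
lemma lagrangian_right_end {u v : ℝ} (h : PreparedBandit K β η C w arm)
    (hR : Region (points arm) u v) (huv : u < v) (hG : ¬ Gray (List.ofFn arm) u v) :
    lagrangian β K C w v = lagrangian β K C w u + slope K β arm u * (v - u) := by
  have hval : ∀ m ∈ Ico u v, ∀ i, (C i).value β m (w i) =
      m * (income β 1 0 ((arm i).at u)).val + (income β 0 (C i).B ((arm i).at u)).val :=
    fun m hm i => by
      rw [value_eq_income (h.admissible i) h.beta_nonneg h.beta_lt_one (h.memory_lt_one i)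
        (h.belief_mem i) (h.prepared i) (h.clear_of_region hR hG hm i), at_eq_of_region hR hm i,
        income_affine]
  have hon : EqOn (lagrangian β K C w)
      (fun m => lagrangian β K C w u + slope K β arm u * (m - u)) (Ico u v) := by
    intro m hm
    simp only [lagrangian, slope]
    rw [Finset.sum_congr rfl fun i _ => hval m hm i,
      Finset.sum_congr rfl fun i _ => hval u ⟨le_rfl, huv⟩ i, Finset.sum_add_distrib,
      Finset.sum_add_distrib, ← Finset.mul_sum, ← Finset.mul_sum]
    ring
  -- The crossing data are constant on [u, v) only; continuity extends the affine formula to v.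
  have := hon.closure h.continuous_lagrangian (by fun_prop)
  rw [closure_Ico huv.ne] at this
  exact this ⟨huv.le, le_rfl⟩

/-- The Lagrangian decreases strictly up to some point from which on everything up to `u` lies in
the gray areas. -/
def DecreasingUpTo (K : ℕ) (β : ℝ) (C : Fin N → Channel) (w : Fin N → ℝ) (arm : Fin N → Arm)
    (u : ℝ) : Prop :=
  ∃ m₀ ≤ u, (∀ m < m₀, lagrangian β K C w m₀ < lagrangian β K C w m) ∧
    ∀ m ∈ Ico m₀ u, ∃ i g, (arm i).gray = some g ∧ m ∈ Ico g.1 g.2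

/-- The properties of the subsidy that the sweep finds. -/
structure Found (K : ℕ) (β : ℝ) (C : Fin N → Channel) (w : Fin N → ℝ) (arm : Fin N → Arm)
    (u : ℝ) : Prop where
  clear : ∀ i, (arm i).Clear u
  le : ∀ m, u ≤ m → lagrangian β K C w u ≤ lagrangian β K C w m
  decreasing : DecreasingUpTo K β C w arm u

/-- Skipping a gray region extends the gray tail of `DecreasingUpTo`; a negative slope moves m₀ to
the right end of the region; a nonnegative slope is a subgradient that settles everything to the
right. -/
lemma exists_found (h : PreparedBandit K β η C w arm) {κ : ℝ} (hκ : κ = ((N : ℝ) - K) / (1 - β))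
    {l : List ℝ} (hl : (0 :: (l ++ [1])).Pairwise (· ≤ ·)) (hp : ∀ s ∈ points arm, s ∈ l)
    {u₀ : ℝ} (hu₀ : u₀ ≤ 0) :
    ∃ m, (sweep β κ (0 :: (l ++ [1])) ((List.ofFn arm).map fun a => a.at u₀)).val =
      (m, (List.ofFn arm).map fun a => a.at m) ∧ Found K β C w arm m := by
  refine sweep_spec (S := points arm) (e := 1) (Inv := DecreasingUpTo K β C w arm)
    ?_ ?_ ?_ ?_ (l ++ [1]) 0 u₀ hu₀ hl ?_ (fun s hs => Or.inr ?_) ?_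
  · rintro u v hR hG ⟨m₀, hm₀, h1, h2⟩
    refine ⟨m₀, hm₀.trans hR.1, h1, fun m hm => ?_⟩
    rcases lt_or_ge m u with hmu | hmu
    · exact h2 m ⟨hm.1, hmu⟩
    · obtain ⟨a, ha, g, hg, hg1, hg2⟩ := hG (hmu.trans_lt hm.2)
      obtain ⟨i, rfl⟩ := List.mem_ofFn.1 ha
      exact ⟨i, g, hg, hg1.trans hmu, hm.2.trans_le hg2⟩
  · rintro u v hR huv hG - hD
    rw [totalPassive_ofFn κ u hκ] at hD
    -- The affine piece on [u, v] supports the Lagrangian globally and has negative slope, so all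
    -- values to the left of v exceed the one at v, even those in gray areas passed before.
    refine ⟨v, le_rfl, fun m hm => ?_, fun m hm => absurd hm (by simp)⟩
    rw [h.lagrangian_right_end hR huv hG]
    refine lt_of_lt_of_le ?_
      (h.lagrangian_subgradient (fun i => h.clear_of_region hR hG ⟨le_rfl, huv⟩ i) m)
    have := mul_lt_mul_of_neg_left (sub_lt_sub_right hm u) hD
    linarith
  · rintro u v hR huv hG hI hD
    rw [totalPassive_ofFn κ u hκ] at hD
    have hcl : ∀ i, (arm i).Clear u := fun i => h.clear_of_region hR hG ⟨le_rfl, huv⟩ i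
    refine ⟨hcl, fun m hm => ?_, hI⟩
    have := h.lagrangian_subgradient hcl m
    have := mul_nonneg hD (sub_nonneg.2 hm)
    linarith
  · intro hI
    -- At the last entry 1 all gray areas have ended, and from there on the Lagrangian is m K/(1-β).
    refine ⟨fun i g hg => Or.inr ((h.prepared i).gray_le g hg).2, fun m hm => ?_, hI⟩
    rw [h.lagrangian_of_one_le le_rfl, h.lagrangian_of_one_le hm]
    have hb : 0 < 1 - β := sub_pos.2 h.beta_lt_one
    gcongr
  · rw [← List.cons_append, List.getLast?_append]; simp
  · exact List.mem_append_left _ (hp s hs)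
  · exact ⟨0, le_rfl, fun m hm => h.lagrangian_zero_lt hm, fun m hm => absurd hm (by simp)⟩

/-- An interval covered by N intervals of length at most η has length at most Nη; subadditivity of
Lebesgue measure handles the overlaps. -/
lemma gray_length_le (h : PreparedBandit K β η C w arm) (hη : 0 ≤ η) {m₀ u : ℝ}
    (hg : ∀ m ∈ Ico m₀ u, ∃ i g, (arm i).gray = some g ∧ m ∈ Ico g.1 g.2) : u - m₀ ≤ N * η := by
  set I : Fin N → Set ℝ := fun i => match (arm i).gray with
    | none => ∅
    | some g => Ico g.1 g.2 with hI
  have hvol : ∀ i, MeasureTheory.volume (I i) ≤ ENNReal.ofReal η := fun i => by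
    simp only [hI]
    split
    · simp
    · next g hg =>
      rw [Real.volume_Ico]
      exact ENNReal.ofReal_le_ofReal ((h.prepared i).gray_length g hg)
  have hsub : Ico m₀ u ⊆ ⋃ i, I i := fun m hm => by
    obtain ⟨i, g, hg1, hg2⟩ := hg m hm
    refine mem_iUnion.2 ⟨i, ?_⟩
    simp only [hI, hg1]
    exact hg2
  have h1 : ENNReal.ofReal (u - m₀) ≤ ENNReal.ofReal (N * η) := by
    rw [← Real.volume_Ico]
    calc MeasureTheory.volume (Ico m₀ u) ≤ ∑ i, MeasureTheory.volume (I i) :=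
          (MeasureTheory.measure_mono hsub).trans (MeasureTheory.measure_iUnion_fintype_le _ _)
      _ ≤ ∑ _i : Fin N, ENNReal.ofReal η := Finset.sum_le_sum fun i _ => hvol i
      _ = ENNReal.ofReal (N * η) := by
          rw [Finset.sum_const, Finset.card_univ, Fintype.card_fin, nsmul_eq_mul,
            ENNReal.ofReal_mul (Nat.cast_nonneg N), ENNReal.ofReal_natCast]
  exact (ENNReal.ofReal_le_ofReal_iff (by positivity)).1 h1

/-- Compared with m₀, or with a point of [m₀, u), the Lagrangian at u is larger by at most its
growth rate times the length of the gray tail; points left of m₀ are worse than m₀. -/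
lemma Found.lagrangian_le {u : ℝ} (hu : Found K β C w arm u) (h : PreparedBandit K β η C w arm)
    (hη : 0 ≤ η) (m : ℝ) :
    lagrangian β K C w u ≤ lagrangian β K C w m + K / (1 - β) * (N * η) := by
  have hb : 0 < 1 - β := sub_pos.2 h.beta_lt_one
  have hC : (0 : ℝ) ≤ K / (1 - β) := by positivity
  rcases le_or_gt u m with hm | hm
  · have := hu.le m hm
    have : 0 ≤ (K : ℝ) / (1 - β) * (N * η) := by positivity
    linarith
  · obtain ⟨m₀, hm₀, h1, h2⟩ := hu.decreasing
    have h3 := mul_le_mul_of_nonneg_left (h.gray_length_le hη h2) hC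
    rcases lt_or_ge m m₀ with hmm | hmm
    · have := h.lagrangian_le hm₀
      linarith [h1 m hmm]
    · have h4 := h.lagrangian_le hm.le
      have := mul_le_mul_of_nonneg_left (sub_le_sub_left hmm u) hC
      linarith

/-- With no gray areas the gray tail is empty, which forces m₀ = u. -/
lemma Found.exact {u : ℝ} (hu : Found K β C w arm u) (hg : ∀ i, (arm i).gray = none) :
    (∀ m, lagrangian β K C w u ≤ lagrangian β K C w m) ∧
      ∀ m < u, lagrangian β K C w u < lagrangian β K C w m := by
  obtain ⟨m₀, hm₀, h1, h2⟩ := hu.decreasing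
  have : m₀ = u := hm₀.eq_of_not_lt fun hlt => by
    obtain ⟨i, g, hg', -⟩ := h2 m₀ ⟨le_rfl, hlt⟩
    rw [hg i] at hg'
    exact absurd hg' (by simp)
  rw [this] at h1
  exact ⟨fun m => (lt_or_ge m u).elim (fun hm => (h1 m hm).le) (hu.le m), h1⟩

end PreparedBandit

/-! ### The algorithm -/

/-- The length of a gray area that the algorithm allows. -/
def grayBound (ε β : ℝ) (N K : ℕ) : ℝ := ε * (1 - β) / K / N

lemma sum_le_of_forall_le {l : List Arm} {b : ℕ} (h : ∀ a ∈ l, a.size ≤ b) :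
    totalSize l ≤ l.length * b := by
  have := List.sum_le_card_nsmul (l.map Arm.size) b (by simpa using h)
  simpa [totalSize] using this

section

variable {ε β : ℝ} {N K : ℕ} {c : Fin N → Channel} {ω : Fin N → ℝ}

lemma preparedBandit (hε : 0 < ε) (hβ₀ : 0 ≤ β) (hβ₁ : β < 1) (hK : 1 ≤ K) (hKN : K < N)
    (hc : ∀ i, (c i).Admissible) (hx : ∀ i, (c i).memory < 1) (hω : ∀ i, ω i ∈ Icc (0 : ℝ) 1) :
    PreparedBandit K β (grayBound ε β N K) c ω
      fun i => (prepareArm β (grayBound ε β N K) (c i) (ω i)).val := by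
  have hb : 0 < 1 - β := by linarith
  have hK' : (0 : ℝ) < K := by exact_mod_cast hK
  have hN' : (0 : ℝ) < N := hK'.trans (by exact_mod_cast hKN)
  obtain ⟨n₀, hn₀⟩ := pow_unbounded_of_one_lt (3 / (1 - β) ^ 3) (one_lt_two (α := ℝ))
  refine ⟨hβ₀, hβ₁, hKN, hc, hx, hω, fun i => ?_⟩
  exact prepareArm_spec (hc i) hβ₀ hβ₁ (hx i) (hω i) (by unfold grayBound; positivity) hn₀.le

lemma upperBoundAlgorithm_val (hε : 0 < ε) (hβ₀ : 0 ≤ β) (hβ₁ : β < 1) (hK : 1 ≤ K) (hKN : K < N)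
    (hc : ∀ i, (c i).Admissible) (hx : ∀ i, (c i).memory < 1) (hω : ∀ i, ω i ∈ Icc (0 : ℝ) 1) :
    ∃ m, (upperBoundAlgorithm ε β N K (List.ofFn fun i => (c i, ω i))).val =
      (m, lagrangian β K c ω m) ∧ PreparedBandit.Found K β c ω
        (fun i => (prepareArm β (grayBound ε β N K) (c i) (ω i)).val) m := by
  have hB := preparedBandit hε hβ₀ hβ₁ hK hKN hc hx hω
  set η := grayBound ε β N K with hη
  set arm : Fin N → Arm := fun i => (prepareArm β η (c i) (ω i)).val with harm
  set κ : ℝ := ((N : ℝ) - K) / (1 - β) with hκ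
  set input := List.ofFn fun i => (c i, ω i) with hinput
  have harms : (prepare β η input).val = List.ofFn arm := by
    rw [prepare_val, hinput, List.map_ofFn]; rfl
  set ws := (collect (List.ofFn arm)).val with hws
  obtain ⟨hperm, hsort, -⟩ := mergeSort_spec (count ws).val ws (by rw [count_val])
  set ws' := (mergeSort (count ws).val ws).val with hws'
  have hmem : ∀ s, s ∈ ws' ↔ s ∈ PreparedBandit.points arm := fun s => by
    rw [hperm.mem_iff, hws, collect_val]
    simp [PreparedBandit.points, List.mem_ofFn]
  have hpts : ∀ i, ∀ s ∈ (arm i).points, s ∈ Icc (0 : ℝ) 1 := by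
    intro i s hs
    have hst : ∀ {z : ℝ} {t : Track}, z ∈ Icc (0 : ℝ) 1 → t.Starts β (c i) z → s ∈ t.rest →
        s ∈ Icc (0 : ℝ) 1 := by
      rintro z t hz ⟨-, -, n, hr⟩ hs
      rw [hr, mem_whittleList] at hs
      obtain ⟨k, -, rfl⟩ := hs
      exact ⟨whittle_nonneg (hc i) hβ₀ hβ₁ (hx i) ((hc i).iterate_mem hz k),
        whittle_le_one (hc i) hβ₀ hβ₁ (hx i) ((hc i).iterate_mem hz k)⟩
    have hp := hB.prepared i
    simp only [Arm.points, List.mem_append, Option.mem_toList,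
      Option.map_eq_some_iff] at hs
    rcases hs with ⟨g, hg, rfl⟩ | hs | hs | hs
    · exact hp.gray_le g hg
    · exact hst (hω i) hp.t1 hs
    · exact hst (hc i).p11_mem hp.t11 hs
    · exact hst (hc i).p01_mem hp.t01 hs
  have hIcc : ∀ s ∈ ws', s ∈ Icc (0 : ℝ) 1 := fun s hs => by
    obtain ⟨i, hi⟩ := (hmem s).1 hs
    exact hpts i s hi
  have hpair : (0 :: (ws' ++ [1])).Pairwise (· ≤ ·) := by
    refine List.pairwise_cons.2 ⟨fun s hs => ?_, List.pairwise_append.2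
      ⟨hsort, List.pairwise_singleton _ _, fun a ha b hb => ?_⟩⟩
    · rcases List.mem_append.1 hs with hs | hs
      · exact (hIcc s hs).1
      · rw [List.mem_singleton.1 hs]; exact zero_le_one
    · rw [List.mem_singleton.1 hb]; exact (hIcc a ha).2
  -- All indices are nonnegative, so the untouched arms are the arms at subsidy -1; this fits them
  -- into the loop rule.
  have hstart : (List.ofFn arm).map (fun a => a.at (-1)) = List.ofFn arm := by
    rw [List.map_ofFn]
    congr 1
    funext i
    have hlt : ∀ s ∈ (arm i).points, (-1 : ℝ) < s := fun s hs => by linarith [(hpts i s hs).1]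
    simp only [Function.comp_apply, Arm.at]
    rw [Track.at_eq_self fun s hs => hlt s (by simp [Arm.points, hs]),
      Track.at_eq_self fun s hs => hlt s (by simp [Arm.points, hs]),
      Track.at_eq_self fun s hs => hlt s (by simp [Arm.points, hs])]
  obtain ⟨m, hm, hfound⟩ := hB.exists_found hκ hpair (fun s hs => (hmem s).2 hs)
    (u₀ := -1) (by norm_num)
  rw [hstart] at hm
  refine ⟨m, ?_, hfound⟩
  have hgrid : (prepend ws' [1]).val = ws' ++ [1] := prepend_val _ _
  have hη' : ε * (1 - β) / K / N = η := rfl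
  simp only [upperBoundAlgorithm, Timed.bind_val, Timed.sub_val, Timed.mul_val, Timed.div_val,
    Timed.const_val, Timed.one_val, Timed.pure_val, hη', harms, ← hws, ← hws', hgrid, ← hκ, hm,
    hB.totalValue_ofFn hfound.clear, lagrangian]
  rw [hκ, mul_div_assoc]

/-- The factor b + 1 leaves room for the upper end of the gray area of each arm, and n + 2 for the
additional entries 0 and 1 of the grid. -/
lemma upperBoundAlgorithm_steps {s : ℕ} {b : ℕ} {n : ℕ} (k : ℕ)
    (hsteps : ∀ i, (prepareArm β (grayBound ε β N K) (c i) (ω i)).steps ≤ s)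
    (hsize : ∀ i, (prepareArm β (grayBound ε β N K) (c i) (ω i)).val.size ≤ b)
    (hn : N * (b + 1) = n) (hk : n ≤ 2 ^ k) :
    (upperBoundAlgorithm ε β N K (List.ofFn fun i => (c i, ω i))).steps ≤
      ((s + 1) * N + 136 * N + 5 * n + 8 * n * k + (142 * N + 10) * (n + 2) + 17 : ℕ) := by
  set η := grayBound ε β N K with hη
  set arm : Fin N → Arm := fun i => (prepareArm β η (c i) (ω i)).val with harm
  set κ : ℝ := ((N : ℝ) - K) / (1 - β) with hκ
  have harms : (prepare β η (List.ofFn fun i => (c i, ω i))).val = List.ofFn arm := by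
    rw [prepare_val, List.map_ofFn]; rfl
  have hlen : (List.ofFn arm).length = N := List.length_ofFn
  set ws := (collect (List.ofFn arm)).val with hws
  have hts : totalSize (List.ofFn arm) ≤ N * b := by
    have := sum_le_of_forall_le (l := List.ofFn arm) (b := b) fun a ha => by
      obtain ⟨i, rfl⟩ := List.mem_ofFn.1 ha
      exact hsize i
    rwa [hlen] at this
  have hwl : ws.length ≤ n := by
    have := length_collect_le (List.ofFn arm)
    rw [hlen] at this
    rw [← hn, Nat.mul_succ]
    exact this.trans (by omega)
  obtain ⟨hperm, -, hms⟩ := mergeSort_spec (count ws).val ws (by rw [count_val])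
  set ws' := (mergeSort (count ws).val ws).val with hws'
  have hwl' : ws'.length ≤ n := by rw [hperm.length_eq]; exact hwl
  have hgrid : (prepend ws' [1]).val = ws' ++ [1] := prepend_val _ _
  obtain ⟨i₁, hi₁, hi₁'⟩ := Timed.exists_steps (prepare_steps (β := β) (η := η) (b := s)
    (l := List.ofFn fun i => (c i, ω i)) fun p hp => by
      obtain ⟨i, rfl⟩ := List.mem_ofFn.1 hp
      exact hsteps i)
  rw [List.length_ofFn] at hi₁'
  obtain ⟨i₂, hi₂, hi₂'⟩ := Timed.exists_steps (collect_steps (List.ofFn arm))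
  obtain ⟨i₃, hi₃, hi₃'⟩ := Timed.exists_steps (hms k (hwl.trans hk))
  obtain ⟨i₄, hi₄, hi₄'⟩ := Timed.exists_steps (sweep_steps β κ (0 :: (ws' ++ [1])) (List.ofFn arm))
  set sw := (sweep β κ (0 :: (ws' ++ [1])) (List.ofFn arm)).val with hsw
  obtain ⟨i₅, hi₅, hi₅'⟩ := Timed.exists_steps (totalValue_steps β sw.1 sw.2)
  have hswl : sw.2.length = N := by rw [hsw, length_sweep, hlen]
  rw [hswl] at hi₅'
  rw [hlen] at hi₂' hi₄'
  simp only [List.length_cons, List.length_append, List.length_nil] at hi₄'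
  have hη' : ε * (1 - β) / K / N = η := rfl
  simp only [upperBoundAlgorithm, Timed.bind_steps, Timed.sub_val, Timed.sub_steps,
    Timed.mul_steps, Timed.mul_val, Timed.div_val, Timed.div_steps, Timed.const_val,
    Timed.const_steps, Timed.one_val, Timed.one_steps, Timed.pure_steps, hη', harms, ← hws, ← hws',
    hgrid, ← hκ, ← hsw, hi₁, hi₂, hi₃, hi₄, hi₅, count_steps, prepend_steps]
  norm_cast
  have h1 : 8 * ws.length * k ≤ 8 * n * k := by gcongr
  have h2 : (142 * N + 10) * (ws'.length + (0 + 1) + 1) ≤ (142 * N + 10) * (n + 2) :=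
    Nat.mul_le_mul_left _ (by omega)
  have h3 : N * b ≤ n := by rw [← hn, Nat.mul_succ]; omega
  omega

end

/-- An elementary bound for the number of steps. -/
lemma step_bound {N l n₀ D k : ℕ} (hl : 1 ≤ l) (hlN : l ≤ N) (hk : k ≤ D * l) :
    (126 * n₀ + 252 * k + 1400 + 1) * N + 136 * N + 5 * (N * (2 * k + 6)) +
      8 * (N * (2 * k + 6)) * (l + (2 * k + 6)) + (142 * N + 10) * (N * (2 * k + 6) + 2) + 17 ≤
      (126 * n₀ + 8 * ((2 * D + 6) * (2 * D + 7)) + 283 * (2 * D + 6) + 1858) * (N ^ 2 * l) := by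
  set E := 2 * D + 6 with hE
  set q := 2 * k + 6 with hq
  have hqE : q ≤ E * l := by rw [hq, hE]; nlinarith
  have hN : 1 ≤ N := hl.trans hlN
  have a1 : N ≤ N ^ 2 * l := by nlinarith [Nat.le_self_pow two_ne_zero N]
  have a2 : N * l ≤ N ^ 2 * l := by
    have := Nat.mul_le_mul_right l (Nat.le_self_pow two_ne_zero N); exact this
  have a3 : N * (l * l) ≤ N ^ 2 * l := by
    calc N * (l * l) ≤ N * (N * l) := by gcongr
      _ = _ := by ring
  have a4 : 1 ≤ N ^ 2 * l := hN.trans a1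
  have b1 : N * q ≤ E * (N ^ 2 * l) := by
    calc N * q ≤ N * (E * l) := by gcongr
      _ = E * (N * l) := by ring
      _ ≤ _ := by gcongr
  have b2 : N * q * (l + q) ≤ E * (2 * D + 7) * (N ^ 2 * l) := by
    calc N * q * (l + q) ≤ N * (E * l) * (l + E * l) := by gcongr
      _ = E * (2 * D + 7) * (N * (l * l)) := by rw [hE]; ring
      _ ≤ _ := by gcongr
  have b3 : N * (N * q) ≤ E * (N ^ 2 * l) := by
    calc N * (N * q) ≤ N * (N * (E * l)) := by gcongr
      _ = _ := by ring
  have b4 : N * k ≤ E * (N ^ 2 * l) := (Nat.mul_le_mul_left N (by omega)).trans b1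
  have b5 : n₀ * N ≤ n₀ * (N ^ 2 * l) := by gcongr
  generalize N ^ 2 * l = X at *
  nlinarith

end ChannelAccess

/-! ### Choice of the constants and proof of the theorem -/

open ChannelAccess in
theorem theorem3 (ε β ρ : ℝ) (hε : 0 < ε) (hβ₀ : 0 ≤ β) (hβ₁ : β < 1) (hρ : ρ < 1) :
    ∃ C : ℝ, ∀ (N K : ℕ) (c : Fin N → ChannelAccess.Channel) (ω : Fin N → ℝ),
      1 ≤ K → K < N →
      (∀ i, (c i).Admissible) →
      (∀ i, (c i).p11 - (c i).p01 ≤ ρ) →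
      (∀ i, ω i ∈ Set.Icc (0 : ℝ) 1) →
      ∃ (m' G : ℝ) (T : ℕ),
        ChannelAccess.upperBoundAlgorithm ε β N K (List.ofFn fun i => (c i, ω i)) =
          ⟨(m', G), (T : ℕ∞)⟩ ∧
        (T : ℝ) ≤ C * ((N : ℝ) ^ 2 * Real.log N) ∧
        G = ChannelAccess.lagrangian β K c ω m' ∧
        |G - ChannelAccess.relaxedBound β K c ω| ≤ ε ∧
        ((∀ i, (c i).p11 < (c i).p01) →
          G = ChannelAccess.relaxedBound β K c ω ∧
          IsLeast {m : ℝ | ChannelAccess.lagrangian β K c ω m =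
            ChannelAccess.relaxedBound β K c ω} m') := by
  have hb : 0 < 1 - β := by linarith
  obtain ⟨n₀, hn₀⟩ := pow_unbounded_of_one_lt (3 / (1 - β) ^ 3) (one_lt_two (α := ℝ))
  -- Since ρ may be zero or negative, it is replaced by a positive rate below 1.
  set r : ℝ := max ρ (1 / 2) with hr
  have hr0 : 0 < r := lt_max_of_lt_right (by norm_num)
  have hr1 : r < 1 := max_lt hρ (by norm_num)
  obtain ⟨A, hA⟩ := exists_pow_lt_of_lt_one (show (0 : ℝ) < 1 / 2 by norm_num) hr1
  obtain ⟨B, hB⟩ := exists_pow_lt_of_lt_one (show (0 : ℝ) < ε * (1 - β) / 2 ^ n₀ by positivity) hr1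
  set D := B + 2 * A with hD
  set M := 126 * n₀ + 8 * ((2 * D + 6) * (2 * D + 7)) + 283 * (2 * D + 6) + 1858 with hM
  refine ⟨M * (2 / Real.log 2), fun N K c ω hK hKN hc hx hω => ?_⟩
  have hx' : ∀ i, (c i).memory < 1 := fun i => (hx i).trans_lt hρ
  have hP := preparedBandit hε hβ₀ hβ₁ hK hKN hc hx' hω
  obtain ⟨m, hval, hfound⟩ := upperBoundAlgorithm_val hε hβ₀ hβ₁ hK hKN hc hx' hω
  have hK' : (0 : ℝ) < K := by exact_mod_cast hK
  have hKN' : (K : ℝ) ≤ N := by exact_mod_cast hKN.le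
  have hN' : (0 : ℝ) < N := hK'.trans_le hKN'
  have hη : 0 < grayBound ε β N K := by unfold grayBound; positivity
  set l := Nat.clog 2 N with hl
  have hl1 : 1 ≤ l := Nat.clog_pos one_lt_two (by omega)
  have hN2l : N ≤ 2 ^ l := Nat.le_pow_clog one_lt_two N
  have hlN : l ≤ N := (Nat.clog_le_iff_le_pow one_lt_two).2 Nat.lt_two_pow_self.le
  -- The factor r^(2Al) is at most 1/N² and r^B absorbs ε(1-β)/2^n₀. As K ≤ N, this pushes r^k below
  -- η/2^n₀, so k = O(log N) bounds all crossing times.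
  set k := B + 2 * A * l with hk
  have hkD : k ≤ D * l := by
    rw [hk, hD, add_mul]
    exact Nat.add_le_add_right (Nat.le_mul_of_pos_right B hl1) _
  have hpow : r ^ k < grayBound ε β N K / 2 ^ n₀ := by
    have hNl : (N : ℝ) ≤ 2 ^ l := by exact_mod_cast hN2l
    have h1 : (r ^ A) ^ (2 * l) ≤ 1 / (N : ℝ) ^ 2 := by
      calc (r ^ A) ^ (2 * l) ≤ (1 / 2) ^ (2 * l) := by gcongr
        _ = 1 / ((2 : ℝ) ^ l) ^ 2 := by rw [one_div_pow, ← pow_mul, mul_comm l]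
        _ ≤ _ := by gcongr
    calc r ^ k = r ^ B * (r ^ A) ^ (2 * l) := by rw [hk, pow_add, ← pow_mul]; ring_nf
      _ ≤ r ^ B * (1 / (N : ℝ) ^ 2) := by gcongr
      _ < ε * (1 - β) / 2 ^ n₀ * (1 / (N : ℝ) ^ 2) := by gcongr
      _ = ε * (1 - β) / N / N / 2 ^ n₀ := by field_simp
      _ ≤ grayBound ε β N K / 2 ^ n₀ := by unfold grayBound; gcongr
  have hbd := fun i => prepareArm_bounds (hc i) hβ₀ hβ₁ (hx' i) (hω i) hη hn₀.le
    ((hx i).trans (le_max_left ρ (1 / 2))) hpow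
  have hH : N * (2 * k + 5 + 1) ≤ 2 ^ (l + (2 * k + 6)) := by
    rw [pow_add]
    exact Nat.mul_le_mul hN2l Nat.lt_two_pow_self.le
  obtain ⟨T, hT, hT'⟩ := Timed.exists_steps (upperBoundAlgorithm_steps (l + (2 * k + 6))
    (fun i => (hbd i).2) (fun i => (hbd i).1) rfl hH)
  have hTM : T ≤ M * (N ^ 2 * l) := hT'.trans (step_bound hl1 hlN hkD)
  have hfl := fun μ => hfound.lagrangian_le hP hη.le μ
  have hεeq : (K : ℝ) / (1 - β) * (N * grayBound ε β N K) = ε := by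
    unfold grayBound; field_simp
  rw [hεeq] at hfl
  have hbdd : BddBelow (Set.range (lagrangian β K c ω)) :=
    ⟨lagrangian β K c ω m - ε, by rintro _ ⟨μ, rfl⟩; linarith [hfl μ]⟩
  have hge : relaxedBound β K c ω ≤ lagrangian β K c ω m := ciInf_le hbdd m
  refine ⟨m, lagrangian β K c ω m, T, ?_, ?_, rfl, ?_, fun hneg => ?_⟩
  · rw [← hval, ← hT]
  · have hlog2 : 0 < Real.log 2 := Real.log_pos one_lt_two
    have hlN2 : (l : ℝ) ≤ 2 / Real.log 2 * Real.log N := by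
      have h1 : 2 ^ (l - 1) < N := Nat.pow_pred_clog_lt_self one_lt_two (by omega)
      have h2 : ((l : ℝ) - 1) * Real.log 2 ≤ Real.log N := by
        have h3 : ((2 : ℝ) ^ (l - 1)) ≤ N := by exact_mod_cast h1.le
        have h4 := Real.log_le_log (by positivity) h3
        rwa [Real.log_pow, Nat.cast_sub hl1, Nat.cast_one] at h4
      -- From (l - 1) log 2 ≤ log N and N ≥ 2 one gets l log 2 ≤ 2 log N, which explains the factor
      -- 2 / log 2 in the constant.
      have h5 : Real.log 2 ≤ Real.log N :=
        Real.log_le_log two_pos (by exact_mod_cast (by omega : 2 ≤ N))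
      rw [div_mul_eq_mul_div, le_div_iff₀ hlog2]
      linarith
    calc (T : ℝ) ≤ M * ((N : ℝ) ^ 2 * l) := by exact_mod_cast hTM
      _ ≤ M * ((N : ℝ) ^ 2 * (2 / Real.log 2 * Real.log N)) := by gcongr
      _ = _ := by ring
  · rw [abs_of_nonneg (sub_nonneg.2 hge)]
    have : lagrangian β K c ω m - ε ≤ relaxedBound β K c ω :=
      le_ciInf fun μ => by linarith [hfl μ]
    linarith
  · obtain ⟨h1, h2⟩ := hfound.exact fun i => (hP.prepared i).gray_neg (hneg i)
    have heq : lagrangian β K c ω m = relaxedBound β K c ω := le_antisymm (le_ciInf h1) hge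
    refine ⟨heq, heq, fun μ hμ => ?_⟩
    by_contra! hlt
    exact (h2 μ hlt).ne (heq.trans hμ.symm)

end
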